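/- Let $n\ge 1$, $s\in(0,1)$, $T>0$, and let $\Omega\subset\mathbb{R}^n$ be open and bounded. Let $A:\mathbb{R}^n\to\mathbb{R}^{n\times n}$ be measurable, symmetric, bounded and uniformly elliptic: there are $0<\lambda_{\min}\le\lambda_{\max}<\infty$ with $\lambda_{\min}|\mathbf v|^2\le \mathbf v\cdot A(x)\mathbf v\le\lambda_{\max}|\mathbf v|^2$ for all $x,\mathbf v\in\mathbb{R}^n$. Let $$H^s_\Omega=\Big\{v\in L^2(\mathbb{R}^n):\ v=0 \text{ a.e. in } \mathbb{R}^n\setminus\Omega,\ \|v\|_{H^s_\Omega}^2:=\int_{\mathbb{R}^n}\!\int_{\mathbb{R}^n}\frac{|v(x)-v(y)|^2}{|x-y|^{n+2s}}\,dx\,dy<\infty\Big\},$$ and let $(H^s_\Omega)'$ be its dual with the operator norm. Put $$C_{n,s}=\frac{4^s\,\Gamma(s+\frac n2)}{\pi^{n/2}|\Gamma(-s)|},\qquad C_\omega=\frac{2^s\,\Gamma(\frac{n+s+1}2)}{\pi^{n/2}\,\Gamma(\frac{1-s}2)},\qquad \omega(x,y)=C_\omega|x-y|^{-(n+s)},\qquad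 \alpha(x,y)=\frac{y-x}{|y-x|},$$ $$\mathcal G_\omega u(x)=\lim_{\varepsilon\to0^+}\int_{|y-x|\ge\varepsilon}\omega(x,y)\,(u(y)-u(x))\,\alpha(x,y)\,dy\quad\text{(limit in } L^2(\mathbb{R}^n;\mathbb{R}^n)),\qquad \mathcal B_{\omega;A}(u,v)=\int_{\mathbb{R}^n}\mathcal G_\omega u(x)\cdot A(x)\,\mathcal G_\omega v(x)\,dx .$$ The limit $\mathcal G_\omega v$ exists for every $v\in H^s_\Omega$, and $H^s_\Omega$ satisfies a Poincaré inequality: there is a constant $C_p$ with $\|v\|_{L^2(\Omega)}\le C_p\|v\|_{H^s_\Omega}$ for all $v\in H^s_\Omega$. Let $f\in L^2(0,T;(H^s_\Omega)')$ and $u_0\in H^s_\Omega$. Then there is a unique $u^*\in L^2(0,T;H^s_\Omega)$, with weak time derivative $\partial_t u^*\in L^2(0,T;(H^s_\Omega)')$ and with a representative in $C([0,T];L^2(\Omega))$, such that $u^*(\cdot,0)=u_0$ and, for almost every $t\in(0,T)$, $$\langle\partial_t u^*(t),v\rangle+\mathcal B_{\omega;A}(u^*(t),v)=\langle f(t),v\rangle\qquad\text{for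 all } v\in H^s_\Omega .$$ Moreover, with $C_{\rm coer}=\frac{C_{n,s}}2\lambda_{\min}$ and any constant $C_p\ge\sqrt2$ for which the Poincaré inequality above holds, the continuous representative of $u^*$ satisfies, for all $t\in[0,T]$, $$\|u^*(\cdot,t)\|_{L^2(\Omega)}^2+C_{\rm coer}\int_0^t\|u^*(\cdot,r)\|_{H^s_\Omega}^2\,dr\ \le\ \|u_0\|_{L^2(\Omega)}^2+\frac{C_p^2}{2C_{\rm coer}}\int_0^t\|f(\cdot,r)\|_{(H^s_\Omega)'}^2\,dr .$$ -/

import Mathlib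

open MeasureTheory Filter Topology
open scoped ContDiff

noncomputable section

namespace FracDiff

/-- The Euclidean space `ℝⁿ`. -/
abbrev Eucl (n : ℕ) : Type := EuclideanSpace ℝ (Fin n)

/-- The space `L²(ℝⁿ)`. -/
abbrev L2 (n : ℕ) : Type := Lp ℝ 2 (volume : Measure (Eucl n))

/-! ### The fractional Sobolev space with zero exterior values -/

/-- The weighted difference quotient `(v(x) - v(y)) / |x - y|^(n/2 + s)`. -/
def diffQuot {n : ℕ} (s : ℝ) (v : Eucl n → ℝ) (p : Eucl n × Eucl n) : ℝ :=
  (v p.1 - v p.2) / ‖p.1 - p.2‖ ^ ((n : ℝ) / 2 + s)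

theorem diffQuot_congr {n : ℕ} (s : ℝ) {v w : Eucl n → ℝ} (h : v =ᵐ[volume] w) :
    diffQuot s v =ᵐ[volume.prod volume] diffQuot s w := by
  have h1 := (Measure.quasiMeasurePreserving_fst
    (μ := (volume : Measure (Eucl n))) (ν := (volume : Measure (Eucl n)))).ae_eq h
  have h2 := (Measure.quasiMeasurePreserving_snd
    (μ := (volume : Measure (Eucl n))) (ν := (volume : Measure (Eucl n)))).ae_eq h
  filter_upwards [h1, h2] with p hp1 hp2
  simp only [Function.comp] at hp1 hp2
  simp [diffQuot, hp1, hp2]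

theorem diffQuot_add {n : ℕ} (s : ℝ) (v w : L2 n) :
    diffQuot s (v + w : L2 n) =ᵐ[volume.prod volume] diffQuot s v + diffQuot s w := by
  refine (diffQuot_congr s (Lp.coeFn_add v w)).trans (Eventually.of_forall fun p => ?_)
  simp only [diffQuot, Pi.add_apply]
  ring

theorem diffQuot_smul {n : ℕ} (s c : ℝ) (v : L2 n) :
    diffQuot s (c • v : L2 n) =ᵐ[volume.prod volume] c • diffQuot s v := by
  refine (diffQuot_congr s (Lp.coeFn_smul c v)).trans (Eventually.of_forall fun p => ?_)
  simp only [diffQuot, Pi.smul_apply, smul_eq_mul]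
  ring

/-- `H^s_Ω(ℝⁿ)` as a subspace of `L²(ℝⁿ)`: the functions `v` that vanish almost everywhere outside
`Ω` and satisfy `∬ |v(x) - v(y)|² / |x - y|^(n + 2s) dx dy < ∞`. -/
def hsSubmodule {n : ℕ} (s : ℝ) (Ω : Set (Eucl n)) : Submodule ℝ (L2 n) where
  carrier := {v | MemLp (diffQuot s v) 2 (volume.prod volume) ∧ ∀ᵐ x, x ∉ Ω → v x = 0}
  zero_mem' := by
    refine ⟨?_, ?_⟩
    · refine (memLp_congr_ae (diffQuot_congr s (Lp.coeFn_zero ℝ 2 volume))).2 ?_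
      have : diffQuot s (0 : Eucl n → ℝ) = 0 := by
        funext p
        simp [diffQuot]
      rw [this]
      exact MemLp.zero
    · filter_upwards [Lp.coeFn_zero ℝ 2 (volume : Measure (Eucl n))] with x hx _
      exact hx
  add_mem' := by
    rintro v w ⟨hv, hv'⟩ ⟨hw, hw'⟩
    refine ⟨(memLp_congr_ae (diffQuot_add s v w)).2 (hv.add hw), ?_⟩
    filter_upwards [Lp.coeFn_add v w, hv', hw'] with x hx h1 h2 hxΩ
    rw [hx, Pi.add_apply, h1 hxΩ, h2 hxΩ, add_zero]
  smul_mem' := by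
    rintro c v ⟨hv, hv'⟩
    refine ⟨(memLp_congr_ae (diffQuot_smul s c v)).2 (hv.const_smul c), ?_⟩
    filter_upwards [Lp.coeFn_smul c v, hv'] with x hx h1 hxΩ
    rw [hx, Pi.smul_apply, h1 hxΩ, smul_zero]

/-- The space `H^s_Ω(ℝⁿ)`. It is a type of its own so that it carries the norm of `H^s_Ω` defined
below and not the norm of `L²(ℝⁿ)`. -/
def Hs {n : ℕ} (s : ℝ) (Ω : Set (Eucl n)) : Type := hsSubmodule s Ω

instance {n : ℕ} (s : ℝ) (Ω : Set (Eucl n)) : AddCommGroup (Hs s Ω) :=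
  inferInstanceAs (AddCommGroup (hsSubmodule s Ω))

instance {n : ℕ} (s : ℝ) (Ω : Set (Eucl n)) : Module ℝ (Hs s Ω) :=
  inferInstanceAs (Module ℝ (hsSubmodule s Ω))

/-- The inclusion of `H^s_Ω(ℝⁿ)` in `L²(ℝⁿ)`. -/
def Hs.toL2 {n : ℕ} {s : ℝ} {Ω : Set (Eucl n)} : Hs s Ω →ₗ[ℝ] L2 n :=
  (hsSubmodule s Ω).subtype

theorem Hs.memLp_diffQuot {n : ℕ} {s : ℝ} {Ω : Set (Eucl n)} (v : Hs s Ω) :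
    MemLp (diffQuot s (Hs.toL2 v)) 2 (volume.prod volume) :=
  v.2.1

/-- The difference quotient as a linear map from `H^s_Ω(ℝⁿ)` to `L²(ℝⁿ × ℝⁿ)`. -/
def Hs.quot {n : ℕ} {s : ℝ} {Ω : Set (Eucl n)} :
    Hs s Ω →ₗ[ℝ] Lp ℝ 2 ((volume : Measure (Eucl n)).prod (volume : Measure (Eucl n))) where
  toFun v := (Hs.memLp_diffQuot v).toLp
  map_add' v w :=
    ((MemLp.toLp_eq_toLp_iff (Hs.memLp_diffQuot (v + w))
      ((Hs.memLp_diffQuot v).add (Hs.memLp_diffQuot w))).2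
      (diffQuot_add s (Hs.toL2 v) (Hs.toL2 w))).trans
      (MemLp.toLp_add (Hs.memLp_diffQuot v) (Hs.memLp_diffQuot w))
  map_smul' c v :=
    ((MemLp.toLp_eq_toLp_iff (Hs.memLp_diffQuot (c • v))
      ((Hs.memLp_diffQuot v).const_smul c)).2
      (diffQuot_smul s c (Hs.toL2 v))).trans
      (MemLp.toLp_const_smul c (Hs.memLp_diffQuot v))

/-- The norm `‖v‖² = ∬ |v(x) - v(y)|² / |x - y|^(n + 2s) dx dy` of `H^s_Ω(ℝⁿ)`. -/
instance {n : ℕ} (s : ℝ) (Ω : Set (Eucl n)) : SeminormedAddCommGroup (Hs s Ω) :=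
  SeminormedAddCommGroup.induced (Hs s Ω) (Lp ℝ 2 ((volume : Measure (Eucl n)).prod (volume : Measure (Eucl n))))
    Hs.quot

/-- The inner product `∬ (v(x) - v(y)) (w(x) - w(y)) / |x - y|^(n + 2s) dx dy`. -/
instance {n : ℕ} (s : ℝ) (Ω : Set (Eucl n)) : InnerProductSpace ℝ (Hs s Ω) where
  toModule := inferInstanceAs (Module ℝ (Hs s Ω))
  norm_smul_le c v := by
    change ‖Hs.quot (c • v)‖ ≤ ‖c‖ * ‖Hs.quot v‖
    rw [map_smul, norm_smul]
  inner v w := inner ℝ (Hs.quot v) (Hs.quot w)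
  norm_sq_eq_re_inner v := norm_sq_eq_re_inner (𝕜 := ℝ) (Hs.quot v)
  conj_inner_symm v w := inner_conj_symm (𝕜 := ℝ) (Hs.quot v) (Hs.quot w)
  add_left u v w := by
    rw [map_add, inner_add_left]
  smul_left u v c := by
    rw [map_smul, inner_smul_left]

/-! ### The weighted nonlocal gradient and the anisotropic form -/

/-- `C_{n,s} = 4^s Γ(s + n/2) / (π^(n/2) |Γ(-s)|)`. -/
def fracLapConst (n : ℕ) (s : ℝ) : ℝ :=
  4 ^ s * Real.Gamma (s + n / 2) / (Real.pi ^ ((n : ℝ) / 2) * |Real.Gamma (-s)|)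

/-- The constant `C_ω` of the weight: the normalization for which the composition of the weighted
divergence and gradient is `-(-Δ)^s`. -/
def weightConst (n : ℕ) (s : ℝ) : ℝ :=
  2 ^ s * Real.Gamma ((n + s + 1) / 2) / (Real.pi ^ ((n : ℝ) / 2) * Real.Gamma ((1 - s) / 2))

/-- The weight `ω(x, y) = C_ω |x - y|^(-(n + s))`. -/
def weight {n : ℕ} (s : ℝ) (x y : Eucl n) : ℝ :=
  weightConst n s * ‖x - y‖ ^ (-((n : ℝ) + s))

/-- The antisymmetric vector function `α(x, y) = (y - x) / |y - x|`. -/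
def direction {n : ℕ} (x y : Eucl n) : Eucl n :=
  ‖y - x‖⁻¹ • (y - x)

/-- The integral `∫ ω(x, y) (u(y) - u(x)) α(x, y) dy` over `|y - x| ≥ ε`. -/
def truncGrad {n : ℕ} (s ε : ℝ) (u : Eucl n → ℝ) (x : Eucl n) : Eucl n :=
  ∫ y in (Metric.ball x ε)ᶜ, (weight s x y * (u y - u x)) • direction x y

/-- `g` is the weighted gradient `𝒢_ω u(x) = ∫ ω(x, y) (u(y) - u(x)) α(x, y) dy`. For a general `u`
in `H^s` the integral does not converge absolutely; it is a principal value, and the limit is taken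
in `L²(ℝⁿ; ℝⁿ)`. -/
def HasWeightedGrad {n : ℕ} (s : ℝ) (u : L2 n) (g : Lp (Eucl n) 2 (volume : Measure (Eucl n))) :
    Prop :=
  Tendsto (fun ε : ℝ => eLpNorm (fun x => truncGrad s ε u x - g x) 2 volume) (𝓝[>] 0) (𝓝 0)

open Classical in
/-- The weighted gradient `𝒢_ω u` (zero if it does not exist). -/
def weightedGrad {n : ℕ} (s : ℝ) (u : L2 n) : Lp (Eucl n) 2 (volume : Measure (Eucl n)) :=
  if h : ∃ g, HasWeightedGrad s u g then h.choose else 0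

/-- The tensor field `A` is measurable, symmetric, bounded and uniformly elliptic, with
`lmin |v|² ≤ v · A(x) v ≤ lmax |v|²`. -/
structure IsEllipticTensor {n : ℕ} (A : Eucl n → Matrix (Fin n) (Fin n) ℝ) (lmin lmax : ℝ) :
    Prop where
  measurable : ∀ i j, Measurable fun x => A x i j
  symm : ∀ x, (A x).IsSymm
  pos : 0 < lmin
  le : lmin ≤ lmax
  lower : ∀ x v, lmin * ‖v‖ ^ 2 ≤ inner ℝ v (Matrix.toEuclideanLin (A x) v)
  upper : ∀ x v, inner ℝ v (Matrix.toEuclideanLin (A x) v) ≤ lmax * ‖v‖ ^ 2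

/-- The form `ℬ_{ω;A}(u, v) = ∫ 𝒢_ω u(x) · A(x) 𝒢_ω v(x) dx`. -/
def anisoForm {n : ℕ} (s : ℝ) (A : Eucl n → Matrix (Fin n) (Fin n) ℝ) (u v : L2 n) : ℝ :=
  ∫ x, inner ℝ (weightedGrad s u x) (Matrix.toEuclideanLin (A x) (weightedGrad s v x))

/-! ### Weak solutions of the parabolic problem -/

/-- Lebesgue measure on the time interval `(0, T)`. -/
def timeMeasure (T : ℝ) : Measure ℝ := volume.restrict (Set.Ioo 0 T)

/-- `w` is the weak time derivative of `u` on `(0, T)`, with values in the dual of `H^s_Ω`. The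
`L²(Ω)` inner product is that of `L²(ℝⁿ)`, as elements of `H^s_Ω` vanish outside `Ω`. -/
def IsTimeDeriv {n : ℕ} {s : ℝ} {Ω : Set (Eucl n)} (T : ℝ) (u : ℝ → Hs s Ω)
    (w : ℝ → StrongDual ℝ (Hs s Ω)) : Prop :=
  ∀ φ : ℝ → ℝ, ContDiff ℝ ∞ φ → HasCompactSupport φ → tsupport φ ⊆ Set.Ioo 0 T →
    ∀ v : Hs s Ω, ∫ t, deriv φ t * inner ℝ (Hs.toL2 (u t)) (Hs.toL2 v) ∂(timeMeasure T) =
      -∫ t, φ t * w t v ∂(timeMeasure T)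

/-- `U` is the representative of `u` that is continuous on `[0, T]` with values in `L²`. -/
def IsContRep {n : ℕ} {s : ℝ} {Ω : Set (Eucl n)} (T : ℝ) (u : ℝ → Hs s Ω) (U : ℝ → L2 n) : Prop :=
  ContinuousOn U (Set.Icc 0 T) ∧ ∀ᵐ t ∂(timeMeasure T), U t = Hs.toL2 (u t)

/-- `u ∈ L²(0, T; H^s_Ω)` has a weak derivative `∂ₜ u ∈ L²(0, T; (H^s_Ω)')`, satisfies
`⟨∂ₜ u, v⟩ + ℬ_{ω;A}(u, v) = f(v)` for all `v ∈ H^s_Ω` at almost every time, and `u(0) = u₀`. -/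
structure IsWeakSolution {n : ℕ} {s : ℝ} {Ω : Set (Eucl n)}
    (A : Eucl n → Matrix (Fin n) (Fin n) ℝ) (T : ℝ) (f : ℝ → StrongDual ℝ (Hs s Ω))
    (u₀ : Hs s Ω) (u : ℝ → Hs s Ω) : Prop where
  memLp : MemLp u 2 (timeMeasure T)
  equation : ∃ w : ℝ → StrongDual ℝ (Hs s Ω), MemLp w 2 (timeMeasure T) ∧ IsTimeDeriv T u w ∧
    ∀ᵐ t ∂(timeMeasure T), ∀ v : Hs s Ω,
      w t v + anisoForm s A (Hs.toL2 (u t)) (Hs.toL2 v) = f t v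
  initial : ∃ U : ℝ → L2 n, IsContRep T u U ∧ U 0 = Hs.toL2 u₀

/-- The Poincaré inequality `‖v‖_{L²(Ω)} ≤ C ‖v‖_{H^s_Ω}` on `H^s_Ω`. -/
def PoincareOn {n : ℕ} (s : ℝ) (Ω : Set (Eucl n)) (C : ℝ) : Prop :=
  ∀ v : Hs s Ω, ‖Hs.toL2 v‖ ≤ C * ‖v‖

end FracDiff

end

/-! A function in `H^s_Ω` is integrable, because `Ω` is bounded, and on such functions both the norm
of `H^s_Ω` and the gradient `𝒢_ω` are diagonalised by the Fourier transform. The squared norm is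
`∫ k(ξ) |v̂(ξ)|² dξ`, where `k(ξ) = ∫ |e^{2πi⟨h, ξ⟩} - 1|² |h|^{-(n+2s)} dh` is proportional to
`|ξ|^{2s}`, and the truncated gradients are convolutions whose multipliers are bounded by a
multiple of `|ξ|^s` and converge to `i (2π|ξ|)^s ξ/|ξ|`. Writing powers of `|h|` as superpositions
of Gaussians gives the two constants. Hence `𝒢_ω v` exists and `‖𝒢_ω v‖² = (C_{n,s}/2) ‖v‖²`, so
that `ℬ_{ω;A}` is a bounded symmetric form on the Hilbert space `H^s_Ω`, coercive with constant
`C_{n,s} λ_min / 2`.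

The equation is then an abstract one, `(ι†ι u)' + B u = F` with `ι : H^s_Ω → L²(ℝⁿ)` the inclusion
and `B` the operator of the form; subtracting `u₀`, one may take `u(0) = 0`. In terms of `h = u'`,
the left-hand side is `h ↦ ι†ι h + B ∫₀ᵗ h`. Since `B` is symmetric and positive, pairing this with
`h` shows that its range is dense, and pairing it with `∫₀ᵗ h` bounds `∫₀ᵗ h` by the right-hand
side, so solutions for a dense set of right-hand sides have limits. Uniqueness follows by
integrating the equation in time and testing with `∫₀ᵗ u`, and the energy estimate from the product
rule and `2⟨f, u⟩ ≤ c⁻¹ ‖f‖² + c ‖u‖²`. -/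

noncomputable section

namespace FracDiff

/-! ### Primitives on a time interval -/

section ProductRule

variable {E F G : Type*} [NormedAddCommGroup E] [NormedSpace ℝ E] [CompleteSpace E]
  [NormedAddCommGroup F] [NormedSpace ℝ F] [CompleteSpace F]
  [NormedAddCommGroup G] [NormedSpace ℝ G] [CompleteSpace G]

theorem integral_bilin_Iic_add_integral_bilin_Iio {μ : Measure ℝ} [SFinite μ]
    (L : E →L[ℝ] F →L[ℝ] G) {a : ℝ → E} {b : ℝ → F} (ha : Integrable a μ) (hb : Integrable b μ) :
    (∫ r, L (∫ q in Set.Iic r, a q ∂μ) (b r) ∂μ) + ∫ r, L (a r) (∫ q in Set.Iio r, b q ∂μ) ∂μ =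
      L (∫ r, a r ∂μ) (∫ r, b r ∂μ) := by
  have hK : Integrable (fun z : ℝ × ℝ => L (a z.1) (b z.2)) (μ.prod μ) :=
    ha.op_fst_snd (by fun_prop) ⟨‖L‖, L.le_opNorm₂⟩ hb
  have hS : MeasurableSet {z : ℝ × ℝ | z.1 ≤ z.2} := measurableSet_le measurable_fst measurable_snd
  have hlower : ∫ z in {z : ℝ × ℝ | z.1 ≤ z.2}, L (a z.1) (b z.2) ∂(μ.prod μ) =
      ∫ r, L (∫ q in Set.Iic r, a q ∂μ) (b r) ∂μ := by
    rw [← integral_indicator hS, integral_prod_symm _ (hK.indicator hS)]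
    refine integral_congr_ae (Eventually.of_forall fun r => ?_)
    exact (integral_indicator (f := fun q => L (a q) (b r)) measurableSet_Iic).trans
      ((L.flip (b r)).integral_comp_comm ha.restrict)
  have hupper : ∫ z in {z : ℝ × ℝ | z.1 ≤ z.2}ᶜ, L (a z.1) (b z.2) ∂(μ.prod μ) =
      ∫ r, L (a r) (∫ q in Set.Iio r, b q ∂μ) ∂μ := by
    rw [← integral_indicator hS.compl, integral_prod _ (hK.indicator hS.compl)]
    refine integral_congr_ae (Eventually.of_forall fun r => ?_)
    have hsection : ∀ q, Set.indicator {z : ℝ × ℝ | z.1 ≤ z.2}ᶜ (fun z => L (a z.1) (b z.2)) (r, q)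
        = Set.indicator (Set.Iio r) (fun q => L (a r) (b q)) q := fun q => by
      simp [Set.indicator_apply]
    simp only [hsection]
    rw [integral_indicator measurableSet_Iio]
    exact (L (a r)).integral_comp_comm hb.restrict
  rw [← hlower, ← hupper, integral_add_compl hS hK, integral_prod_bilin L ha hb]

theorem intervalIntegral_bilin_primitive_add {t : ℝ} (ht : 0 ≤ t) (L : E →L[ℝ] F →L[ℝ] G)
    {a : ℝ → E} {b : ℝ → F} (ha : IntervalIntegrable a volume 0 t)
    (hb : IntervalIntegrable b volume 0 t) :
    (∫ r in (0 : ℝ)..t, L (∫ q in (0 : ℝ)..r, a q) (b r)) +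
      ∫ r in (0 : ℝ)..t, L (a r) (∫ q in (0 : ℝ)..r, b q) =
    L (∫ r in (0 : ℝ)..t, a r) (∫ r in (0 : ℝ)..t, b r) := by
  rw [intervalIntegrable_iff_integrableOn_Ioc_of_le ht] at ha hb
  simp only [intervalIntegral.integral_of_le ht]
  rw [← integral_bilin_Iic_add_integral_bilin_Iio L ha hb]
  congr 1 <;> refine setIntegral_congr_fun measurableSet_Ioc fun r hr => ?_
  · have hIoc : Set.Iic r ∩ Set.Ioc 0 t = Set.Ioc 0 r := by
      rw [Set.inter_comm, Set.Ioc_inter_Iic, min_eq_right hr.2]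
    simp only [Measure.restrict_restrict measurableSet_Iic, hIoc,
      intervalIntegral.integral_of_le hr.1.le]
  · have hIoo : Set.Iio r ∩ Set.Ioc 0 t = Set.Ioo 0 r := by
      ext q
      simp only [Set.mem_inter_iff, Set.mem_Iio, Set.mem_Ioc, Set.mem_Ioo]
      exact ⟨fun h => ⟨h.2.1, h.1⟩, fun h => ⟨h.2, h.1, h.2.le.trans hr.2⟩⟩
    simp only [Measure.restrict_restrict measurableSet_Iio, hIoo,
      intervalIntegral.integral_of_le hr.1.le, integral_Ioc_eq_integral_Ioo]

theorem two_mul_intervalIntegral_bilin_primitive {t : ℝ} (ht : 0 ≤ t) (L : E →L[ℝ] E →L[ℝ] ℝ)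
    (hL : ∀ x y, L x y = L y x) {a : ℝ → E} (ha : IntervalIntegrable a volume 0 t) :
    2 * ∫ r in (0 : ℝ)..t, L (∫ q in (0 : ℝ)..r, a q) (a r) =
      L (∫ r in (0 : ℝ)..t, a r) (∫ r in (0 : ℝ)..t, a r) := by
  rw [← intervalIntegral_bilin_primitive_add ht L ha ha, two_mul]
  simp only [hL (a _)]

end ProductRule

section TimeMeasure

variable {E : Type*} [NormedAddCommGroup E] {T t : ℝ}

instance (T : ℝ) : IsFiniteMeasure (timeMeasure T) :=
  inferInstanceAs (IsFiniteMeasure (volume.restrict _))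

theorem intervalIntegrable_of_timeMeasure (ht : t ∈ Set.Icc 0 T) {a : ℝ → E}
    (ha : Integrable a (timeMeasure T)) : IntervalIntegrable a volume 0 t := by
  rw [intervalIntegrable_iff_integrableOn_Ioo_of_le ht.1]
  exact IntegrableOn.mono_set ha (Set.Ioo_subset_Ioo le_rfl ht.2)

theorem restrict_Iic_timeMeasure (ht : t ∈ Set.Icc 0 T) :
    (timeMeasure T).restrict (Set.Iic t) = volume.restrict (Set.Ioc 0 t) := by
  rw [timeMeasure, Measure.restrict_congr_set Ioo_ae_eq_Ioc,
    Measure.restrict_restrict measurableSet_Iic, Set.inter_comm, Set.Ioc_inter_Iic,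
    min_eq_right ht.2]

theorem ae_timeMeasure_mem (T : ℝ) : ∀ᵐ t ∂(timeMeasure T), t ∈ Set.Icc 0 T := by
  filter_upwards [ae_restrict_mem measurableSet_Ioo] with t ht using Set.Ioo_subset_Icc_self ht

theorem memLp_timeMeasure_of_continuousOn {a : ℝ → E} (ha : ContinuousOn a (Set.Icc 0 T))
    (p : ENNReal) : MemLp a p (timeMeasure T) := by
  obtain ⟨C, hC⟩ := isCompact_Icc.exists_bound_of_continuousOn ha
  refine MemLp.of_bound ?_ C ?_
  · exact (ha.aestronglyMeasurable measurableSet_Icc).mono_measure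
      (Measure.restrict_mono_set _ Set.Ioo_subset_Icc_self)
  · filter_upwards [ae_timeMeasure_mem T] with t ht using hC t ht

theorem integrable_timeMeasure_of_continuousOn {a : ℝ → E} (ha : ContinuousOn a (Set.Icc 0 T)) :
    Integrable a (timeMeasure T) :=
  memLp_one_iff_integrable.1 (memLp_timeMeasure_of_continuousOn ha 1)

theorem eqOn_of_ae_timeMeasure (hT : 0 < T) {a b : ℝ → E} (ha : ContinuousOn a (Set.Icc 0 T))
    (hb : ContinuousOn b (Set.Icc 0 T)) (h : a =ᵐ[timeMeasure T] b) :
    Set.EqOn a b (Set.Icc 0 T) := by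
  rw [timeMeasure, restrict_Ioo_eq_restrict_Icc] at h
  exact Measure.eqOn_Icc_of_ae_eq volume hT.ne h ha hb

theorem integrable_Lp_timeMeasure (h : Lp E 2 (timeMeasure T)) : Integrable h (timeMeasure T) :=
  (Lp.memLp h).integrable one_le_two

variable [NormedSpace ℝ E]

theorem integral_Iic_timeMeasure (ht : t ∈ Set.Icc 0 T) (a : ℝ → E) :
    ∫ r in Set.Iic t, a r ∂(timeMeasure T) = ∫ r in (0 : ℝ)..t, a r := by
  rw [restrict_Iic_timeMeasure ht, intervalIntegral.integral_of_le ht.1]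

theorem integral_timeMeasure (hT : 0 ≤ T) (a : ℝ → E) :
    ∫ r, a r ∂(timeMeasure T) = ∫ r in (0 : ℝ)..T, a r := by
  rw [timeMeasure, intervalIntegral.integral_of_le hT, integral_Ioc_eq_integral_Ioo]

theorem intervalIntegral_congr_timeMeasure (ht : t ∈ Set.Icc 0 T) {a b : ℝ → E}
    (h : a =ᵐ[timeMeasure T] b) : ∫ r in (0 : ℝ)..t, a r = ∫ r in (0 : ℝ)..t, b r := by
  rw [← integral_Iic_timeMeasure ht, ← integral_Iic_timeMeasure ht]
  exact integral_congr_ae (ae_restrict_of_ae h)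

theorem continuousOn_primitive_timeMeasure {a : ℝ → E} (ha : Integrable a (timeMeasure T)) :
    ContinuousOn (fun t => ∫ r in (0 : ℝ)..t, a r) (Set.Icc 0 T) := by
  rcases le_or_gt 0 T with hT | hT
  · rw [← Set.uIcc_of_le hT]
    refine intervalIntegral.continuousOn_primitive_interval ?_
    rwa [Set.uIcc_of_le hT, integrableOn_Icc_iff_integrableOn_Ioo]
  · simp [Set.Icc_eq_empty hT.not_ge]

end TimeMeasure

/-! ### Parabolic equations in Hilbert spaces -/

section Volterra

variable {V : Type*} [NormedAddCommGroup V] [InnerProductSpace ℝ V] {T t : ℝ}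

/-- The primitive of `h ∈ L²(0, T; V)` that vanishes at time `0`. -/
def primitive (h : Lp V 2 (timeMeasure T)) (t : ℝ) : V := ∫ r in (0 : ℝ)..t, h r

theorem continuousOn_primitive (h : Lp V 2 (timeMeasure T)) :
    ContinuousOn (primitive h) (Set.Icc 0 T) :=
  continuousOn_primitive_timeMeasure (integrable_Lp_timeMeasure h)

theorem primitive_add (ht : t ∈ Set.Icc 0 T) (h k : Lp V 2 (timeMeasure T)) :
    primitive (h + k) t = primitive h t + primitive k t := by
  rw [primitive, intervalIntegral_congr_timeMeasure ht (Lp.coeFn_add h k)]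
  exact intervalIntegral.integral_add
    (intervalIntegrable_of_timeMeasure ht (integrable_Lp_timeMeasure h))
    (intervalIntegrable_of_timeMeasure ht (integrable_Lp_timeMeasure k))

theorem primitive_sub (ht : t ∈ Set.Icc 0 T) (h k : Lp V 2 (timeMeasure T)) :
    primitive (h - k) t = primitive h t - primitive k t := by
  rw [eq_sub_iff_add_eq, ← primitive_add ht, sub_add_cancel]

theorem primitive_smul (ht : t ∈ Set.Icc 0 T) (c : ℝ) (h : Lp V 2 (timeMeasure T)) :
    primitive (c • h) t = c • primitive h t := by
  rw [primitive, intervalIntegral_congr_timeMeasure ht (Lp.coeFn_smul c h)]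
  exact intervalIntegral.integral_smul _ _

/-- The Volterra operator `h ↦ ∫₀ᵗ h(r) dr` on `L²(0, T; V)`. -/
def volterra (V : Type*) [NormedAddCommGroup V] [InnerProductSpace ℝ V] (T : ℝ) :
    Lp V 2 (timeMeasure T) →ₗ[ℝ] Lp V 2 (timeMeasure T) where
  toFun h := (memLp_timeMeasure_of_continuousOn (continuousOn_primitive h) 2).toLp
  map_add' h k := by
    rw [← MemLp.toLp_add, MemLp.toLp_eq_toLp_iff]
    filter_upwards [ae_timeMeasure_mem T] with t ht using primitive_add ht h k
  map_smul' c h := by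
    rw [RingHom.id_apply, ← MemLp.toLp_const_smul, MemLp.toLp_eq_toLp_iff]
    filter_upwards [ae_timeMeasure_mem T] with t ht using primitive_smul ht c h

theorem coeFn_volterra (h : Lp V 2 (timeMeasure T)) :
    volterra V T h =ᵐ[timeMeasure T] primitive h :=
  (memLp_timeMeasure_of_continuousOn (continuousOn_primitive h) 2).coeFn_toLp

/-- The restriction map `L²(0, T; V) → L²(0, t; V)`. -/
def restrictTime (V : Type*) [NormedAddCommGroup V] [InnerProductSpace ℝ V] (T t : ℝ) :
    Lp V 2 (timeMeasure T) →L[ℝ] Lp V 2 ((timeMeasure T).restrict (Set.Iic t)) :=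
  LpToLpRestrictCLM ℝ V ℝ (timeMeasure T) 2 (Set.Iic t)

theorem norm_restrictTime_le (h : Lp V 2 (timeMeasure T)) : ‖restrictTime V T t h‖ ≤ ‖h‖ :=
  norm_Lp_toLp_restrict_le _ h

theorem inner_restrictTime (ht : t ∈ Set.Icc 0 T) (a b : Lp V 2 (timeMeasure T)) :
    inner ℝ (restrictTime V T t a) (restrictTime V T t b) =
      ∫ r in (0 : ℝ)..t, inner ℝ (a r) (b r) := by
  rw [L2.inner_def, ← integral_Iic_timeMeasure ht]
  refine integral_congr_ae ?_
  filter_upwards [LpToLpRestrictCLM_coeFn ℝ (Set.Iic t) a,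
    LpToLpRestrictCLM_coeFn ℝ (Set.Iic t) b] with r hra hrb
  rw [restrictTime, hra, hrb]

theorem intervalIntegral_inner_const (ht : t ∈ Set.Icc 0 T) (a : Lp V 2 (timeMeasure T)) (v : V) :
    ∫ r in (0 : ℝ)..t, inner ℝ (a r) v =
      inner ℝ (restrictTime V T t a) (restrictTime V T t (memLp_const v).toLp) := by
  rw [inner_restrictTime ht]
  refine intervalIntegral_congr_timeMeasure ht ?_
  filter_upwards [(memLp_const (μ := timeMeasure T) v).coeFn_toLp] with r hr
  rw [hr]

theorem inner_L2_timeMeasure (hT : 0 ≤ T) (a b : Lp V 2 (timeMeasure T)) :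
    inner ℝ a b = ∫ r in (0 : ℝ)..T, inner ℝ (a r) (b r) := by
  rw [L2.inner_def, integral_timeMeasure hT]

theorem two_mul_intervalIntegral_inner_volterra [CompleteSpace V] (ht : t ∈ Set.Icc 0 T)
    {S : V →L[ℝ] V} (hS : ∀ x y, inner ℝ (S x) y = inner ℝ x (S y)) (h : Lp V 2 (timeMeasure T)) :
    2 * ∫ r in (0 : ℝ)..t, inner ℝ (volterra V T h r) (S.compLpL 2 (timeMeasure T) h r) =
      inner ℝ (primitive h t) (S (primitive h t)) := by
  have hprod := two_mul_intervalIntegral_bilin_primitive ht.1 ((innerSL ℝ).comp S)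
    (fun x y => by
      simp only [ContinuousLinearMap.comp_apply, innerSL_apply_apply]
      rw [hS, real_inner_comm])
    (intervalIntegrable_of_timeMeasure ht (integrable_Lp_timeMeasure h))
  simp only [ContinuousLinearMap.comp_apply, innerSL_apply_apply, hS] at hprod
  rw [primitive, ← hprod]
  congr 1
  refine intervalIntegral_congr_timeMeasure ht ?_
  filter_upwards [coeFn_volterra h, S.coeFn_compLpL h] with r hvolterra hcomp
  rw [hvolterra, hcomp, primitive]

end Volterra

section Evolution

open scoped InnerProduct

variable {V H : Type*} [NormedAddCommGroup V] [InnerProductSpace ℝ V] [CompleteSpace V]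
  [NormedAddCommGroup H] [InnerProductSpace ℝ H] [CompleteSpace H] {T t : ℝ}

/-- The operator `ι†ι` on `V`, which represents the inner product of `H` by that of `V`. -/
def gram (ι : V →L[ℝ] H) : V →L[ℝ] V := (ι†).comp ι

theorem inner_gram_right (ι : V →L[ℝ] H) (x y : V) :
    inner ℝ x (gram ι y) = inner ℝ (ι x) (ι y) :=
  ι.adjoint_inner_right x (ι y)

theorem inner_gram_left (ι : V →L[ℝ] H) (x y : V) :
    inner ℝ (gram ι x) y = inner ℝ (ι x) (ι y) :=
  ι.adjoint_inner_left y (ι x)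

theorem gram_symm (ι : V →L[ℝ] H) (x y : V) :
    inner ℝ (gram ι x) y = inner ℝ x (gram ι y) := by
  rw [inner_gram_left, inner_gram_right]

theorem two_mul_intervalIntegral_inner_gram (ι : V →L[ℝ] H) (ht : t ∈ Set.Icc 0 T)
    (h : Lp V 2 (timeMeasure T)) :
    2 * ∫ r in (0 : ℝ)..t, inner ℝ (volterra V T h r) ((gram ι).compLpL 2 (timeMeasure T) h r) =
      ‖ι (primitive h t)‖ ^ 2 := by
  rw [two_mul_intervalIntegral_inner_volterra ht (gram_symm ι), inner_gram_right,
    real_inner_self_eq_norm_sq]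

theorem inner_primitive_eq_intervalIntegral_gram (ι : V →L[ℝ] H) (ht : t ∈ Set.Icc 0 T)
    (h : Lp V 2 (timeMeasure T)) (v : V) :
    inner ℝ (ι (primitive h t)) (ι v) =
      ∫ r in (0 : ℝ)..t, inner ℝ ((gram ι).compLpL 2 (timeMeasure T) h r) v := by
  rw [← inner_gram_right, real_inner_comm]
  refine ((innerSL ℝ (gram ι v)).intervalIntegral_comp_comm
    (intervalIntegrable_of_timeMeasure ht (integrable_Lp_timeMeasure h))).symm.trans
    (intervalIntegral_congr_timeMeasure ht ?_)
  filter_upwards [(gram ι).coeFn_compLpL h] with r hr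
  rw [hr, innerSL_apply_apply, gram_symm, real_inner_comm, gram_symm]

theorem norm_primitive_le (ι : V →L[ℝ] H) (ht : t ∈ Set.Icc 0 T) (h : Lp V 2 (timeMeasure T)) :
    ‖ι (primitive h t)‖ ≤ ‖volterra V T h‖ + ‖(gram ι).compLpL 2 (timeMeasure T) h‖ := by
  refine le_of_sq_le_sq ?_ (by positivity)
  rw [← two_mul_intervalIntegral_inner_gram ι ht, ← inner_restrictTime ht]
  calc 2 * inner ℝ (restrictTime V T t (volterra V T h))
        (restrictTime V T t ((gram ι).compLpL 2 (timeMeasure T) h))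
      ≤ 2 * (‖volterra V T h‖ * ‖(gram ι).compLpL 2 (timeMeasure T) h‖) := by
        gcongr
        exact (real_inner_le_norm _ _).trans (mul_le_mul (norm_restrictTime_le _)
          (norm_restrictTime_le _) (norm_nonneg _) (norm_nonneg _))
    _ ≤ (‖volterra V T h‖ + ‖(gram ι).compLpL 2 (timeMeasure T) h‖) ^ 2 := by
        nlinarith [sq_nonneg ‖volterra V T h‖,
          sq_nonneg ‖(gram ι).compLpL 2 (timeMeasure T) h‖]

/-- The operator `h ↦ ι†ι h + B ∫₀ᵗ h` on `L²(0, T; V)`: in terms of `h = w'`, the left-hand side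
of the equation `(ι†ι w)' + B w = F` with `w(0) = 0`. -/
def evolutionMap (ι : V →L[ℝ] H) (B : V →L[ℝ] V) (T : ℝ) :
    Lp V 2 (timeMeasure T) →ₗ[ℝ] Lp V 2 (timeMeasure T) :=
  ((gram ι).compLpL 2 (timeMeasure T)).toLinearMap +
    (B.compLpL 2 (timeMeasure T)).toLinearMap.comp (volterra V T)

theorem evolutionMap_apply (ι : V →L[ℝ] H) (B : V →L[ℝ] V) (h : Lp V 2 (timeMeasure T)) :
    evolutionMap ι B T h =
      (gram ι).compLpL 2 (timeMeasure T) h + B.compLpL 2 (timeMeasure T) (volterra V T h) :=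
  rfl

theorem inner_compLpL_volterra_nonneg (hT : 0 ≤ T) {B : V →L[ℝ] V}
    (hB : ∀ x y, inner ℝ (B x) y = inner ℝ x (B y)) (hpos : ∀ x, 0 ≤ inner ℝ x (B x))
    (h : Lp V 2 (timeMeasure T)) :
    0 ≤ inner ℝ (B.compLpL 2 (timeMeasure T) (volterra V T h)) h := by
  have hswap : inner ℝ (B.compLpL 2 (timeMeasure T) (volterra V T h)) h =
      inner ℝ (volterra V T h) (B.compLpL 2 (timeMeasure T) h) := by
    rw [L2.inner_def, L2.inner_def]
    refine integral_congr_ae ?_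
    filter_upwards [B.coeFn_compLpL h, B.coeFn_compLpL (volterra V T h)] with r hh hvolterra
    rw [hh, hvolterra, hB]
  have henergy := two_mul_intervalIntegral_inner_volterra ⟨hT, le_rfl⟩ hB h
  rw [← inner_L2_timeMeasure hT] at henergy
  linarith [hpos (primitive h T)]

theorem inner_gram_compLpL_self (ι : V →L[ℝ] H) (h : Lp V 2 (timeMeasure T)) :
    inner ℝ ((gram ι).compLpL 2 (timeMeasure T) h) h = ‖ι.compLpL 2 (timeMeasure T) h‖ ^ 2 := by
  rw [← real_inner_self_eq_norm_sq, L2.inner_def, L2.inner_def]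
  refine integral_congr_ae ?_
  filter_upwards [(gram ι).coeFn_compLpL h, ι.coeFn_compLpL h] with r hgram hι
  rw [hgram, hι, inner_gram_left]

theorem denseRange_evolutionMap (hT : 0 ≤ T) {ι : V →L[ℝ] H} (hι : Function.Injective ι)
    {B : V →L[ℝ] V} (hB : ∀ x y, inner ℝ (B x) y = inner ℝ x (B y))
    (hpos : ∀ x, 0 ≤ inner ℝ x (B x)) : DenseRange (evolutionMap ι B T) := by
  have hdense : (LinearMap.range (evolutionMap ι B T)).topologicalClosure = ⊤ := by
    rw [Submodule.topologicalClosure_eq_top_iff, Submodule.eq_bot_iff]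
    intro z hz
    have horth : inner ℝ (evolutionMap ι B T z) z = 0 :=
      (Submodule.mem_orthogonal _ _).1 hz _ ⟨z, rfl⟩
    rw [evolutionMap_apply, inner_add_left, inner_gram_compLpL_self] at horth
    have hnorm : ‖ι.compLpL 2 (timeMeasure T) z‖ ^ 2 = 0 := by
      linarith [inner_compLpL_volterra_nonneg hT hB hpos z,
        sq_nonneg ‖ι.compLpL 2 (timeMeasure T) z‖]
    have hzero : ι.compLpL 2 (timeMeasure T) z = 0 := norm_eq_zero.1 (by simpa using hnorm)
    rw [Lp.eq_zero_iff_ae_eq_zero] at hzero ⊢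
    filter_upwards [hzero, ι.coeFn_compLpL z] with r hr hcomp
    exact hι (by rw [← hcomp, hr, Pi.zero_apply, Pi.zero_apply, map_zero])
  exact dense_iff_closure_eq.2 (congrArg SetLike.coe hdense)

theorem mul_norm_volterra_le (hT : 0 ≤ T) (ι : V →L[ℝ] H) {B : V →L[ℝ] V} {c : ℝ}
    (hcoer : ∀ x, c * ‖x‖ ^ 2 ≤ inner ℝ x (B x)) (h : Lp V 2 (timeMeasure T)) :
    c * ‖volterra V T h‖ ≤ ‖evolutionMap ι B T h‖ := by
  set w := volterra V T h
  have hgram : 0 ≤ inner ℝ w ((gram ι).compLpL 2 (timeMeasure T) h) := by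
    have henergy := two_mul_intervalIntegral_inner_gram ι ⟨hT, le_rfl⟩ h
    rw [← inner_L2_timeMeasure hT] at henergy
    linarith [sq_nonneg ‖ι (primitive h T)‖]
  have hcoerLp : c * ‖w‖ ^ 2 ≤ inner ℝ w (B.compLpL 2 (timeMeasure T) w) := by
    rw [← real_inner_self_eq_norm_sq, L2.inner_def, L2.inner_def, ← integral_const_mul]
    refine integral_mono_ae ((L2.integrable_inner (𝕜 := ℝ) _ _).const_mul _)
      (L2.integrable_inner _ _) ?_
    filter_upwards [B.coeFn_compLpL w] with r hr
    rw [real_inner_self_eq_norm_sq, hr]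
    exact hcoer _
  have hmul : ‖w‖ * (c * ‖w‖) ≤ ‖w‖ * ‖evolutionMap ι B T h‖ :=
    calc ‖w‖ * (c * ‖w‖) = c * ‖w‖ ^ 2 := by ring
      _ ≤ inner ℝ w (evolutionMap ι B T h) := by
        rw [evolutionMap_apply, inner_add_right]
        linarith
      _ ≤ ‖w‖ * ‖evolutionMap ι B T h‖ := real_inner_le_norm _ _
  rcases (norm_nonneg w).eq_or_lt with hw | hw
  · simp [← hw]
  · exact le_of_mul_le_mul_left hmul hw

/-- `U` is continuous on `[0, T]` with values in `H`, represents `ι w`, vanishes at time `0`, and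
`ι w` has the weak derivative `g`. Functionals on `V` are represented by elements of `V`. The last
field is the energy identity `d/dt ‖ι w‖² = 2 ⟨g, w⟩`. -/
structure IsWeakPrimitive (ι : V →L[ℝ] H) (w g : Lp V 2 (timeMeasure T)) (U : ℝ → H) : Prop where
  continuousOn : ContinuousOn U (Set.Icc 0 T)
  ae_eq : ∀ᵐ t ∂(timeMeasure T), U t = ι (w t)
  zero : U 0 = 0
  inner_eq : ∀ t ∈ Set.Icc 0 T, ∀ v, inner ℝ (U t) (ι v) = ∫ r in (0 : ℝ)..t, inner ℝ (g r) v
  norm_sq_eq : ∀ t ∈ Set.Icc 0 T, ‖U t‖ ^ 2 = 2 * ∫ r in (0 : ℝ)..t, inner ℝ (w r) (g r)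

theorem uniformCauchySeqOn_primitive (ι : V →L[ℝ] H) {h : ℕ → Lp V 2 (timeMeasure T)}
    (hvolterra : CauchySeq fun i => volterra V T (h i))
    (hgram : CauchySeq fun i => (gram ι).compLpL 2 (timeMeasure T) (h i)) :
    UniformCauchySeqOn (fun i t => ι (primitive (h i) t)) atTop (Set.Icc 0 T) := by
  rw [Metric.uniformCauchySeqOn_iff]
  intro ε hε
  obtain ⟨M, hM⟩ := Metric.cauchySeq_iff.1 hvolterra (ε / 2) (half_pos hε)
  obtain ⟨N, hN⟩ := Metric.cauchySeq_iff.1 hgram (ε / 2) (half_pos hε)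
  refine ⟨max M N, fun i hi j hj t ht => ?_⟩
  calc dist (ι (primitive (h i) t)) (ι (primitive (h j) t))
      = ‖ι (primitive (h i - h j) t)‖ := by rw [dist_eq_norm, ← map_sub, primitive_sub ht]
    _ ≤ ‖volterra V T (h i - h j)‖ + ‖(gram ι).compLpL 2 (timeMeasure T) (h i - h j)‖ :=
        norm_primitive_le ι ht _
    _ = dist (volterra V T (h i)) (volterra V T (h j)) +
        dist ((gram ι).compLpL 2 (timeMeasure T) (h i))
          ((gram ι).compLpL 2 (timeMeasure T) (h j)) := by
        rw [map_sub, map_sub, dist_eq_norm, dist_eq_norm]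
    _ < ε / 2 + ε / 2 := add_lt_add
        (hM i (le_of_max_le_left hi) j (le_of_max_le_left hj))
        (hN i (le_of_max_le_right hi) j (le_of_max_le_right hj))
    _ = ε := add_halves ε

theorem isWeakPrimitive_of_tendsto (hT : 0 ≤ T) {ι : V →L[ℝ] H} {h : ℕ → Lp V 2 (timeMeasure T)}
    {w g : Lp V 2 (timeMeasure T)} {U : ℝ → H}
    (hw : Tendsto (fun i => volterra V T (h i)) atTop (𝓝 w))
    (hg : Tendsto (fun i => (gram ι).compLpL 2 (timeMeasure T) (h i)) atTop (𝓝 g))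
    (hU : TendstoUniformlyOn (fun i t => ι (primitive (h i) t)) U atTop (Set.Icc 0 T)) :
    IsWeakPrimitive ι w g U where
  continuousOn := hU.continuousOn (Frequently.of_forall fun i =>
    ι.continuous.comp_continuousOn (continuousOn_primitive (h i)))
  ae_eq := by
    obtain ⟨ns, hns, hae⟩ := (tendstoInMeasure_of_tendsto_Lp hw).exists_seq_tendsto_ae
    filter_upwards [hae, ae_all_iff.2 fun i => coeFn_volterra (h i), ae_timeMeasure_mem T]
      with t hlim hvolterra ht
    simp only [hvolterra] at hlim
    exact tendsto_nhds_unique ((hU.tendsto_at ht).comp hns.tendsto_atTop)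
      ((ι.continuous.tendsto _).comp hlim)
  zero := tendsto_nhds_unique (hU.tendsto_at ⟨le_rfl, hT⟩) (by simp [primitive])
  inner_eq t ht v := by
    refine tendsto_nhds_unique ((hU.tendsto_at ht).inner tendsto_const_nhds) ?_
    simp only [inner_primitive_eq_intervalIntegral_gram ι ht, intervalIntegral_inner_const ht]
    exact (((restrictTime V T t).continuous.tendsto g).comp hg).inner tendsto_const_nhds
  norm_sq_eq t ht := by
    refine tendsto_nhds_unique ((hU.tendsto_at ht).norm.pow 2) ?_
    simp only [← two_mul_intervalIntegral_inner_gram ι ht, ← inner_restrictTime ht]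
    exact ((((restrictTime V T t).continuous.tendsto w).comp hw).inner
      (((restrictTime V T t).continuous.tendsto g).comp hg)).const_mul 2

theorem exists_isWeakPrimitive_of_tendsto (hT : 0 ≤ T) {ι : V →L[ℝ] H}
    {h : ℕ → Lp V 2 (timeMeasure T)} {w g : Lp V 2 (timeMeasure T)}
    (hw : Tendsto (fun i => volterra V T (h i)) atTop (𝓝 w))
    (hg : Tendsto (fun i => (gram ι).compLpL 2 (timeMeasure T) (h i)) atTop (𝓝 g)) :
    ∃ U, IsWeakPrimitive ι w g U := by
  have hunif := uniformCauchySeqOn_primitive ι hw.cauchySeq hg.cauchySeq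
  have hlim : ∀ t, ∃ x, t ∈ Set.Icc 0 T →
      Tendsto (fun i => ι (primitive (h i) t)) atTop (𝓝 x) := fun t => by
    by_cases ht : t ∈ Set.Icc 0 T
    · exact (cauchySeq_tendsto_of_complete (hunif.cauchySeq ht)).imp fun _ hx _ => hx
    · exact ⟨0, fun h => absurd h ht⟩
  choose U hU using hlim
  exact ⟨U, isWeakPrimitive_of_tendsto hT hw hg (hunif.tendstoUniformlyOn_of_tendsto hU)⟩

theorem cauchySeq_volterra (hT : 0 ≤ T) {ι : V →L[ℝ] H} {B : V →L[ℝ] V} {c : ℝ} (hc : 0 < c)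
    (hcoer : ∀ x, c * ‖x‖ ^ 2 ≤ inner ℝ x (B x)) {h : ℕ → Lp V 2 (timeMeasure T)}
    (hh : CauchySeq fun i => evolutionMap ι B T (h i)) :
    CauchySeq fun i => volterra V T (h i) := by
  rw [cauchySeq_iff_tendsto_dist_atTop_0] at hh ⊢
  refine squeeze_zero (fun _ => dist_nonneg) (fun i => ?_)
    (by simpa only [mul_zero] using hh.const_mul c⁻¹)
  rw [le_inv_mul_iff₀ hc, dist_eq_norm, dist_eq_norm, ← map_sub, ← map_sub]
  exact mul_norm_volterra_le hT ι hcoer _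

theorem exists_isWeakPrimitive_add_compLpL_eq (hT : 0 ≤ T) {ι : V →L[ℝ] H}
    (hι : Function.Injective ι) {B : V →L[ℝ] V} (hB : ∀ x y, inner ℝ (B x) y = inner ℝ x (B y))
    {c : ℝ} (hc : 0 < c) (hcoer : ∀ x, c * ‖x‖ ^ 2 ≤ inner ℝ x (B x))
    (F : Lp V 2 (timeMeasure T)) :
    ∃ (w g : Lp V 2 (timeMeasure T)) (U : ℝ → H),
      IsWeakPrimitive ι w g U ∧ g + B.compLpL 2 (timeMeasure T) w = F := by
  have hpos : ∀ x, 0 ≤ inner ℝ x (B x) := fun x =>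
    (by positivity : (0 : ℝ) ≤ c * ‖x‖ ^ 2).trans (hcoer x)
  obtain ⟨k, hk, hkF⟩ := mem_closure_iff_seq_limit.1 (denseRange_evolutionMap hT hι hB hpos F)
  choose h hh using hk
  obtain rfl : (fun i => evolutionMap ι B T (h i)) = k := funext hh
  obtain ⟨w, hw⟩ := cauchySeq_tendsto_of_complete (cauchySeq_volterra hT hc hcoer hkF.cauchySeq)
  have hg : Tendsto (fun i => (gram ι).compLpL 2 (timeMeasure T) (h i)) atTop
      (𝓝 (F - B.compLpL 2 (timeMeasure T) w)) := by
    simpa only [evolutionMap_apply, Function.comp_def, add_sub_cancel_right] using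
      hkF.sub (((B.compLpL 2 (timeMeasure T)).continuous.tendsto w).comp hw)
  obtain ⟨U, hU⟩ := exists_isWeakPrimitive_of_tendsto hT hw hg
  exact ⟨w, _, U, hU, sub_add_cancel _ _⟩

end Evolution

/-! ### Weak derivatives in time -/

section WeakDerivative

variable {a b T : ℝ}

theorem exists_Icc_of_isCompact_subset_Ioo {K : Set ℝ} (hK : IsCompact K)
    (hKs : K ⊆ Set.Ioo a b) : ∃ α β, K ⊆ Set.Icc α β ∧ Set.Icc α β ⊆ Set.Ioo a b := by
  rcases K.eq_empty_or_nonempty with rfl | hne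
  · exact ⟨1, 0, by simp, by simp⟩
  · exact ⟨sInf K, sSup K, subset_Icc_csInf_csSup hK.bddBelow hK.bddAbove,
      Set.Icc_subset_Ioo (hKs (hK.sInf_mem hne)).1 (hKs (hK.sSup_mem hne)).2⟩

theorem exists_deriv_eq_of_integral_eq_zero {η : ℝ → ℝ} (hη : ContDiff ℝ ∞ η)
    (hηc : HasCompactSupport η) (hηs : tsupport η ⊆ Set.Ioo a b) (hη0 : ∫ t, η t = 0) :
    ∃ φ : ℝ → ℝ, ContDiff ℝ ∞ φ ∧ HasCompactSupport φ ∧ tsupport φ ⊆ Set.Ioo a b ∧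
      deriv φ = η := by
  set φ : ℝ → ℝ := fun t => ∫ r in Set.Iic t, η r
  have hηi : Integrable η := hη.continuous.integrable_of_hasCompactSupport hηc
  have hderiv : ∀ t, HasDerivAt φ (η t) t := fun t => by
    have hφ : φ = fun t => (∫ r in Set.Iic 0, η r) + ∫ r in (0 : ℝ)..t, η r := funext fun t => by
      rw [← intervalIntegral.integral_Iic_sub_Iic hηi.integrableOn hηi.integrableOn,
        add_sub_cancel]
    rw [hφ]
    exact (hη.continuous.integral_hasStrictDerivAt 0 t).hasDerivAt.const_add _
  have hφη : deriv φ = η := funext fun t => (hderiv t).deriv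
  obtain ⟨α, β, hηαβ, hαβ⟩ := exists_Icc_of_isCompact_subset_Ioo hηc.isCompact hηs
  have hφsupp : Function.support φ ⊆ Set.Icc α β := by
    refine fun t ht => by_contra fun htαβ => ht ?_
    rw [Set.mem_Icc, not_and_or, not_le, not_le] at htαβ
    rcases htαβ with htα | htβ
    · exact setIntegral_eq_zero_of_forall_eq_zero fun y hy =>
        image_eq_zero_of_notMem_tsupport fun hyη => (htα.trans_le (hηαβ hyη).1).not_ge hy
    · rw [← hη0]
      exact setIntegral_eq_integral_of_forall_compl_eq_zero fun y hy =>
        image_eq_zero_of_notMem_tsupport fun hyη => hy ((hηαβ hyη).2.trans htβ.le)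
  refine ⟨φ, ?_, .of_support_subset_isCompact isCompact_Icc hφsupp,
    (closure_minimal hφsupp isClosed_Icc).trans hαβ, hφη⟩
  rw [contDiff_infty_iff_deriv, hφη]
  exact ⟨fun t => (hderiv t).differentiableAt, hη⟩

theorem exists_contDiff_integral_eq_one (hab : a < b) :
    ∃ ρ : ℝ → ℝ, ContDiff ℝ ∞ ρ ∧ HasCompactSupport ρ ∧ tsupport ρ ⊆ Set.Ioo a b ∧
      ∫ t, ρ t = 1 := by
  let ρ : ContDiffBump ((a + b) / 2) := ⟨(b - a) / 8, (b - a) / 4, by linarith, by linarith⟩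
  refine ⟨ρ.normed volume, ρ.contDiff_normed, ρ.hasCompactSupport_normed, ?_, ρ.integral_normed⟩
  rw [ρ.tsupport_normed_eq, Real.closedBall_eq_Icc]
  exact Set.Icc_subset_Ioo (by dsimp only [ρ]; linarith) (by dsimp only [ρ]; linarith)

theorem integrable_mul_of_hasCompactSupport {μ : Measure ℝ} {ψ d : ℝ → ℝ} (hψ : Continuous ψ)
    (hψc : HasCompactSupport ψ) (hd : Integrable d μ) : Integrable (fun t => ψ t * d t) μ := by
  obtain ⟨C, hC⟩ := hψ.bounded_above_of_compact_support hψc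
  exact hd.bdd_mul hψ.aestronglyMeasurable (Eventually.of_forall hC)

-- The du Bois-Reymond lemma: `ψ - (∫ ψ) ρ` is the derivative of a test function for every test
-- function `ψ`, where `ρ` is a fixed test function of integral `1`.
theorem exists_ae_eq_const_of_integral_deriv_mul_eq_zero (hab : a < b) {d : ℝ → ℝ}
    (hd : IntegrableOn d (Set.Ioo a b))
    (h : ∀ φ : ℝ → ℝ, ContDiff ℝ ∞ φ → HasCompactSupport φ → tsupport φ ⊆ Set.Ioo a b →
      ∫ t in Set.Ioo a b, deriv φ t * d t = 0) :
    ∃ C : ℝ, d =ᵐ[volume.restrict (Set.Ioo a b)] fun _ => C := by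
  obtain ⟨ρ, hρ, hρc, hρs, hρ1⟩ := exists_contDiff_integral_eq_one hab
  set C := ∫ t in Set.Ioo a b, ρ t * d t
  have htest : ∀ ψ : ℝ → ℝ, ContDiff ℝ ∞ ψ → HasCompactSupport ψ → tsupport ψ ⊆ Set.Ioo a b →
      ∫ t in Set.Ioo a b, ψ t * d t = (∫ t, ψ t) * C := fun ψ hψ hψc hψs => by
    have hρψ : ContDiff ℝ ∞ fun t => (∫ r, ψ r) * ρ t := contDiff_const.mul hρ
    have hρψc : HasCompactSupport fun t => (∫ r, ψ r) * ρ t := hρc.mul_left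
    obtain ⟨φ, hφ, hφc, hφs, hφη⟩ := exists_deriv_eq_of_integral_eq_zero (hψ.sub hρψ)
      (hψc.sub hρψc) ((tsupport_sub _ _).trans (Set.union_subset hψs
        ((closure_mono (Function.support_mul_subset_right _ _)).trans hρs)))
      (by
        rw [integral_sub (hψ.continuous.integrable_of_hasCompactSupport hψc)
          (hρψ.continuous.integrable_of_hasCompactSupport hρψc), integral_const_mul, hρ1, mul_one,
          sub_self])
    have hortho := h φ hφ hφc hφs
    simp only [hφη, sub_mul, mul_assoc] at hortho
    rwa [integral_sub (integrable_mul_of_hasCompactSupport hψ.continuous hψc hd)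
      ((integrable_mul_of_hasCompactSupport hρ.continuous hρc hd).const_mul _),
      integral_const_mul, sub_eq_zero] at hortho
  refine ⟨C, (ae_restrict_iff' measurableSet_Ioo).2 ?_⟩
  have hzero : ∀ᵐ t : ℝ, t ∈ Set.Ioo a b → d t - C = 0 := by
    refine isOpen_Ioo.ae_eq_zero_of_integral_contDiff_smul_eq_zero
      (IntegrableOn.locallyIntegrableOn (hd.sub (integrable_const C))) fun ψ hψ hψc hψs => ?_
    have hoff : ∀ k : ℝ → ℝ, ∀ t ∉ Set.Ioo a b, ψ t * k t = 0 := fun k t ht => by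
      rw [image_eq_zero_of_notMem_tsupport fun hmem => ht (hψs hmem), zero_mul]
    simp only [smul_eq_mul]
    rw [← setIntegral_eq_integral_of_forall_compl_eq_zero (hoff fun t => d t - C)]
    simp only [mul_sub]
    rw [integral_sub (integrable_mul_of_hasCompactSupport hψ.continuous hψc hd)
      (integrable_mul_of_hasCompactSupport hψ.continuous hψc (integrable_const C)),
      htest ψ hψ hψc hψs, setIntegral_eq_integral_of_forall_compl_eq_zero (hoff fun _ => C),
      integral_mul_const, sub_self]
  filter_upwards [hzero] with t ht hmem using sub_eq_zero.1 (ht hmem)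

theorem integral_deriv_mul_add_primitive (hT : 0 ≤ T) {w : ℝ → ℝ} (c₀ : ℝ)
    (hw : Integrable w (timeMeasure T)) {φ : ℝ → ℝ} (hφ : ContDiff ℝ ∞ φ)
    (hφs : tsupport φ ⊆ Set.Ioo 0 T) :
    ∫ t, deriv φ t * (c₀ + ∫ r in (0 : ℝ)..t, w r) ∂(timeMeasure T) =
      -∫ t, φ t * w t ∂(timeMeasure T) := by
  have hφ0 : φ 0 = 0 := image_eq_zero_of_notMem_tsupport fun h => lt_irrefl _ (hφs h).1
  have hφT : φ T = 0 := image_eq_zero_of_notMem_tsupport fun h => lt_irrefl _ (hφs h).2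
  have hφ' : Continuous (deriv φ) := hφ.continuous_deriv (by simp)
  have hTT : T ∈ Set.Icc 0 T := ⟨hT, le_rfl⟩
  have hprim : ∀ t, ∫ r in (0 : ℝ)..t, deriv φ r = φ t := fun t => by
    rw [intervalIntegral.integral_deriv_eq_sub (fun x _ => hφ.differentiable (by simp) x)
      (hφ'.intervalIntegrable _ _), hφ0, sub_zero]
  have hparts := intervalIntegral_bilin_primitive_add hT (ContinuousLinearMap.mul ℝ ℝ)
    (hφ'.intervalIntegrable 0 T) (intervalIntegrable_of_timeMeasure hTT hw)
  simp only [hprim, hφT, ContinuousLinearMap.mul_apply', zero_mul] at hparts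
  have hint : Integrable (fun t => deriv φ t * ∫ r in (0 : ℝ)..t, w r) (timeMeasure T) :=
    integrable_timeMeasure_of_continuousOn
      (hφ'.continuousOn.mul (continuousOn_primitive_timeMeasure hw))
  simp only [integral_timeMeasure hT, mul_add]
  rw [intervalIntegral.integral_add ((hφ'.intervalIntegrable _ _).mul_const _)
    (intervalIntegrable_of_timeMeasure hTT hint), intervalIntegral.integral_mul_const, hprim, hφT,
    zero_mul, zero_add]
  exact eq_neg_of_add_eq_zero_right hparts

theorem eq_add_primitive_of_integral_deriv_mul (hT : 0 < T) {c w : ℝ → ℝ}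
    (hc : ContinuousOn c (Set.Icc 0 T)) (hw : Integrable w (timeMeasure T))
    (h : ∀ φ : ℝ → ℝ, ContDiff ℝ ∞ φ → HasCompactSupport φ → tsupport φ ⊆ Set.Ioo 0 T →
      ∫ t, deriv φ t * c t ∂(timeMeasure T) = -∫ t, φ t * w t ∂(timeMeasure T)) :
    Set.EqOn c (fun t => c 0 + ∫ r in (0 : ℝ)..t, w r) (Set.Icc 0 T) := by
  have hprim := continuousOn_primitive_timeMeasure hw
  have hd : ContinuousOn (fun t => c t - (0 + ∫ r in (0 : ℝ)..t, w r)) (Set.Icc 0 T) :=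
    hc.sub (continuousOn_const.add hprim)
  obtain ⟨C, hC⟩ := exists_ae_eq_const_of_integral_deriv_mul_eq_zero hT
    (integrable_timeMeasure_of_continuousOn hd) fun φ hφ hφc hφs => by
    have hφ' : ContinuousOn (deriv φ) (Set.Icc 0 T) := (hφ.continuous_deriv (by simp)).continuousOn
    simp only [mul_sub]
    refine (integral_sub (integrable_timeMeasure_of_continuousOn (hφ'.mul hc))
      (integrable_timeMeasure_of_continuousOn
        (hφ'.mul (continuousOn_const.add hprim)))).trans ?_
    exact sub_eq_zero.2 ((h φ hφ hφc hφs).trans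
      (integral_deriv_mul_add_primitive hT.le 0 hw hφ hφs).symm)
  have hconst := eqOn_of_ae_timeMeasure hT hd continuousOn_const hC
  intro t ht
  have hconst_t := hconst ht
  have hconst_zero := hconst (Set.left_mem_Icc.2 hT.le)
  simp only [intervalIntegral.integral_same] at hconst_t hconst_zero
  linarith

end WeakDerivative

section Parabolic

/-- `u ∈ L²(0, T; V)` solves `(ι u)' + a(u, ·) = f`, `u(0) = u₀`, in the form integrated in time,
and `U` is its representative in `C([0, T]; H)`. -/
structure IsMildSolution {V H : Type*} [SeminormedAddCommGroup V] [NormedSpace ℝ V]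
    [NormedAddCommGroup H] [InnerProductSpace ℝ H] (ι : V → H) (a : V →L[ℝ] V →L[ℝ] ℝ) (T : ℝ)
    (f : ℝ → StrongDual ℝ V) (u₀ : V) (u : ℝ → V) (U : ℝ → H) : Prop where
  memLp : MemLp u 2 (timeMeasure T)
  continuousOn : ContinuousOn U (Set.Icc 0 T)
  ae_eq : ∀ᵐ t ∂(timeMeasure T), U t = ι (u t)
  zero : U 0 = ι u₀
  inner_eq : ∀ t ∈ Set.Icc 0 T, ∀ v,
    inner ℝ (U t) (ι v) = inner ℝ (ι u₀) (ι v) + ∫ r in (0 : ℝ)..t, (f r v - a (u r) v)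

section NormedSpace

variable {V : Type*} [NormedAddCommGroup V] [NormedSpace ℝ V] {T t : ℝ}
  {f : ℝ → StrongDual ℝ V} {u : ℝ → V}

theorem memLp_dual_sub (a : V →L[ℝ] V →L[ℝ] ℝ) (hf : MemLp f 2 (timeMeasure T))
    (hu : MemLp u 2 (timeMeasure T)) : MemLp (fun t => f t - a (u t)) 2 (timeMeasure T) :=
  hf.sub (a.comp_memLp' hu)

theorem integrable_dual_apply (hf : MemLp f 2 (timeMeasure T)) (hu : MemLp u 2 (timeMeasure T)) :
    Integrable (fun t => f t (u t)) (timeMeasure T) :=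
  memLp_one_iff_integrable.1 <| hf.of_bilin (fun l v => l v) 1 hu
    (isBoundedBilinearMap_apply.continuous.comp_aestronglyMeasurable₂
      hf.aestronglyMeasurable hu.aestronglyMeasurable)
    (Eventually.of_forall fun t => by simpa using (f t).le_opNNNorm (u t))

theorem integrable_dual_sub_apply (a : V →L[ℝ] V →L[ℝ] ℝ) (hf : MemLp f 2 (timeMeasure T))
    (hu : MemLp u 2 (timeMeasure T)) (v : V) :
    Integrable (fun t => f t v - a (u t) v) (timeMeasure T) := by
  simpa only [sub_apply] using integrable_dual_apply (memLp_dual_sub a hf hu) (memLp_const v)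

theorem integral_dual_sub_form_le (ht : t ∈ Set.Icc 0 T) {a : V →L[ℝ] V →L[ℝ] ℝ} {c : ℝ}
    (hc : 0 < c) (hcoer : ∀ x, c * ‖x‖ ^ 2 ≤ a x x) (hf : MemLp f 2 (timeMeasure T))
    (hu : MemLp u 2 (timeMeasure T)) :
    (2 * ∫ r in (0 : ℝ)..t, (f r (u r) - a (u r) (u r))) + c * ∫ r in (0 : ℝ)..t, ‖u r‖ ^ 2 ≤
      c⁻¹ * ∫ r in (0 : ℝ)..t, ‖f r‖ ^ 2 := by
  have hpair := intervalIntegrable_of_timeMeasure ht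
    (integrable_dual_apply (memLp_dual_sub a hf hu) hu)
  simp only [sub_apply] at hpair
  have hu2 := intervalIntegrable_of_timeMeasure ht (hu.integrable_norm_pow two_ne_zero)
  have hf2 := intervalIntegrable_of_timeMeasure ht (hf.integrable_norm_pow two_ne_zero)
  simp only [← intervalIntegral.integral_const_mul]
  rw [← intervalIntegral.integral_add (hpair.const_mul 2) (hu2.const_mul c)]
  refine intervalIntegral.integral_mono_on ht.1 ((hpair.const_mul 2).add (hu2.const_mul c))
    (hf2.const_mul c⁻¹) fun r _ => ?_
  have hdual : f r (u r) ≤ ‖f r‖ * ‖u r‖ := (le_abs_self _).trans ((f r).le_opNorm (u r))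
  have hyoung : c⁻¹ * ‖f r‖ ^ 2 - 2 * (‖f r‖ * ‖u r‖) + c * ‖u r‖ ^ 2 =
      c⁻¹ * (‖f r‖ - c * ‖u r‖) ^ 2 := by
    field_simp
    ring
  have hsq : 0 ≤ c⁻¹ * (‖f r‖ - c * ‖u r‖) ^ 2 := by positivity
  linarith [hcoer (u r)]

theorem ae_eq_zero_of_forall_inner_eq {H : Type*} [NormedAddCommGroup H] [InnerProductSpace ℝ H]
    [CompleteSpace V] (hT : 0 ≤ T) {ι : V →L[ℝ] H} (hι : Function.Injective ι)
    {a : V →L[ℝ] V →L[ℝ] ℝ} (ha : ∀ x y, a x y = a y x) (hpos : ∀ x, 0 ≤ a x x)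
    (hu : MemLp u 2 (timeMeasure T))
    (h : ∀ᵐ t ∂(timeMeasure T), ∀ v, inner ℝ (ι (u t)) (ι v) = -∫ r in (0 : ℝ)..t, a (u r) v) :
    u =ᵐ[timeMeasure T] 0 := by
  have hTT : T ∈ Set.Icc 0 T := ⟨hT, le_rfl⟩
  have hui : Integrable u (timeMeasure T) := hu.integrable one_le_two
  have hnorm_sq : (fun t => ‖ι (u t)‖ ^ 2) =ᵐ[timeMeasure T]
      fun t => -a (∫ r in (0 : ℝ)..t, u r) (u t) := by
    filter_upwards [h, ae_timeMeasure_mem T] with t hinner ht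
    rw [← real_inner_self_eq_norm_sq, hinner]
    exact congrArg Neg.neg
      ((a.flip (u t)).intervalIntegral_comp_comm (intervalIntegrable_of_timeMeasure ht hui))
  have hnonpos : ∫ t, ‖ι (u t)‖ ^ 2 ∂(timeMeasure T) ≤ 0 := by
    rw [integral_congr_ae hnorm_sq, integral_neg, integral_timeMeasure hT]
    linarith [two_mul_intervalIntegral_bilin_primitive hT a ha
      (intervalIntegrable_of_timeMeasure hTT hui), hpos (∫ r in (0 : ℝ)..T, u r)]
  have hzero := (integral_eq_zero_iff_of_nonneg (fun t => by positivity)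
    (ι.comp_memLp' hu).norm.integrable_sq).1
    (hnonpos.antisymm (integral_nonneg fun t => by positivity))
  filter_upwards [hzero] with t ht
  refine hι ?_
  rw [Pi.zero_apply, map_zero, ← norm_eq_zero]
  exact pow_eq_zero_iff two_ne_zero |>.1 ht

theorem IsMildSolution.unique {H : Type*} [NormedAddCommGroup H] [InnerProductSpace ℝ H]
    [CompleteSpace V] (hT : 0 ≤ T) {ι : V →L[ℝ] H} (hι : Function.Injective ι)
    {a : V →L[ℝ] V →L[ℝ] ℝ} (ha : ∀ x y, a x y = a y x) (hpos : ∀ x, 0 ≤ a x x)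
    (hf : MemLp f 2 (timeMeasure T)) {u₀ : V} {u' : ℝ → V} {U U' : ℝ → H}
    (hu : IsMildSolution ι a T f u₀ u U) (hu' : IsMildSolution ι a T f u₀ u' U') :
    u =ᵐ[timeMeasure T] u' := by
  rw [← sub_ae_eq_zero]
  refine ae_eq_zero_of_forall_inner_eq hT hι ha hpos (hu.memLp.sub hu'.memLp) ?_
  filter_upwards [hu.ae_eq, hu'.ae_eq, ae_timeMeasure_mem T] with t hUt hUt' ht v
  rw [Pi.sub_apply, map_sub, inner_sub_left, ← hUt, ← hUt', hu.inner_eq t ht, hu'.inner_eq t ht,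
    add_sub_add_left_eq_sub, ← intervalIntegral.integral_sub
      (intervalIntegrable_of_timeMeasure ht (integrable_dual_sub_apply a hf hu.memLp v))
      (intervalIntegrable_of_timeMeasure ht (integrable_dual_sub_apply a hf hu'.memLp v)),
    ← intervalIntegral.integral_neg]
  simp only [Pi.sub_apply, map_sub, sub_apply, sub_sub_sub_cancel_left, neg_sub]

end NormedSpace

section HilbertSpace

variable {V H : Type*} [NormedAddCommGroup V] [InnerProductSpace ℝ V]
  [NormedAddCommGroup H] [InnerProductSpace ℝ H] {T t : ℝ} {ι : V →L[ℝ] H}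
  {w g : Lp V 2 (timeMeasure T)} {W : ℝ → H} {a : V →L[ℝ] V →L[ℝ] ℝ} {f : ℝ → StrongDual ℝ V}
  {u₀ : V}

theorem IsWeakPrimitive.isMildSolution (hW : IsWeakPrimitive ι w g W)
    (hg : ∀ᵐ t ∂(timeMeasure T), ∀ v, inner ℝ (g t) v = f t v - a (u₀ + w t) v) :
    IsMildSolution ι a T f u₀ (fun t => u₀ + w t) (fun t => ι u₀ + W t) where
  memLp := (memLp_const u₀).add (Lp.memLp w)
  continuousOn := continuousOn_const.add hW.continuousOn
  ae_eq := by
    filter_upwards [hW.ae_eq] with t ht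
    rw [ht, map_add]
  zero := by rw [hW.zero, add_zero]
  inner_eq t ht v := by
    rw [inner_add_left, hW.inner_eq t ht]
    congr 1
    refine intervalIntegral_congr_timeMeasure ht ?_
    filter_upwards [hg] with r hr using hr v

theorem IsWeakPrimitive.norm_add_sq_eq (hW : IsWeakPrimitive ι w g W)
    (hg : ∀ᵐ t ∂(timeMeasure T), ∀ v, inner ℝ (g t) v = f t v - a (u₀ + w t) v)
    (ht : t ∈ Set.Icc 0 T) :
    ‖ι u₀ + W t‖ ^ 2 = ‖ι u₀‖ ^ 2 +
      2 * ∫ r in (0 : ℝ)..t, (f r (u₀ + w r) - a (u₀ + w r) (u₀ + w r)) := by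
  rw [norm_add_sq_real, hW.norm_sq_eq t ht, real_inner_comm, hW.inner_eq t ht, add_assoc,
    ← mul_add, ← intervalIntegral.integral_add
      (intervalIntegrable_of_timeMeasure ht ((integrable_Lp_timeMeasure g).inner_const u₀))
      (intervalIntegrable_of_timeMeasure ht (L2.integrable_inner w g))]
  congr 2
  refine intervalIntegral_congr_timeMeasure ht ?_
  filter_upwards [hg] with r hr
  rw [← hr, inner_add_right, real_inner_comm (g r) (w r)]

theorem exists_isMildSolution [CompleteSpace V] [CompleteSpace H] (hT : 0 ≤ T)
    (hι : Function.Injective ι) (ha : ∀ x y, a x y = a y x) {c : ℝ} (hc : 0 < c)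
    (hcoer : ∀ x, c * ‖x‖ ^ 2 ≤ a x x)
    (hf : MemLp f 2 (timeMeasure T)) (u₀ : V) :
    ∃ (u : ℝ → V) (U : ℝ → H), IsMildSolution ι a T f u₀ u U ∧
      ∀ t ∈ Set.Icc 0 T, ‖U t‖ ^ 2 + c * ∫ r in (0 : ℝ)..t, ‖u r‖ ^ 2 ≤
        ‖ι u₀‖ ^ 2 + c⁻¹ * ∫ r in (0 : ℝ)..t, ‖f r‖ ^ 2 := by
  set B : V →L[ℝ] V := InnerProductSpace.continuousLinearMapOfBilin (𝕜 := ℝ) a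
  have hB : ∀ x y, inner ℝ (B x) y = a x y :=
    InnerProductSpace.continuousLinearMapOfBilin_apply (𝕜 := ℝ) a
  have hBsymm : ∀ x y, inner ℝ (B x) y = inner ℝ x (B y) := fun x y => by
    rw [hB, real_inner_comm, hB, ha]
  have hF : MemLp (fun t => (InnerProductSpace.toDual ℝ V).symm (f t) - B u₀) 2 (timeMeasure T) :=
    ((InnerProductSpace.toDual ℝ V).symm.lipschitz.comp_memLp (map_zero _) hf).sub (memLp_const _)
  obtain ⟨w, g, W, hW, hwg⟩ := exists_isWeakPrimitive_add_compLpL_eq hT hι hBsymm hc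
    (fun x => by rw [← hBsymm, hB]; exact hcoer x) hF.toLp
  have hg : ∀ᵐ t ∂(timeMeasure T), ∀ v, inner ℝ (g t) v = f t v - a (u₀ + w t) v := by
    rw [← eq_sub_iff_add_eq] at hwg
    rw [hwg]
    filter_upwards [Lp.coeFn_sub hF.toLp (B.compLpL 2 (timeMeasure T) w), hF.coeFn_toLp,
      B.coeFn_compLpL w] with t hsub hFt hBt v
    rw [hsub, Pi.sub_apply, hFt, hBt, inner_sub_left, inner_sub_left,
      InnerProductSpace.toDual_symm_apply, hB, hB, map_add, add_apply, sub_sub]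
  have hu := hW.isMildSolution hg
  refine ⟨_, _, hu, fun t ht => ?_⟩
  rw [hW.norm_add_sq_eq hg ht, add_assoc]
  exact add_le_add_right (integral_dual_sub_form_le ht hc hcoer hf hu.memLp) _

end HilbertSpace

end Parabolic

/-! ### Plancherel's theorem for integrable functions -/

section Plancherel

theorem lintegral_enorm_sq_eq {α F : Type*} [MeasurableSpace α] [SeminormedAddCommGroup F]
    (μ : Measure α) (g : α → F) : ∫⁻ x, ‖g x‖ₑ ^ 2 ∂μ = eLpNorm g 2 μ ^ 2 := by
  have h := eLpNorm_nnreal_pow_eq_lintegral (f := g) (μ := μ) (two_ne_zero (α := NNReal))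
  simpa using h.symm

open scoped FourierTransform

variable {E : Type*} [NormedAddCommGroup E] [InnerProductSpace ℝ E] [FiniteDimensional ℝ E]
  [MeasurableSpace E] [BorelSpace E]

theorem continuous_fourier_of_integrable {f : E → ℂ} (hf : Integrable f) : Continuous (𝓕 f) :=
  VectorFourier.fourierIntegral_continuous Real.continuous_fourierChar
    (by exact continuous_inner) hf

theorem integral_smul_fourier_toLp {f : E → ℂ} (hf : Integrable f) (hf2 : MemLp f 2)
    (G : SchwartzMap E ℂ) :
    ∫ x, G x • (𝓕 hf2.toLp : Lp ℂ 2 (volume : Measure E)) x = ∫ x, G x • 𝓕 f x := by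
  have to_kernel : ∫ x, G x • (𝓕 hf2.toLp : Lp ℂ 2 (volume : Measure E)) x =
      ∫ x, (𝓕 G) x • (hf2.toLp : Lp ℂ 2 (volume : Measure E)) x := by
    have h := DFunLike.congr_fun (Lp.fourier_toTemperedDistribution_eq
      (hf2.toLp : Lp ℂ 2 (volume : Measure E))) G
    rw [TemperedDistribution.fourier_apply, Lp.toTemperedDistribution_apply,
      Lp.toTemperedDistribution_apply] at h
    exact h.symm
  have from_kernel : ∫ x, (𝓕 G) x • f x = ∫ x, G x • 𝓕 f x := by
    have h := VectorFourier.integral_fourierIntegral_smul_eq_flip (μ := (volume : Measure E))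
      (ν := (volume : Measure E)) (L := innerₗ E) Real.continuous_fourierChar
      (by exact continuous_inner) G.integrable hf
    rwa [flip_innerₗ] at h
  rw [to_kernel, ← from_kernel]
  exact integral_congr_ae (hf2.coeFn_toLp.mono fun x hx => by simp only [hx])

theorem fourier_toLp_ae_eq {f : E → ℂ} (hf : Integrable f) (hf2 : MemLp f 2) :
    (𝓕 hf2.toLp : Lp ℂ 2 (volume : Measure E)) =ᵐ[volume] 𝓕 f := by
  have hloc : LocallyIntegrable (𝓕 f) (volume : Measure E) :=
    (continuous_fourier_of_integrable hf).locallyIntegrable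
  have hloc2 : LocallyIntegrable (𝓕 hf2.toLp : Lp ℂ 2 (volume : Measure E)) volume :=
    (Lp.memLp _).locallyIntegrable one_le_two
  have hsub := ae_eq_zero_of_integral_contDiff_smul_eq_zero (hloc2.sub hloc) fun g hg hgc => by
    have hg₁ : HasCompactSupport (Complex.ofRealCLM ∘ g) := hgc.comp_left rfl
    have hg₂ : ContDiff ℝ ∞ (Complex.ofRealCLM ∘ g) := by fun_prop
    have htest := integral_smul_fourier_toLp hf hf2 (hg₁.toSchwartzMap hg₂)
    have hG : ∀ x, hg₁.toSchwartzMap hg₂ x = (g x : ℂ) := fun x => rfl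
    simp only [Pi.sub_apply, smul_sub]
    rw [integral_sub (hloc2.integrable_smul_left_of_hasCompactSupport hg.continuous hgc)
      (hloc.integrable_smul_left_of_hasCompactSupport hg.continuous hgc), sub_eq_zero]
    simpa only [hG, Complex.coe_smul, smul_eq_mul, Complex.real_smul] using htest
  filter_upwards [hsub] with x hx using sub_eq_zero.1 hx

theorem lintegral_enorm_fourier_sq {f : E → ℂ} (hf : Integrable f) (hf2 : MemLp f 2) :
    ∫⁻ ξ, ‖𝓕 f ξ‖ₑ ^ 2 = ∫⁻ x, ‖f x‖ₑ ^ 2 := by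
  rw [lintegral_enorm_sq_eq, lintegral_enorm_sq_eq, ← eLpNorm_congr_ae (fourier_toLp_ae_eq hf hf2),
    ← eLpNorm_congr_ae hf2.coeFn_toLp]
  congr 1
  rw [← ENNReal.toReal_eq_toReal_iff' (Lp.memLp _).2.ne (Lp.memLp _).2.ne, ← Lp.norm_def,
    ← Lp.norm_def]
  exact Lp.norm_fourier_eq (hf2.toLp : Lp ℂ 2 (volume : Measure E))

end Plancherel

/-! ### Trigonometric moments of Gaussians -/

section Gaussian

open scoped FourierTransform
open Module (finrank)

variable {E : Type*} [NormedAddCommGroup E] [InnerProductSpace ℝ E] [FiniteDimensional ℝ E]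
  [MeasurableSpace E] [BorelSpace E]

theorem integrable_exp_neg_mul_norm_sq {t : ℝ} (ht : 0 < t) :
    Integrable fun h : E => Real.exp (-t * ‖h‖ ^ 2) := by
  have hcexp := GaussianFourier.integrable_cexp_neg_mul_sq_norm_add (V := E) (b := (t : ℂ))
    (by simpa using ht) 0 0
  refine hcexp.re.congr (Eventually.of_forall fun h => ?_)
  have hreal : (-(t : ℂ) * (‖h‖ : ℂ) ^ 2 + 0 * (inner ℝ (0 : E) h : ℝ) : ℂ) =
      ((-t * ‖h‖ ^ 2 : ℝ) : ℂ) := by push_cast; ring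
  simp only [hreal]
  rw [← Complex.ofReal_exp]
  exact Complex.ofReal_re _

theorem le_mul_exp_mul_sq {t : ℝ} (ht : 0 < t) (r : ℝ) :
    r ≤ (1 + t⁻¹) * Real.exp (t * r ^ 2) := by
  have hcancel : t⁻¹ * (t * r ^ 2) = r ^ 2 := by field_simp
  calc r ≤ (1 + t⁻¹) * (t * r ^ 2 + 1) := by
        nlinarith [sq_nonneg (r - 1), mul_nonneg ht.le (sq_nonneg r), inv_pos.2 ht]
    _ ≤ _ := by gcongr; exact Real.add_one_le_exp _

theorem integrable_norm_mul_exp_neg_mul_norm_sq {t : ℝ} (ht : 0 < t) :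
    Integrable fun h : E => ‖h‖ * Real.exp (-t * ‖h‖ ^ 2) := by
  refine ((integrable_exp_neg_mul_norm_sq (E := E) (half_pos ht)).const_mul
    (1 + (t / 2)⁻¹)).mono' (by fun_prop) (Eventually.of_forall fun h => ?_)
  rw [Real.norm_of_nonneg (by positivity)]
  calc ‖h‖ * Real.exp (-t * ‖h‖ ^ 2)
      ≤ (1 + (t / 2)⁻¹) * Real.exp (t / 2 * ‖h‖ ^ 2) * Real.exp (-t * ‖h‖ ^ 2) := by
        gcongr; exact le_mul_exp_mul_sq (half_pos ht) _
    _ = (1 + (t / 2)⁻¹) * Real.exp (-(t / 2) * ‖h‖ ^ 2) := by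
        rw [mul_assoc, ← Real.exp_add]; ring_nf

theorem re_fourierChar_smul (θ a : ℝ) :
    (Real.fourierChar (-θ) • (a : ℂ)).re = Real.cos (2 * Real.pi * θ) * a := by
  rw [Circle.smul_def, Real.fourierChar_apply, smul_eq_mul, Complex.re_mul_ofReal,
    Complex.exp_ofReal_mul_I_re, mul_neg, Real.cos_neg]

theorem re_fourier_ofReal {g : E → ℝ} (hg : Integrable g) (ξ : E) :
    (𝓕 (fun h => (g h : ℂ)) ξ).re = ∫ h, Real.cos (2 * Real.pi * inner ℝ h ξ) * g h := by
  have hre := integral_re (𝕜 := ℂ) ((Real.fourierIntegral_convergent_iff ξ).2 hg.ofReal)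
  simp only [RCLike.re_eq_complex_re] at hre
  rw [Real.fourier_eq]
  exact hre.symm.trans
    (integral_congr_ae (Eventually.of_forall fun h => re_fourierChar_smul _ _))

theorem integral_cos_mul_gaussian {t : ℝ} (ht : 0 < t) (ξ : E) :
    ∫ h : E, Real.cos (2 * Real.pi * inner ℝ h ξ) * Real.exp (-t * ‖h‖ ^ 2) =
      (Real.pi / t) ^ ((finrank ℝ E : ℝ) / 2) * Real.exp (-(Real.pi ^ 2 * ‖ξ‖ ^ 2) / t) := by
  have hcast : ((Real.pi / t) ^ ((finrank ℝ E : ℂ) / 2) : ℂ) *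
      Complex.exp (-Real.pi ^ 2 * ‖ξ‖ ^ 2 / t) = (((Real.pi / t) ^ ((finrank ℝ E : ℝ) / 2) *
        Real.exp (-(Real.pi ^ 2 * ‖ξ‖ ^ 2) / t) : ℝ) : ℂ) := by
    push_cast
    rw [Complex.ofReal_cpow (by positivity)]
    simp
  have hfourier := fourier_gaussian_innerProductSpace (V := E) (b := (t : ℂ)) (by simpa using ht) ξ
  rw [← re_fourier_ofReal (integrable_exp_neg_mul_norm_sq ht)]
  push_cast
  rw [hfourier, hcast, Complex.ofReal_re]

theorem hasDerivAt_integral_cos_inner_mul {g : E → ℝ} (hg : Integrable g)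
    (hg' : Integrable fun h => ‖h‖ * g h) (ξ e : E) :
    HasDerivAt (fun r : ℝ => ∫ h, Real.cos (2 * Real.pi * inner ℝ h (ξ + r • e)) * g h)
      (-(2 * Real.pi) * ∫ h, Real.sin (2 * Real.pi * inner ℝ h ξ) * inner ℝ h e * g h) 0 := by
  have hderiv : ∀ (h : E) (r : ℝ),
      HasDerivAt (fun r : ℝ => Real.cos (2 * Real.pi * inner ℝ h (ξ + r • e)) * g h)
        (-(2 * Real.pi) * (Real.sin (2 * Real.pi * inner ℝ h (ξ + r • e)) * inner ℝ h e * g h))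
        r := fun h r => by
    have hphase : HasDerivAt (fun r : ℝ => 2 * Real.pi * inner ℝ h (ξ + r • e))
        (2 * Real.pi * inner ℝ h e) r := by
      simp only [inner_add_right, inner_smul_right]
      simpa using (((hasDerivAt_id r).mul_const (inner ℝ h e)).const_add
        (inner ℝ h ξ)).const_mul (2 * Real.pi)
    exact (hphase.cos.mul_const (g h)).congr_deriv (by ring)
  have hmeas : ∀ r : ℝ, AEStronglyMeasurable
      (fun h : E => Real.cos (2 * Real.pi * inner ℝ h (ξ + r • e)) * g h) volume := fun r =>
    (by fun_prop : Continuous fun h : E =>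
      Real.cos (2 * Real.pi * inner ℝ h (ξ + r • e))).aestronglyMeasurable.mul hg.1
  have hbound : ∀ (h : E) (r : ℝ),
      ‖-(2 * Real.pi) * (Real.sin (2 * Real.pi * inner ℝ h (ξ + r • e)) * inner ℝ h e * g h)‖ ≤
        2 * Real.pi * ‖e‖ * ‖‖h‖ * g h‖ := fun h r => by
    simp only [norm_mul, norm_neg, norm_norm, Real.norm_ofNat, Real.norm_of_nonneg Real.pi_pos.le]
    calc 2 * Real.pi * (‖Real.sin (2 * Real.pi * inner ℝ h (ξ + r • e))‖ * ‖inner ℝ h e‖ * ‖g h‖)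
        ≤ 2 * Real.pi * (1 * (‖h‖ * ‖e‖) * ‖g h‖) := by
          gcongr
          · exact Real.abs_sin_le_one _
          · exact norm_inner_le_norm h e
      _ = _ := by ring
  have hmain := (hasDerivAt_integral_of_dominated_loc_of_deriv_le (x₀ := (0 : ℝ)) univ_mem
    (Eventually.of_forall hmeas)
    (hg.norm.mono' (hmeas 0) (Eventually.of_forall fun h => ?_)) ?_
    (Eventually.of_forall fun h r _ => hbound h r) (hg'.norm.const_mul _)
    (Eventually.of_forall fun h r _ => hderiv h r)).2
  · simpa only [zero_smul, add_zero, integral_const_mul] using hmain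
  · rw [norm_mul]
    exact mul_le_of_le_one_left (norm_nonneg _) (Real.abs_cos_le_one _)
  · exact ((by fun_prop : Continuous fun h : E => Real.sin (2 * Real.pi *
      inner ℝ h (ξ + (0 : ℝ) • e)) * inner ℝ h e).aestronglyMeasurable.mul hg.1).const_mul _

theorem integral_sin_mul_inner_mul_gaussian {t : ℝ} (ht : 0 < t) (ξ e : E) :
    ∫ h : E, Real.sin (2 * Real.pi * inner ℝ h ξ) * inner ℝ h e * Real.exp (-t * ‖h‖ ^ 2) =
      Real.pi / t * inner ℝ ξ e *
        ((Real.pi / t) ^ ((finrank ℝ E : ℝ) / 2) * Real.exp (-(Real.pi ^ 2 * ‖ξ‖ ^ 2) / t)) := by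
  have hintegral := hasDerivAt_integral_cos_inner_mul (integrable_exp_neg_mul_norm_sq (E := E) ht)
    (integrable_norm_mul_exp_neg_mul_norm_sq ht) ξ e
  simp only [integral_cos_mul_gaussian ht] at hintegral
  have hline : HasDerivAt (fun r : ℝ => ξ + r • e) e 0 := by
    simpa using ((hasDerivAt_id (0 : ℝ)).smul_const e).const_add ξ
  have hformula := ((((hline.norm_sq.const_mul (Real.pi ^ 2)).neg).div_const t).exp).const_mul
    ((Real.pi / t) ^ ((finrank ℝ E : ℝ) / 2))
  have heq := hintegral.unique hformula
  simp only [zero_smul, add_zero, Pi.neg_apply] at heq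
  refine mul_left_cancel₀ (neg_ne_zero.2 Real.two_pi_pos.ne') (heq.trans ?_)
  ring

end Gaussian

/-! ### Gamma integrals -/

section GammaIntegrals

theorem integral_rpow_mul_exp_neg {p r : ℝ} (hp : 0 < p) (hr : 0 < r) :
    ∫ t in Set.Ioi (0 : ℝ), t ^ (p - 1) * Real.exp (-t * r) = Real.Gamma p * r ^ (-p) := by
  have h := Real.integral_rpow_mul_exp_neg_mul_Ioi hp hr
  rw [one_div, Real.inv_rpow hr.le, ← Real.rpow_neg hr.le, mul_comm] at h
  rw [← h]
  refine setIntegral_congr_fun measurableSet_Ioi fun t _ => ?_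
  rw [neg_mul, mul_comm t r]

theorem integral_rpow_mul_exp_neg_mul_norm_sq {E : Type*} [NormedAddCommGroup E] {p : ℝ}
    (hp : 0 < p) {h : E} (hh : h ≠ 0) :
    ∫ t in Set.Ioi (0 : ℝ), t ^ (p - 1) * Real.exp (-t * ‖h‖ ^ 2) =
      Real.Gamma p * ‖h‖ ^ (-(2 * p)) := by
  rw [integral_rpow_mul_exp_neg hp (by positivity), ← Real.rpow_natCast, ← Real.rpow_mul
    (norm_nonneg h), Nat.cast_ofNat, mul_neg]

theorem integrableOn_rpow_mul_exp_neg {p r : ℝ} (hp : 0 < p) (hr : 0 < r) :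
    IntegrableOn (fun t : ℝ => t ^ (p - 1) * Real.exp (-t * r)) (Set.Ioi 0) :=
  not_imp_comm.1 integral_undef ((integral_rpow_mul_exp_neg hp hr).trans_ne
    (mul_pos (Real.Gamma_pos_of_pos hp) (Real.rpow_pos_of_pos hr _)).ne')

theorem lintegral_rpow_mul_exp_neg {p r : ℝ} (hp : 0 < p) (hr : 0 < r) :
    ∫⁻ t in Set.Ioi (0 : ℝ), ENNReal.ofReal (t ^ (p - 1) * Real.exp (-t * r)) =
      ENNReal.ofReal (Real.Gamma p * r ^ (-p)) := by
  rw [← integral_rpow_mul_exp_neg hp hr, ofReal_integral_eq_lintegral_ofReal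
    (integrableOn_rpow_mul_exp_neg hp hr)]
  filter_upwards [ae_restrict_mem measurableSet_Ioi] with t ht
  exact mul_nonneg (Real.rpow_nonneg (le_of_lt ht) _) (Real.exp_pos _).le

theorem integral_rpow_mul_exp_neg_div {q u : ℝ} (hq : 0 < q) (hu : 0 < u) :
    ∫ t in Set.Ioi (0 : ℝ), t ^ (-q - 1) * Real.exp (-u / t) = Real.Gamma q * u ^ (-q) := by
  rw [← integral_rpow_mul_exp_neg hq hu, ← integral_comp_rpow_Ioi _ (p := -1) (by norm_num)]
  refine setIntegral_congr_fun measurableSet_Ioi fun t (ht : 0 < t) => ?_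
  simp only [smul_eq_mul]
  rw [← Real.rpow_mul ht.le, abs_neg, abs_one, one_mul, ← mul_assoc, ← Real.rpow_add ht,
    Real.rpow_neg_one]
  congr 2
  · ring
  · rw [div_eq_mul_inv, inv_inv]; ring

theorem lintegral_rpow_mul_exp_neg_div {q u : ℝ} (hq : 0 < q) (hu : 0 < u) :
    ∫⁻ t in Set.Ioi (0 : ℝ), ENNReal.ofReal (t ^ (-q - 1) * Real.exp (-u / t)) =
      ENNReal.ofReal (Real.Gamma q * u ^ (-q)) := by
  have hint : IntegrableOn (fun t : ℝ => t ^ (-q - 1) * Real.exp (-u / t)) (Set.Ioi 0) :=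
    not_imp_comm.1 integral_undef ((integral_rpow_mul_exp_neg_div hq hu).trans_ne
      (mul_pos (Real.Gamma_pos_of_pos hq) (Real.rpow_pos_of_pos hu _)).ne')
  rw [← integral_rpow_mul_exp_neg_div hq hu, ofReal_integral_eq_lintegral_ofReal hint]
  filter_upwards [ae_restrict_mem measurableSet_Ioi] with t ht
  exact mul_nonneg (Real.rpow_nonneg (le_of_lt ht) _) (Real.exp_pos _).le

theorem integral_inv_mul_exp_neg_div (t a : ℝ) :
    ∫ u in (0 : ℝ)..a, t⁻¹ * Real.exp (-u / t) = 1 - Real.exp (-a / t) := by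
  have hderiv : ∀ u ∈ Set.uIcc 0 a,
      HasDerivAt (fun u => -Real.exp (-u / t)) (t⁻¹ * Real.exp (-u / t)) u := fun u _ =>
    ((((hasDerivAt_id u).neg.div_const t).exp).neg).congr_deriv (by
      simp only [Pi.neg_apply, id]; ring)
  rw [intervalIntegral.integral_eq_sub_of_hasDerivAt hderiv
    ((continuous_const.mul (continuous_neg.div_const t).rexp).intervalIntegrable _ _)]
  simp
  ring

theorem lintegral_Ioc_rpow_sub_one {s a : ℝ} (hs : 0 < s) (ha : 0 ≤ a) :
    ∫⁻ u in Set.Ioc 0 a, ENNReal.ofReal (u ^ (s - 1)) = ENNReal.ofReal (a ^ s / s) := by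
  have hint : IntervalIntegrable (fun u : ℝ => u ^ (s - 1)) volume 0 a :=
    intervalIntegral.intervalIntegrable_rpow' (by linarith)
  rw [← ofReal_integral_eq_lintegral_ofReal ((intervalIntegrable_iff_integrableOn_Ioc_of_le ha).1
    hint), ← intervalIntegral.integral_of_le ha, integral_rpow (Or.inl (by linarith)),
    sub_add_cancel, Real.zero_rpow hs.ne', sub_zero]
  filter_upwards [ae_restrict_mem measurableSet_Ioc] with u hu
  exact Real.rpow_nonneg hu.1.le _

theorem lintegral_rpow_mul_one_sub_exp {s a : ℝ} (hs0 : 0 < s) (hs1 : s < 1) (ha : 0 ≤ a) :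
    ∫⁻ t in Set.Ioi (0 : ℝ), ENNReal.ofReal (t ^ (s - 1) * (1 - Real.exp (-a / t))) =
      ENNReal.ofReal (Real.Gamma (1 - s) / s * a ^ s) := by
  have hG : 0 < Real.Gamma (1 - s) := Real.Gamma_pos_of_pos (by linarith)
  have hlayer : ∀ t ∈ Set.Ioi (0 : ℝ), ENNReal.ofReal (t ^ (s - 1) * (1 - Real.exp (-a / t))) =
      ∫⁻ u in Set.Ioc 0 a, ENNReal.ofReal (t ^ (-(1 - s) - 1) * Real.exp (-u / t)) := by
    intro t (ht : 0 < t)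
    have hpow : t ^ (-(1 - s) - 1) = t ^ (s - 1) * t⁻¹ := by
      rw [← Real.rpow_neg_one t, ← Real.rpow_add ht]; congr 1; ring
    have hcont : Continuous fun u : ℝ => t ^ (-(1 - s) - 1) * Real.exp (-u / t) := by fun_prop
    rw [← ofReal_integral_eq_lintegral_ofReal hcont.integrableOn_Ioc
      (Eventually.of_forall fun u => by positivity), ← intervalIntegral.integral_of_le ha,
      ← integral_inv_mul_exp_neg_div, ← intervalIntegral.integral_const_mul]
    simp only [hpow, mul_assoc]
  have hinner : ∀ u ∈ Set.Ioc 0 a, ∫⁻ t in Set.Ioi (0 : ℝ),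
      ENNReal.ofReal (t ^ (-(1 - s) - 1) * Real.exp (-u / t)) =
        ENNReal.ofReal (Real.Gamma (1 - s)) * ENNReal.ofReal (u ^ (s - 1)) := fun u hu => by
    rw [lintegral_rpow_mul_exp_neg_div (by linarith) hu.1, neg_sub, ENNReal.ofReal_mul hG.le]
  rw [setLIntegral_congr_fun measurableSet_Ioi hlayer, lintegral_lintegral_swap,
    setLIntegral_congr_fun measurableSet_Ioc hinner, lintegral_const_mul _ (by fun_prop),
    lintegral_Ioc_rpow_sub_one hs0 ha, ← ENNReal.ofReal_mul hG.le]
  · congr 1; ring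
  · exact Measurable.aemeasurable (by unfold Function.uncurry; fun_prop)

end GammaIntegrals

/-! ### The symbol of the fractional Laplacian -/

section FractionalLaplacianSymbol

variable {n : ℕ} {s : ℝ}

theorem abs_Gamma_neg (hs0 : 0 < s) (hs1 : s < 1) :
    |Real.Gamma (-s)| = Real.Gamma (1 - s) / s := by
  have hrec := Real.Gamma_add_one (neg_ne_zero.2 hs0.ne')
  rw [neg_add_eq_sub] at hrec
  have hG : 0 < Real.Gamma (1 - s) := Real.Gamma_pos_of_pos (by linarith)
  rw [hrec, abs_of_neg]
  · field_simp
  · by_contra hcon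
    nlinarith

theorem fracLapConst_pos (n : ℕ) (hs0 : 0 < s) (hs1 : s < 1) : 0 < fracLapConst n s := by
  have : 0 < Real.Gamma (s + n / 2) := Real.Gamma_pos_of_pos (by positivity)
  have : 0 < Real.Gamma (1 - s) := Real.Gamma_pos_of_pos (by linarith)
  rw [fracLapConst, abs_Gamma_neg hs0 hs1]
  positivity

theorem ofReal_mul_norm_rpow_eq_lintegral {p c : ℝ} (hp : 0 < p) (hc : 0 ≤ c) {h : Eucl n}
    (hh : h ≠ 0) :
    ENNReal.ofReal (c * ‖h‖ ^ (-(2 * p))) = ∫⁻ t in Set.Ioi (0 : ℝ),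
      ENNReal.ofReal ((Real.Gamma p)⁻¹ * t ^ (p - 1) * (c * Real.exp (-t * ‖h‖ ^ 2))) := by
  have : 0 < Real.Gamma p := Real.Gamma_pos_of_pos hp
  have hsplit : ∀ t : ℝ, ENNReal.ofReal ((Real.Gamma p)⁻¹ * t ^ (p - 1) *
      (c * Real.exp (-t * ‖h‖ ^ 2))) = ENNReal.ofReal ((Real.Gamma p)⁻¹ * c) *
        ENNReal.ofReal (t ^ (p - 1) * Real.exp (-t * ‖h‖ ^ 2)) := fun t => by
    rw [← ENNReal.ofReal_mul (by positivity)]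
    congr 1; ring
  simp only [hsplit]
  rw [lintegral_const_mul _ (by fun_prop), lintegral_rpow_mul_exp_neg hp (by positivity),
    ← ENNReal.ofReal_mul (by positivity), ← Real.rpow_natCast ‖h‖ 2,
    ← Real.rpow_mul (norm_nonneg h), Nat.cast_ofNat, mul_neg]
  congr 1
  field_simp

theorem lintegral_one_sub_cos_mul_gaussian {t : ℝ} (ht : 0 < t) (ξ : Eucl n) :
    ∫⁻ h : Eucl n, ENNReal.ofReal
        ((1 - Real.cos (2 * Real.pi * inner ℝ h ξ)) * Real.exp (-t * ‖h‖ ^ 2)) =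
      ENNReal.ofReal ((Real.pi / t) ^ ((n : ℝ) / 2) *
        (1 - Real.exp (-(Real.pi ^ 2 * ‖ξ‖ ^ 2) / t))) := by
  have hgauss := integrable_exp_neg_mul_norm_sq (E := Eucl n) ht
  have hcos : Integrable fun h : Eucl n =>
      Real.cos (2 * Real.pi * inner ℝ h ξ) * Real.exp (-t * ‖h‖ ^ 2) :=
    hgauss.bdd_mul (c := 1) (by fun_prop) (Eventually.of_forall fun h => Real.abs_cos_le_one _)
  have hsub : (fun h : Eucl n => (1 - Real.cos (2 * Real.pi * inner ℝ h ξ)) *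
      Real.exp (-t * ‖h‖ ^ 2)) = fun h => Real.exp (-t * ‖h‖ ^ 2) -
        Real.cos (2 * Real.pi * inner ℝ h ξ) * Real.exp (-t * ‖h‖ ^ 2) := by
    funext h; ring
  rw [← ofReal_integral_eq_lintegral_ofReal (hsub ▸ hgauss.sub hcos) (Eventually.of_forall
    fun h => mul_nonneg (sub_nonneg.2 (Real.cos_le_one _)) (Real.exp_pos _).le), hsub,
    integral_sub hgauss hcos, integral_cos_mul_gaussian ht,
    GaussianFourier.integral_rexp_neg_mul_sq_norm ht, finrank_euclideanSpace_fin]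
  ring_nf

theorem two_pi_mul_rpow_div_fracLapConst (hs0 : 0 < s) (hs1 : s < 1) {r : ℝ} (hr : 0 ≤ r) :
    (2 * Real.pi * r) ^ (2 * s) / fracLapConst n s =
      (Real.Gamma (s + n / 2))⁻¹ * Real.pi ^ ((n : ℝ) / 2) *
        (Real.Gamma (1 - s) / s * (Real.pi ^ 2 * r ^ 2) ^ s) := by
  have := Real.pi_pos
  have : 0 < Real.Gamma (s + n / 2) := Real.Gamma_pos_of_pos (by positivity)
  have hG' : 0 < Real.Gamma (1 - s) := Real.Gamma_pos_of_pos (by linarith)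
  have hpow : (2 * Real.pi * r) ^ (2 * s) = 4 ^ s * (Real.pi ^ 2 * r ^ 2) ^ s := by
    rw [Real.rpow_mul (by positivity), Real.rpow_ofNat, ← Real.mul_rpow (by norm_num)
      (by positivity)]
    ring_nf
  rw [hpow, fracLapConst, abs_Gamma_neg hs0 hs1]
  field_simp

theorem lintegral_one_sub_cos (hn : 1 ≤ n) (hs0 : 0 < s) (hs1 : s < 1) (ξ : Eucl n) :
    ∫⁻ h : Eucl n, ENNReal.ofReal ((1 - Real.cos (2 * Real.pi * inner ℝ h ξ)) *
      ‖h‖ ^ (-((n : ℝ) + 2 * s))) =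
      ENNReal.ofReal ((2 * Real.pi * ‖ξ‖) ^ (2 * s) / fracLapConst n s) := by
  have hpi := Real.pi_pos
  set p : ℝ := s + n / 2 with hp
  have hp0 : 0 < p := by positivity
  have : 0 < Real.Gamma p := Real.Gamma_pos_of_pos hp0
  have : Nonempty (Fin n) := ⟨⟨0, hn⟩⟩
  have hsubord : ∀ᵐ h : Eucl n, ENNReal.ofReal ((1 - Real.cos (2 * Real.pi * inner ℝ h ξ)) *
      ‖h‖ ^ (-((n : ℝ) + 2 * s))) = ∫⁻ t in Set.Ioi (0 : ℝ), ENNReal.ofReal ((Real.Gamma p)⁻¹ *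
        t ^ (p - 1) * ((1 - Real.cos (2 * Real.pi * inner ℝ h ξ)) * Real.exp (-t * ‖h‖ ^ 2))) := by
    filter_upwards [Measure.ae_ne volume (0 : Eucl n)] with h hh
    rw [← ofReal_mul_norm_rpow_eq_lintegral hp0 (sub_nonneg.2 (Real.cos_le_one _)) hh,
      show -((n : ℝ) + 2 * s) = -(2 * p) by rw [hp]; ring]
  have hgauss : ∀ t ∈ Set.Ioi (0 : ℝ), ∫⁻ h : Eucl n, ENNReal.ofReal ((Real.Gamma p)⁻¹ *
      t ^ (p - 1) * ((1 - Real.cos (2 * Real.pi * inner ℝ h ξ)) * Real.exp (-t * ‖h‖ ^ 2))) =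
        ENNReal.ofReal ((Real.Gamma p)⁻¹ * Real.pi ^ ((n : ℝ) / 2)) *
          ENNReal.ofReal (t ^ (s - 1) * (1 - Real.exp (-(Real.pi ^ 2 * ‖ξ‖ ^ 2) / t))) := by
    intro t (ht : 0 < t)
    have hpow : t ^ (p - 1) = t ^ (s - 1) * t ^ ((n : ℝ) / 2) := by
      rw [← Real.rpow_add ht]; congr 1; rw [hp]; ring
    simp only [ENNReal.ofReal_mul (show 0 ≤ (Real.Gamma p)⁻¹ * t ^ (p - 1) by positivity)]
    rw [lintegral_const_mul _ (by fun_prop), lintegral_one_sub_cos_mul_gaussian ht,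
      ← ENNReal.ofReal_mul (by positivity), ← ENNReal.ofReal_mul (by positivity), hpow,
      Real.div_rpow hpi.le ht.le]
    congr 1
    field_simp
  rw [lintegral_congr_ae hsubord, lintegral_lintegral_swap,
    setLIntegral_congr_fun measurableSet_Ioi hgauss, lintegral_const_mul _ (by fun_prop),
    lintegral_rpow_mul_one_sub_exp hs0 hs1 (by positivity), ← ENNReal.ofReal_mul (by positivity),
    two_pi_mul_rpow_div_fracLapConst hs0 hs1 (norm_nonneg ξ)]
  exact Measurable.aemeasurable (by unfold Function.uncurry; fun_prop)

end FractionalLaplacianSymbol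

/-! ### The kernel of the weighted gradient and its symbol -/

section SineTransform

variable {E : Type*} [NormedAddCommGroup E] [InnerProductSpace ℝ E] [FiniteDimensional ℝ E]
  [MeasurableSpace E] [BorelSpace E]

/-- The sine transform of a real kernel: up to the factor `i`, the Fourier symbol of the difference
operator with an odd kernel. -/
def sineTransform (k : E → ℝ) (ξ : E) : ℝ :=
  ∫ h, k h * Real.sin (2 * Real.pi * inner ℝ h ξ)

theorem integrable_mul_sin_inner {k : E → ℝ} (hk : Integrable k) (ξ : E) :
    Integrable fun h => k h * Real.sin (2 * Real.pi * inner ℝ h ξ) :=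
  hk.mul_bdd (c := 1) (by fun_prop) (Eventually.of_forall fun _ => Real.abs_sin_le_one _)

theorem continuous_sineTransform {k : E → ℝ} (hk : Integrable k) : Continuous (sineTransform k) :=
  continuous_of_dominated (bound := fun h => ‖k h‖)
    (fun ξ => (integrable_mul_sin_inner hk ξ).aestronglyMeasurable)
    (fun _ => Eventually.of_forall fun _ => by
      rw [norm_mul]
      exact mul_le_of_le_one_right (norm_nonneg _) (Real.abs_sin_le_one _))
    hk.norm (Eventually.of_forall fun _ => by fun_prop)

theorem sineTransform_sub {k k' : E → ℝ} (hk : Integrable k) (hk' : Integrable k') (ξ : E) :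
    sineTransform (k - k') ξ = sineTransform k ξ - sineTransform k' ξ := by
  simp only [sineTransform, Pi.sub_apply, sub_mul]
  exact integral_sub (integrable_mul_sin_inner hk ξ) (integrable_mul_sin_inner hk' ξ)

end SineTransform

section Kernel

variable {n : ℕ} {s : ℝ}

theorem weightConst_pos (n : ℕ) (hs0 : 0 < s) (hs1 : s < 1) : 0 < weightConst n s := by
  have : 0 < Real.Gamma ((n + s + 1) / 2) := Real.Gamma_pos_of_pos (by positivity)
  have : 0 < Real.Gamma ((1 - s) / 2) := Real.Gamma_pos_of_pos (by linarith)
  unfold weightConst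
  positivity

theorem integrable_min_mul_rpow (hn : 1 ≤ n) (hs0 : 0 < s) (hs1 : s < 1) :
    Integrable fun h : Eucl n => min 1 ‖h‖ * ‖h‖ ^ (-((n : ℝ) + s)) := by
  have : Nonempty (Fin n) := ⟨⟨0, hn⟩⟩
  have hpow : ∀ r : ℝ, 0 < r → r ^ (Module.finrank ℝ (Eucl n) - 1) * r ^ (-((n : ℝ) + s)) =
      r ^ (-1 - s) := fun r hr => by
    rw [← Real.rpow_natCast, ← Real.rpow_add hr, finrank_euclideanSpace_fin, Nat.cast_sub hn]
    congr 1; push_cast; ring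
  refine (integrable_fun_norm_addHaar (E := Eucl n) volume
    (f := fun r : ℝ => min 1 r * r ^ (-((n : ℝ) + s)))).2 ?_
  rw [← Set.Ioc_union_Ioi_eq_Ioi (zero_le_one' ℝ)]
  refine IntegrableOn.union ?_ ?_
  · have hnear : IntegrableOn (fun r : ℝ => r ^ (-s)) (Set.Ioc 0 1) :=
      (intervalIntegrable_iff_integrableOn_Ioc_of_le zero_le_one).1
        (intervalIntegral.intervalIntegrable_rpow' (by linarith))
    refine hnear.congr_fun (fun r hr => ?_) measurableSet_Ioc
    simp only [smul_eq_mul]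
    rw [min_eq_right hr.2, mul_left_comm, hpow r hr.1, ← Real.rpow_one_add' hr.1.le (by linarith)]
    ring_nf
  · have hfar : IntegrableOn (fun r : ℝ => r ^ (-1 - s)) (Set.Ioi 1) :=
      integrableOn_Ioi_rpow_of_lt (by linarith) zero_lt_one
    refine hfar.congr_fun (fun r (hr : 1 < r) => ?_) measurableSet_Ioi
    simp only [smul_eq_mul]
    rw [min_eq_left hr.le, one_mul, hpow r (by linarith)]

theorem min_mul_rpow_comp_smul {b : ℝ} (hb : 0 < b) (h : Eucl n) :
    min 1 (b * ‖h‖) * ‖h‖ ^ (-((n : ℝ) + s)) =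
      b ^ ((n : ℝ) + s) * (min 1 ‖b • h‖ * ‖b • h‖ ^ (-((n : ℝ) + s))) := by
  rw [norm_smul, Real.norm_of_nonneg hb.le, Real.mul_rpow hb.le (norm_nonneg _),
    Real.rpow_neg hb.le]
  have : 0 < b ^ ((n : ℝ) + s) := by positivity
  field_simp

theorem integrable_min_mul_rpow_scaled (hn : 1 ≤ n) (hs0 : 0 < s) (hs1 : s < 1) {b : ℝ}
    (hb : 0 ≤ b) : Integrable fun h : Eucl n => min 1 (b * ‖h‖) * ‖h‖ ^ (-((n : ℝ) + s)) := by
  rcases hb.eq_or_lt with rfl | hb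
  · simp
  simp only [min_mul_rpow_comp_smul hb]
  exact ((integrable_min_mul_rpow hn hs0 hs1).comp_smul hb.ne').const_mul _

theorem integral_min_mul_rpow_scaled (hs0 : 0 < s) {b : ℝ} (hb : 0 ≤ b) :
    ∫ h : Eucl n, min 1 (b * ‖h‖) * ‖h‖ ^ (-((n : ℝ) + s)) =
      (∫ h : Eucl n, min 1 ‖h‖ * ‖h‖ ^ (-((n : ℝ) + s))) * b ^ s := by
  rcases hb.eq_or_lt with rfl | hb
  · simp [Real.zero_rpow hs0.ne']
  simp only [min_mul_rpow_comp_smul hb]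
  rw [integral_const_mul, Measure.integral_comp_smul volume
    (fun h : Eucl n => min 1 ‖h‖ * ‖h‖ ^ (-((n : ℝ) + s))) b, finrank_euclideanSpace_fin,
    abs_of_pos (by positivity), smul_eq_mul, Real.rpow_add hb, Real.rpow_natCast]
  field_simp

/-- The component `C_ω |h|^(-(n+s)) ⟨h / |h|, e⟩` of the convolution kernel of `𝒢_ω` along `e`. -/
def fracKernel (s : ℝ) (e h : Eucl n) : ℝ :=
  weightConst n s * ‖h‖ ^ (-((n : ℝ) + s)) * (‖h‖⁻¹ * inner ℝ h e)

/-- The kernel `fracKernel` cut off to `|h| ≥ ε`, as in the principal value defining `𝒢_ω`. -/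
def truncKernel (s ε : ℝ) (e : Eucl n) : Eucl n → ℝ :=
  (Metric.ball (0 : Eucl n) ε)ᶜ.indicator (fracKernel s e)

theorem measurable_fracKernel (s : ℝ) (e : Eucl n) : Measurable (fracKernel s e) := by
  unfold fracKernel
  fun_prop

theorem measurable_truncKernel (s ε : ℝ) (e : Eucl n) : Measurable (truncKernel s ε e) :=
  (measurable_fracKernel s e).indicator Metric.isOpen_ball.measurableSet.compl

theorem truncKernel_neg (s ε : ℝ) (e h : Eucl n) :
    truncKernel s ε e (-h) = -truncKernel s ε e h := by
  unfold truncKernel Set.indicator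
  simp only [Set.mem_compl_iff, Metric.mem_ball, dist_zero_right, norm_neg, fracKernel,
    inner_neg_left]
  split_ifs <;> ring

theorem abs_fracKernel_le (hs0 : 0 < s) (hs1 : s < 1) (e h : Eucl n) :
    |fracKernel s e h| ≤ weightConst n s * ‖e‖ * ‖h‖ ^ (-((n : ℝ) + s)) := by
  have hw := weightConst_pos n hs0 hs1
  have hdir : |‖h‖⁻¹ * inner ℝ h e| ≤ ‖e‖ := by
    rcases eq_or_ne h 0 with rfl | hh
    · simp
    rw [abs_mul, abs_inv, abs_norm, inv_mul_le_iff₀ (norm_pos_iff.2 hh)]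
    exact abs_real_inner_le_norm h e
  rw [fracKernel, abs_mul, abs_of_nonneg (by positivity), mul_right_comm]
  gcongr

theorem abs_truncKernel_le (s ε : ℝ) (e h : Eucl n) :
    |truncKernel s ε e h| ≤ |fracKernel s e h| := by
  rw [truncKernel, ← Real.norm_eq_abs, ← Real.norm_eq_abs]
  exact norm_indicator_le_norm_self _ _

theorem integrable_truncKernel (hn : 1 ≤ n) (hs0 : 0 < s) (hs1 : s < 1) {ε : ℝ}
    (hε : 0 < ε) (e : Eucl n) : Integrable (truncKernel s ε e) := by
  have hw := weightConst_pos n hs0 hs1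
  refine ((integrable_min_mul_rpow_scaled hn hs0 hs1 (inv_pos.2 hε).le).const_mul
    (weightConst n s * ‖e‖)).mono' (measurable_truncKernel s ε e).aestronglyMeasurable
    (Eventually.of_forall fun h => ?_)
  rw [truncKernel]
  by_cases hh : h ∈ (Metric.ball (0 : Eucl n) ε)ᶜ
  · have hεh : ε ≤ ‖h‖ := by simpa using hh
    rw [Set.indicator_of_mem hh, min_eq_left ((le_inv_mul_iff₀ hε).2 (by simpa using hεh)),
      one_mul]
    exact abs_fracKernel_le hs0 hs1 e h
  · rw [Set.indicator_of_notMem hh, norm_zero]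
    positivity

theorem abs_fracKernel_mul_sin_le (hs0 : 0 < s) (hs1 : s < 1) (e ξ h : Eucl n) :
    |fracKernel s e h * Real.sin (2 * Real.pi * inner ℝ h ξ)| ≤
      weightConst n s * ‖e‖ * (min 1 (2 * Real.pi * ‖ξ‖ * ‖h‖) * ‖h‖ ^ (-((n : ℝ) + s))) := by
  have hw := weightConst_pos n hs0 hs1
  have := Real.pi_pos
  have hsin : |Real.sin (2 * Real.pi * inner ℝ h ξ)| ≤ min 1 (2 * Real.pi * ‖ξ‖ * ‖h‖) := by
    refine le_min (Real.abs_sin_le_one _) (Real.abs_sin_le_abs.trans ?_)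
    rw [abs_mul, abs_of_pos Real.two_pi_pos, mul_assoc (2 * Real.pi), mul_comm ‖ξ‖]
    gcongr
    exact abs_real_inner_le_norm h ξ
  rw [abs_mul]
  calc _ ≤ weightConst n s * ‖e‖ * ‖h‖ ^ (-((n : ℝ) + s)) * min 1 (2 * Real.pi * ‖ξ‖ * ‖h‖) := by
        gcongr; exact abs_fracKernel_le hs0 hs1 e h
    _ = _ := by ring

theorem integrable_fracKernel_mul_sin (hn : 1 ≤ n) (hs0 : 0 < s) (hs1 : s < 1) (e ξ : Eucl n) :
    Integrable fun h => fracKernel s e h * Real.sin (2 * Real.pi * inner ℝ h ξ) :=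
  ((integrable_min_mul_rpow_scaled hn hs0 hs1 (b := 2 * Real.pi * ‖ξ‖)
    (by positivity)).const_mul (weightConst n s * ‖e‖)).mono'
    ((measurable_fracKernel s e).mul (by fun_prop)).aestronglyMeasurable
    (Eventually.of_forall fun h => abs_fracKernel_mul_sin_le hs0 hs1 e ξ h)

theorem abs_truncKernel_mul_sin_le (s ε : ℝ) (e ξ h : Eucl n) :
    |truncKernel s ε e h * Real.sin (2 * Real.pi * inner ℝ h ξ)| ≤
      |fracKernel s e h * Real.sin (2 * Real.pi * inner ℝ h ξ)| := by
  rw [abs_mul, abs_mul]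
  exact mul_le_mul_of_nonneg_right (abs_truncKernel_le s ε e h) (abs_nonneg _)

theorem abs_sineTransform_truncKernel_le (hn : 1 ≤ n) (hs0 : 0 < s) (hs1 : s < 1) (ε : ℝ)
    (e ξ : Eucl n) : |sineTransform (truncKernel s ε e) ξ| ≤ weightConst n s * ‖e‖ *
      ((∫ h : Eucl n, min 1 ‖h‖ * ‖h‖ ^ (-((n : ℝ) + s))) * (2 * Real.pi * ‖ξ‖) ^ s) := by
  rw [← integral_min_mul_rpow_scaled hs0 (by positivity), ← integral_const_mul,
    sineTransform, ← Real.norm_eq_abs]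
  exact norm_integral_le_of_norm_le ((integrable_min_mul_rpow_scaled hn hs0 hs1
    (by positivity)).const_mul _) (Eventually.of_forall fun h =>
      (abs_truncKernel_mul_sin_le s ε e ξ h).trans (abs_fracKernel_mul_sin_le hs0 hs1 e ξ h))

theorem tendsto_sineTransform_truncKernel (hn : 1 ≤ n) (hs0 : 0 < s) (hs1 : s < 1)
    (e ξ : Eucl n) : Tendsto (fun ε => sineTransform (truncKernel s ε e) ξ) (𝓝[>] 0)
      (𝓝 (sineTransform (fracKernel s e) ξ)) := by
  have : Nonempty (Fin n) := ⟨⟨0, hn⟩⟩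
  refine tendsto_integral_filter_of_dominated_convergence
    (fun h => |fracKernel s e h * Real.sin (2 * Real.pi * inner ℝ h ξ)|)
    (Eventually.of_forall fun ε => ((measurable_truncKernel s ε e).mul
      (by fun_prop)).aestronglyMeasurable)
    (Eventually.of_forall fun ε => Eventually.of_forall (abs_truncKernel_mul_sin_le s ε e ξ))
    (integrable_fracKernel_mul_sin hn hs0 hs1 e ξ).abs ?_
  filter_upwards [Measure.ae_ne volume (0 : Eucl n)] with h hh
  refine tendsto_const_nhds.congr' ?_
  filter_upwards [(eventually_lt_nhds (norm_pos_iff.2 hh)).filter_mono nhdsWithin_le_nhds]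
    with ε hε
  rw [truncKernel, Set.indicator_of_mem]
  simpa using hε.le

theorem integrable_prod_mul_rpow_mul_exp (hn : 1 ≤ n) {p : ℝ} (hp : 0 < p) {w : Eucl n → ℝ}
    (hw : Measurable w) (hint : Integrable fun h => w h * ‖h‖ ^ (-(2 * p))) :
    Integrable (fun q : Eucl n × ℝ => w q.1 * (q.2 ^ (p - 1) * Real.exp (-q.2 * ‖q.1‖ ^ 2)))
      (volume.prod (volume.restrict (Set.Ioi 0))) := by
  have : Nonempty (Fin n) := ⟨⟨0, hn⟩⟩
  have hmeas : Measurable fun q : Eucl n × ℝ =>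
      w q.1 * (q.2 ^ (p - 1) * Real.exp (-q.2 * ‖q.1‖ ^ 2)) :=
    (hw.comp measurable_fst).mul (by fun_prop)
  rw [integrable_prod_iff hmeas.aestronglyMeasurable]
  constructor
  · filter_upwards [Measure.ae_ne volume (0 : Eucl n)] with h hh
    exact (integrableOn_rpow_mul_exp_neg hp (by positivity)).const_mul _
  · refine (hint.norm.const_mul (Real.Gamma p)).congr ?_
    filter_upwards [Measure.ae_ne volume (0 : Eucl n)] with h hh
    have hnorm : ∀ t ∈ Set.Ioi (0 : ℝ), ‖w h * (t ^ (p - 1) * Real.exp (-t * ‖h‖ ^ 2))‖ =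
        ‖w h‖ * (t ^ (p - 1) * Real.exp (-t * ‖h‖ ^ 2)) := fun t (ht : 0 < t) => by
      rw [norm_mul, Real.norm_of_nonneg (by positivity : 0 ≤ t ^ (p - 1) * _)]
    rw [setIntegral_congr_fun measurableSet_Ioi hnorm, integral_const_mul,
      integral_rpow_mul_exp_neg_mul_norm_sq hp hh, norm_mul,
      Real.norm_of_nonneg (by positivity : 0 ≤ ‖h‖ ^ (-(2 * p)))]
    ring

/-- Gaussian subordination: `Γ(p) |h|^(-2p)` is the integral of `t^(p-1) exp(-t|h|²)` in `t`. -/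
theorem Gamma_mul_integral_mul_norm_rpow (hn : 1 ≤ n) {p : ℝ} (hp : 0 < p) {w : Eucl n → ℝ}
    (hw : Measurable w) (hint : Integrable fun h => w h * ‖h‖ ^ (-(2 * p))) :
    Real.Gamma p * ∫ h, w h * ‖h‖ ^ (-(2 * p)) =
      ∫ t in Set.Ioi (0 : ℝ), t ^ (p - 1) * ∫ h, w h * Real.exp (-t * ‖h‖ ^ 2) := by
  have : Nonempty (Fin n) := ⟨⟨0, hn⟩⟩
  calc Real.Gamma p * ∫ h, w h * ‖h‖ ^ (-(2 * p))
      = ∫ h, ∫ t in Set.Ioi (0 : ℝ), w h * (t ^ (p - 1) * Real.exp (-t * ‖h‖ ^ 2)) := by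
        rw [← integral_const_mul]
        refine integral_congr_ae ?_
        filter_upwards [Measure.ae_ne volume (0 : Eucl n)] with h hh
        rw [integral_const_mul, integral_rpow_mul_exp_neg_mul_norm_sq hp hh]
        ring
    _ = ∫ t in Set.Ioi (0 : ℝ), ∫ h, w h * (t ^ (p - 1) * Real.exp (-t * ‖h‖ ^ 2)) :=
        integral_integral_swap (integrable_prod_mul_rpow_mul_exp hn hp hw hint)
    _ = _ := by simp only [mul_left_comm (w _), integral_const_mul]

theorem fracKernel_eq (s : ℝ) (e h : Eucl n) :
    fracKernel s e h = weightConst n s * (inner ℝ h e * ‖h‖ ^ (-(2 * ((n + s + 1) / 2)))) := by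
  rcases eq_or_ne h 0 with rfl | hh
  · simp [fracKernel]
  have hpow : ‖h‖ ^ (-(2 * ((n + s + 1) / 2))) = ‖h‖ ^ (-((n : ℝ) + s)) * ‖h‖⁻¹ := by
    rw [← Real.rpow_neg_one ‖h‖, ← Real.rpow_add (norm_pos_iff.2 hh)]; congr 1; ring
  rw [fracKernel, hpow]
  ring

theorem integral_rpow_mul_integral_sin_mul_gaussian (hs1 : s < 1) {ξ : Eucl n} (hξ : ξ ≠ 0)
    (e : Eucl n) :
    ∫ t in Set.Ioi (0 : ℝ), t ^ (((n + s + 1) / 2 : ℝ) - 1) * ∫ h : Eucl n,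
        Real.sin (2 * Real.pi * inner ℝ h ξ) * inner ℝ h e * Real.exp (-t * ‖h‖ ^ 2) =
      Real.pi * inner ℝ ξ e * Real.pi ^ ((n : ℝ) / 2) *
        (Real.Gamma ((1 - s) / 2) * (Real.pi ^ 2 * ‖ξ‖ ^ 2) ^ (-((1 - s) / 2))) := by
  have hpi := Real.pi_pos
  rw [← integral_rpow_mul_exp_neg_div (by linarith) (by positivity), ← integral_const_mul]
  refine setIntegral_congr_fun measurableSet_Ioi fun t (ht : 0 < t) => ?_
  have hpow : t ^ (((n + s + 1) / 2 : ℝ) - 1) =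
      t ^ (-((1 - s) / 2) - 1) * t ^ ((n : ℝ) / 2) * t := by
    rw [← Real.rpow_add ht, ← Real.rpow_add_one ht.ne']; congr 1; ring
  simp only [integral_sin_mul_inner_mul_gaussian ht]
  rw [finrank_euclideanSpace_fin, Real.div_rpow hpi.le ht.le, hpow]
  have : 0 < t ^ ((n : ℝ) / 2) := by positivity
  field_simp

theorem sineTransform_fracKernel (hn : 1 ≤ n) (hs0 : 0 < s) (hs1 : s < 1) (e ξ : Eucl n) :
    sineTransform (fracKernel s e) ξ =
      2 * Real.pi * inner ℝ ξ e * (2 * Real.pi * ‖ξ‖) ^ (s - 1) := by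
  rcases eq_or_ne ξ 0 with rfl | hξ
  · simp [sineTransform]
  have := Real.pi_pos
  have hw := weightConst_pos n hs0 hs1
  have hG : 0 < Real.Gamma ((n + s + 1) / 2) := Real.Gamma_pos_of_pos (by positivity)
  have hG' : 0 < Real.Gamma ((1 - s) / 2) := Real.Gamma_pos_of_pos (by linarith)
  set w : Eucl n → ℝ := fun h => Real.sin (2 * Real.pi * inner ℝ h ξ) * inner ℝ h e
  have hkernel : ∀ h, fracKernel s e h * Real.sin (2 * Real.pi * inner ℝ h ξ) =
      weightConst n s * (w h * ‖h‖ ^ (-(2 * ((n + s + 1) / 2 : ℝ)))) := fun h => by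
    rw [fracKernel_eq]; ring
  have hint : Integrable fun h => w h * ‖h‖ ^ (-(2 * ((n + s + 1) / 2 : ℝ))) := by
    refine ((integrable_fracKernel_mul_sin hn hs0 hs1 e ξ).const_mul
      (weightConst n s)⁻¹).congr (Eventually.of_forall fun h => ?_)
    simp only [hkernel, inv_mul_cancel_left₀ hw.ne']
  have hsubord := Gamma_mul_integral_mul_norm_rpow hn (by positivity) (by fun_prop) hint
  rw [integral_rpow_mul_integral_sin_mul_gaussian hs1 hξ, mul_comm (Real.Gamma _),
    ← eq_div_iff hG.ne'] at hsubord
  have hpow : (Real.pi ^ 2 * ‖ξ‖ ^ 2) ^ (-((1 - s) / 2)) = (Real.pi * ‖ξ‖) ^ (s - 1) := by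
    rw [← mul_pow, ← Real.rpow_natCast, ← Real.rpow_mul (by positivity)]
    congr 1; push_cast; ring
  have hpow_two : (2 * Real.pi * ‖ξ‖) ^ (s - 1) = 2 ^ s / 2 * (Real.pi * ‖ξ‖) ^ (s - 1) := by
    rw [mul_assoc, Real.mul_rpow (by norm_num) (by positivity), Real.rpow_sub_one (by norm_num)]
  simp only [sineTransform, hkernel]
  rw [integral_const_mul, hsubord, weightConst, hpow, hpow_two]
  field_simp

end Kernel

/-! ### Fourier transforms of difference operators -/

section DifferenceOperators

open scoped FourierTransform

section FourierReal

variable {E : Type*} [NormedAddCommGroup E] [InnerProductSpace ℝ E] [FiniteDimensional ℝ E]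
  [MeasurableSpace E] [BorelSpace E]

/-- The Fourier transform of a real-valued function. -/
def fourierReal (v : E → ℝ) : E → ℂ := 𝓕 fun x => (v x : ℂ)

theorem continuous_fourierReal {v : E → ℝ} (hv : Integrable v) : Continuous (fourierReal v) :=
  continuous_fourier_of_integrable hv.ofReal

theorem lintegral_fourierReal_sq {v : E → ℝ} (hv : Integrable v) (hv2 : MemLp v 2) :
    ∫⁻ ξ, ‖fourierReal v ξ‖ₑ ^ 2 = ∫⁻ x, ‖v x‖ₑ ^ 2 := by
  refine (lintegral_enorm_fourier_sq (f := fun x => (v x : ℂ)) hv.ofReal hv2.ofReal).trans ?_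
  simp only [enorm_eq_nnnorm, Complex.nnnorm_real]

theorem fourierReal_eq_integral (v : E → ℝ) (ξ : E) :
    fourierReal v ξ = ∫ x, (Real.fourierChar (-inner ℝ x ξ) : ℂ) * v x := by
  rw [fourierReal, Real.fourier_eq]; rfl

theorem fourierReal_translate_sub {v : E → ℝ} (hv : Integrable v) (h ξ : E) :
    fourierReal (fun x => v (x + h) - v x) ξ =
      ((Real.fourierChar (inner ℝ h ξ) : ℂ) - 1) * fourierReal v ξ := by
  have hchar : ∀ w : E → ℝ, Integrable w →
      Integrable fun x => (Real.fourierChar (-inner ℝ x ξ) : ℂ) * w x := fun w hw =>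
    (Real.fourierIntegral_convergent_iff ξ).2 hw.ofReal
  rw [fourierReal_eq_integral, fourierReal_eq_integral]
  simp only [Complex.ofReal_sub, mul_sub]
  rw [integral_sub (hchar _ (hv.comp_add_right h)) (hchar _ hv), sub_mul, one_mul]
  congr 1
  rw [← integral_const_mul, ← integral_add_right_eq_self _ (-h)]
  refine integral_congr_ae (Eventually.of_forall fun x => ?_)
  simp only [neg_add_cancel_right]
  rw [inner_add_left, inner_neg_left, neg_add, neg_neg, AddChar.map_add_eq_mul, Circle.coe_mul]
  ring

theorem norm_fourierChar_sub_one_sq (θ : ℝ) :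
    ‖(Real.fourierChar θ : ℂ) - 1‖ ^ 2 = 2 * (1 - Real.cos (2 * Real.pi * θ)) := by
  rw [Real.fourierChar_apply, ← Complex.normSq_eq_norm_sq, Complex.normSq_apply, Complex.sub_re,
    Complex.sub_im, Complex.exp_ofReal_mul_I_re, Complex.exp_ofReal_mul_I_im]
  simp only [Complex.one_re, Complex.one_im]
  linear_combination Real.sin_sq_add_cos_sq (2 * Real.pi * θ)

theorem enorm_sq_eq_ofReal {F : Type*} [SeminormedAddCommGroup F] (x : F) :
    ‖x‖ₑ ^ 2 = ENNReal.ofReal (‖x‖ ^ 2) := by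
  rw [← ofReal_norm, ENNReal.ofReal_pow (norm_nonneg _)]

theorem lintegral_translate_sub_sq {v : E → ℝ} (hv : Integrable v) (hv2 : MemLp v 2) (h : E) :
    ∫⁻ x, ‖v (x + h) - v x‖ₑ ^ 2 =
      ∫⁻ ξ, ENNReal.ofReal (2 * (1 - Real.cos (2 * Real.pi * inner ℝ h ξ))) *
        ‖fourierReal v ξ‖ₑ ^ 2 := by
  have hvh2 : MemLp (fun x => v (x + h)) 2 :=
    hv2.comp_measurePreserving (measurePreserving_add_right volume h)
  refine (lintegral_fourierReal_sq (v := fun x => v (x + h) - v x)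
    ((hv.comp_add_right h).sub hv) (hvh2.sub hv2)).symm.trans (lintegral_congr fun ξ => ?_)
  rw [fourierReal_translate_sub hv h ξ, enorm_mul, mul_pow,
    enorm_sq_eq_ofReal ((Real.fourierChar (inner ℝ h ξ) : ℂ) - 1), norm_fourierChar_sub_one_sq]

theorem lintegral_translate_sub_sq_le {v : E → ℝ} (hv : Integrable v) (hv2 : MemLp v 2) (h : E) :
    ∫⁻ x, ‖v (x + h) - v x‖ₑ ^ 2 ≤ 4 * ∫⁻ x, ‖v x‖ₑ ^ 2 := by
  rw [lintegral_translate_sub_sq hv hv2, ← lintegral_fourierReal_sq hv hv2,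
    ← lintegral_const_mul _ ((continuous_fourierReal hv).measurable.enorm.pow_const 2)]
  refine lintegral_mono fun ξ => ?_
  gcongr
  refine (ENNReal.ofReal_le_ofReal (q := 4) ?_).trans (by simp)
  linarith [Real.neg_one_le_cos (2 * Real.pi * inner ℝ h ξ)]

/-- The difference operator `v ↦ ∫ k(h) (v(x + h) - v(x)) dh` with kernel `k`. -/
def diffOp (k v : E → ℝ) (x : E) : ℝ := ∫ h, k h * (v (x + h) - v x)

theorem integrable_mul_translate_sub {k v : E → ℝ} (hk : Integrable k) (hm : Measurable v)
    (hv : Integrable v) :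
    Integrable (fun p : E × E => k p.2 * (v (p.1 + p.2) - v p.1))
      ((volume : Measure E).prod volume) := by
  have hmeas : AEStronglyMeasurable (fun p : E × E => k p.2 * (v (p.1 + p.2) - v p.1))
      ((volume : Measure E).prod volume) :=
    hk.aestronglyMeasurable.comp_snd.mul (by fun_prop)
  have hvh : ∀ h, Integrable fun x => v (x + h) - v x := fun h => (hv.comp_add_right h).sub hv
  rw [integrable_prod_iff' hmeas]
  refine ⟨Eventually.of_forall fun h => (hvh h).const_mul (k h), ?_⟩
  refine (hk.norm.mul_const (2 * ∫ x, ‖v x‖)).mono' hmeas.norm.prod_swap.integral_prod_right'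
    (Eventually.of_forall fun h => ?_)
  rw [Real.norm_of_nonneg (integral_nonneg fun x => norm_nonneg _)]
  simp only [norm_mul]
  rw [integral_const_mul]
  refine mul_le_mul_of_nonneg_left ?_ (norm_nonneg _)
  calc ∫ x, ‖v (x + h) - v x‖ ≤ ∫ x, (‖v (x + h)‖ + ‖v x‖) :=
        integral_mono (hvh h).norm ((hv.comp_add_right h).norm.add hv.norm) fun x => norm_sub_le _ _
    _ = 2 * ∫ x, ‖v x‖ := by
        rw [integral_add (hv.comp_add_right h).norm hv.norm,
          integral_add_right_eq_self (fun x => ‖v x‖) h, two_mul]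

theorem integrable_diffOp {k v : E → ℝ} (hk : Integrable k) (hm : Measurable v)
    (hv : Integrable v) : Integrable (diffOp k v) :=
  (integrable_mul_translate_sub hk hm hv).integral_prod_left

theorem enorm_integral_mul_sq_le {α : Type*} [MeasurableSpace α] {μ : Measure α} {k w : α → ℝ}
    (hk : AEStronglyMeasurable k μ) (hw : AEStronglyMeasurable w μ) :
    ‖∫ h, k h * w h ∂μ‖ₑ ^ 2 ≤ (∫⁻ h, ‖k h‖ₑ ∂μ) * ∫⁻ h, ‖k h‖ₑ * ‖w h‖ₑ ^ 2 ∂μ := by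
  have hsqrt : AEMeasurable (fun h => ‖k h‖ₑ ^ (1 / 2 : ℝ)) μ := hk.enorm.pow_const _
  have sqrt_sq : ∀ a : ENNReal, (a ^ (1 / 2 : ℝ)) ^ (2 : ℝ) = a := fun a => by
    rw [← ENNReal.rpow_mul]; norm_num
  have hle : ‖∫ h, k h * w h ∂μ‖ₑ ≤
      ∫⁻ h, ‖k h‖ₑ ^ (1 / 2 : ℝ) * (‖k h‖ₑ ^ (1 / 2 : ℝ) * ‖w h‖ₑ) ∂μ := by
    refine (enorm_integral_le_lintegral_enorm _).trans (le_of_eq (lintegral_congr fun h => ?_))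
    rw [enorm_mul, ← mul_assoc, ← ENNReal.rpow_add_of_nonneg _ _ (by norm_num) (by norm_num)]
    norm_num
  have hholder := hle.trans (ENNReal.lintegral_mul_le_Lp_mul_Lq μ Real.HolderConjugate.two_two
    hsqrt (hsqrt.mul hw.enorm))
  refine (pow_le_pow_left' hholder 2).trans (le_of_eq ?_)
  rw [mul_pow, ← ENNReal.rpow_natCast, ← ENNReal.rpow_natCast]
  simp only [Nat.cast_ofNat, sqrt_sq]
  congr 1
  refine lintegral_congr fun h => ?_
  rw [ENNReal.mul_rpow_of_nonneg _ _ (by norm_num), sqrt_sq]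
  norm_num

theorem memLp_diffOp {k v : E → ℝ} (hk : Integrable k) (hm : Measurable v)
    (hv : Integrable v) (hv2 : MemLp v 2) : MemLp (diffOp k v) 2 := by
  refine ⟨(integrable_diffOp hk hm hv).aestronglyMeasurable, ?_⟩
  have hk_fin : ∫⁻ h, ‖k h‖ₑ < ⊤ := hk.2
  have hv_fin : ∫⁻ x, ‖v x‖ₑ ^ 2 < ⊤ := by
    rw [lintegral_enorm_sq_eq]; exact ENNReal.pow_lt_top hv2.2
  refine (ENNReal.pow_lt_top_iff.1 ?_).resolve_right two_ne_zero
  calc eLpNorm (diffOp k v) 2 volume ^ 2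
      = ∫⁻ x, ‖diffOp k v x‖ₑ ^ 2 := (lintegral_enorm_sq_eq _ _).symm
    _ ≤ ∫⁻ x, (∫⁻ h, ‖k h‖ₑ) * ∫⁻ h, ‖k h‖ₑ * ‖v (x + h) - v x‖ₑ ^ 2 :=
        lintegral_mono fun x => enorm_integral_mul_sq_le hk.1
          (hm.comp (measurable_const_add x) |>.sub_const _).aestronglyMeasurable
    _ = (∫⁻ h, ‖k h‖ₑ) * ∫⁻ h, ∫⁻ x, ‖k h‖ₑ * ‖v (x + h) - v x‖ₑ ^ 2 := by
        rw [lintegral_const_mul' _ _ hk_fin.ne, lintegral_lintegral_swap]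
        exact hk.aestronglyMeasurable.comp_snd.enorm.mul (Measurable.aemeasurable (by fun_prop))
    _ ≤ (∫⁻ h, ‖k h‖ₑ) * ∫⁻ h, ‖k h‖ₑ * (4 * ∫⁻ x, ‖v x‖ₑ ^ 2) := by
        refine mul_le_mul_right (lintegral_mono fun h => ?_) _
        rw [lintegral_const_mul' _ _ enorm_ne_top]
        exact mul_le_mul_right (lintegral_translate_sub_sq_le hv hv2 h) _
    _ < ⊤ := by
        have hbound : 4 * ∫⁻ x, ‖v x‖ₑ ^ 2 < ⊤ := ENNReal.mul_lt_top (by norm_num) hv_fin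
        rw [lintegral_mul_const' _ _ hbound.ne]
        exact ENNReal.mul_lt_top hk_fin (ENNReal.mul_lt_top hk_fin hbound)

theorem fourierReal_diffOp {k v : E → ℝ} (hk : Integrable k) (hm : Measurable v)
    (hv : Integrable v) (ξ : E) :
    fourierReal (diffOp k v) ξ =
      (∫ h, (k h : ℂ) * ((Real.fourierChar (inner ℝ h ξ) : ℂ) - 1)) * fourierReal v ξ := by
  have hdiffOp : ∀ x, (Real.fourierChar (-inner ℝ x ξ) : ℂ) * (diffOp k v x : ℂ) =
      ∫ h, (Real.fourierChar (-inner ℝ x ξ) : ℂ) * ((k h * (v (x + h) - v x) : ℝ) : ℂ) :=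
    fun x => (congrArg _ (integral_ofReal (𝕜 := ℂ)).symm).trans (integral_const_mul _ _).symm
  rw [fourierReal_eq_integral]
  simp only [hdiffOp]
  rw [integral_integral_swap]
  · rw [← integral_mul_const]
    refine integral_congr_ae (Eventually.of_forall fun h => ?_)
    simp only
    rw [mul_assoc, ← fourierReal_translate_sub hv, fourierReal_eq_integral, ← integral_const_mul]
    refine integral_congr_ae (Eventually.of_forall fun x => ?_)
    simp only [Complex.ofReal_mul]
    ring
  · refine (integrable_mul_translate_sub hk hm hv).ofReal.bdd_mul (𝕜 := ℂ) (c := 1) ?_ ?_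
    · exact Continuous.aestronglyMeasurable (by fun_prop)
    · exact Eventually.of_forall fun p => (Circle.norm_coe _).le

theorem integral_odd_mul_cos_sub_one {k : E → ℝ} (hodd : ∀ h, k (-h) = -k h) (ξ : E) :
    ∫ h, k h * (Real.cos (2 * Real.pi * inner ℝ h ξ) - 1) = 0 := by
  have hneg := integral_neg_eq_self
    (fun h => k h * (Real.cos (2 * Real.pi * inner ℝ h ξ) - 1)) (volume : Measure E)
  simp only [hodd, inner_neg_left, mul_neg, Real.cos_neg, neg_mul, integral_neg] at hneg
  linarith

theorem integral_odd_mul_fourierChar_sub_one {k : E → ℝ} (hk : Integrable k)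
    (hodd : ∀ h, k (-h) = -k h) (ξ : E) :
    ∫ h, (k h : ℂ) * ((Real.fourierChar (inner ℝ h ξ) : ℂ) - 1) =
      Complex.I * (sineTransform k ξ : ℂ) := by
  have hcos : Integrable fun h => k h * (Real.cos (2 * Real.pi * inner ℝ h ξ) - 1) := by
    refine hk.mul_bdd (c := 2) (by fun_prop) (Eventually.of_forall fun h => ?_)
    rw [Real.norm_eq_abs, abs_le]
    constructor <;> linarith [Real.neg_one_le_cos (2 * Real.pi * inner ℝ h ξ),
      Real.cos_le_one (2 * Real.pi * inner ℝ h ξ)]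
  have hsplit : ∀ h : E, (k h : ℂ) * ((Real.fourierChar (inner ℝ h ξ) : ℂ) - 1) =
      ((k h * (Real.cos (2 * Real.pi * inner ℝ h ξ) - 1) : ℝ) : ℂ) +
        Complex.I * ((k h * Real.sin (2 * Real.pi * inner ℝ h ξ) : ℝ) : ℂ) := fun h => by
    rw [Real.fourierChar_apply, Complex.exp_mul_I, ← Complex.ofReal_cos, ← Complex.ofReal_sin]
    push_cast; ring
  simp only [hsplit]
  rw [integral_add hcos.ofReal ((integrable_mul_sin_inner hk ξ).ofReal.const_mul _),
    integral_const_mul, integral_complex_ofReal, integral_complex_ofReal,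
    integral_odd_mul_cos_sub_one hodd, Complex.ofReal_zero, zero_add, sineTransform]

theorem lintegral_diffOp_sq {k v : E → ℝ} (hk : Integrable k) (hodd : ∀ h, k (-h) = -k h)
    (hm : Measurable v) (hv : Integrable v) (hv2 : MemLp v 2) :
    ∫⁻ x, ‖diffOp k v x‖ₑ ^ 2 =
      ∫⁻ ξ, ENNReal.ofReal (sineTransform k ξ ^ 2) * ‖fourierReal v ξ‖ₑ ^ 2 := by
  rw [← lintegral_fourierReal_sq (integrable_diffOp hk hm hv) (memLp_diffOp hk hm hv hv2)]
  refine lintegral_congr fun ξ => ?_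
  rw [fourierReal_diffOp hk hm hv, integral_odd_mul_fourierChar_sub_one hk hodd, enorm_mul,
    mul_pow, enorm_sq_eq_ofReal (Complex.I * _), norm_mul, Complex.norm_I, one_mul,
    Complex.norm_real, Real.norm_eq_abs, sq_abs]

end FourierReal

variable {n : ℕ} {s : ℝ}

theorem lintegral_diffQuot_sq_slice (s : ℝ) (v : Eucl n → ℝ) (x : Eucl n) :
    ∫⁻ y, ‖diffQuot s v (x, y)‖ₑ ^ 2 =
      ∫⁻ h, ENNReal.ofReal (‖h‖ ^ (-((n : ℝ) + 2 * s))) * ‖v (x + h) - v x‖ₑ ^ 2 := by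
  rw [← lintegral_add_left_eq_self _ x]
  refine lintegral_congr fun h => ?_
  have hdiff : diffQuot s v (x, x + h) = -(‖h‖ ^ (-((n : ℝ) / 2 + s)) * (v (x + h) - v x)) := by
    simp only [diffQuot]
    rw [sub_add_cancel_left, norm_neg, Real.rpow_neg (norm_nonneg _)]
    ring
  rw [hdiff, enorm_neg, enorm_mul, mul_pow, enorm_sq_eq_ofReal (‖h‖ ^ (-((n : ℝ) / 2 + s))),
    Real.norm_of_nonneg (by positivity), ← Real.rpow_natCast _ 2, ← Real.rpow_mul (by positivity)]
  congr 3; push_cast; ring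

theorem lintegral_norm_rpow_mul_translate_sub_sq (s : ℝ) {v : Eucl n → ℝ} (hm : Measurable v)
    (hv : Integrable v) (hv2 : MemLp v 2) (h : Eucl n) :
    ∫⁻ x, ENNReal.ofReal (‖h‖ ^ (-((n : ℝ) + 2 * s))) * ‖v (x + h) - v x‖ₑ ^ 2 =
      ∫⁻ ξ, ENNReal.ofReal (2 * ((1 - Real.cos (2 * Real.pi * inner ℝ h ξ)) *
        ‖h‖ ^ (-((n : ℝ) + 2 * s)))) * ‖fourierReal v ξ‖ₑ ^ 2 := by
  have hfm : Measurable (fourierReal v) := (continuous_fourierReal hv).measurable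
  rw [lintegral_const_mul _ (by fun_prop), lintegral_translate_sub_sq hv hv2,
    ← lintegral_const_mul _ (by fun_prop)]
  refine lintegral_congr fun ξ => ?_
  rw [← mul_assoc, ← ENNReal.ofReal_mul (by positivity)]
  congr 2; ring

theorem lintegral_diffQuot_sq (hn : 1 ≤ n) (hs0 : 0 < s) (hs1 : s < 1) {v : Eucl n → ℝ}
    (hm : Measurable v) (hv : Integrable v) (hv2 : MemLp v 2) :
    ∫⁻ p, ‖diffQuot s v p‖ₑ ^ 2 ∂((volume : Measure (Eucl n)).prod volume) =
      ENNReal.ofReal (2 / fracLapConst n s) *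
        ∫⁻ ξ, ENNReal.ofReal ((2 * Real.pi * ‖ξ‖) ^ (2 * s)) * ‖fourierReal v ξ‖ₑ ^ 2 := by
  have hC := fracLapConst_pos n hs0 hs1
  have hfm : Measurable (fourierReal v) := (continuous_fourierReal hv).measurable
  have hdm : Measurable (diffQuot s v) := by unfold diffQuot; fun_prop
  rw [lintegral_prod _ (hdm.enorm.pow_const 2).aemeasurable]
  simp only [lintegral_diffQuot_sq_slice]
  rw [lintegral_lintegral_swap (Measurable.aemeasurable (by unfold Function.uncurry; fun_prop))]
  simp only [lintegral_norm_rpow_mul_translate_sub_sq s hm hv hv2]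
  rw [lintegral_lintegral_swap (Measurable.aemeasurable (by unfold Function.uncurry; fun_prop)),
    ← lintegral_const_mul _ (by fun_prop)]
  refine lintegral_congr fun ξ => ?_
  rw [lintegral_mul_const _ (by fun_prop)]
  simp only [ENNReal.ofReal_mul (zero_le_two (α := ℝ))]
  rw [lintegral_const_mul _ (by fun_prop), lintegral_one_sub_cos hn hs0 hs1, ← mul_assoc,
    ← ENNReal.ofReal_mul (by norm_num), ← ENNReal.ofReal_mul (by positivity)]
  congr 2; ring

end DifferenceOperators

/-! ### Limits in `L^p` along a filter -/

section LpLimits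

variable {α ι F : Type*} [MeasurableSpace α] {μ : Measure α} [NormedAddCommGroup F]
  {p : ENNReal} [Fact (1 ≤ p)] {l : Filter ι} [l.NeBot] {G : ι → α → F}

theorem eq_of_tendsto_eLpNorm_sub (hG : ∀ᶠ i in l, AEStronglyMeasurable (G i) μ) {g g' : Lp F p μ}
    (hg : Tendsto (fun i => eLpNorm (fun x => G i x - g x) p μ) l (𝓝 0))
    (hg' : Tendsto (fun i => eLpNorm (fun x => G i x - g' x) p μ) l (𝓝 0)) : g = g' := by
  have hsum : Tendsto (fun i => eLpNorm (fun x => G i x - g' x) p μ +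
      eLpNorm (fun x => G i x - g x) p μ) l (𝓝 0) := by simpa using hg'.add hg
  have hle : eLpNorm (g - g' : α → F) p μ ≤ 0 := by
    refine ge_of_tendsto hsum (hG.mono fun i hi => ?_)
    have hsplit : (g - g' : α → F) = (fun x => G i x - g' x) - fun x => G i x - g x := by
      funext x; simp
    rw [hsplit]
    exact eLpNorm_sub_le (hi.sub (Lp.aestronglyMeasurable g'))
      (hi.sub (Lp.aestronglyMeasurable g)) Fact.out
  have hp : p ≠ 0 := (zero_lt_one.trans_le Fact.out).ne'
  refine Lp.ext (sub_ae_eq_zero _ _ |>.1 ?_)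
  exact (eLpNorm_eq_zero_iff ((Lp.aestronglyMeasurable g).sub (Lp.aestronglyMeasurable g')) hp).1
    (le_antisymm hle zero_le)

theorem exists_tendsto_eLpNorm_sub [CompleteSpace F] (hG : ∀ᶠ i in l, MemLp (G i) p μ)
    (hcauchy : Tendsto (fun q : ι × ι => eLpNorm (G q.1 - G q.2) p μ) (l ×ˢ l) (𝓝 0)) :
    ∃ g : Lp F p μ, Tendsto (fun i => eLpNorm (fun x => G i x - g x) p μ) l (𝓝 0) ∧
      Tendsto (fun i => eLpNorm (G i) p μ) l (𝓝 ‖g‖ₑ) := by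
  classical
  let L : ι → Lp F p μ := fun i => if h : MemLp (G i) p μ then h.toLp else 0
  have hL : ∀ {i} (h : MemLp (G i) p μ), L i = h.toLp := fun h => dif_pos h
  have hmap : Cauchy (map L l) := by
    rw [cauchy_map_iff, tendsto_uniformity_iff_dist_tendsto_zero]
    refine ⟨inferInstance, ((ENNReal.tendsto_toReal ENNReal.zero_ne_top).comp hcauchy).congr' ?_⟩
    filter_upwards [hG.prod_mk hG] with q hq
    rw [hL hq.1, hL hq.2, dist_edist, Lp.edist_toLp_toLp, Function.comp_apply]
  obtain ⟨g, hg⟩ := CompleteSpace.complete hmap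
  have hLg : Tendsto L l (𝓝 g) := hg
  refine ⟨g, (tendsto_iff_edist_tendsto_0.1 hLg).congr' ?_, (hLg.enorm).congr' ?_⟩
  · filter_upwards [hG] with i hi
    rw [hL hi, Lp.edist_def]
    refine eLpNorm_congr_ae ?_
    filter_upwards [hi.coeFn_toLp] with x hx
    simp [hx]
  · filter_upwards [hG] with i hi
    rw [hL hi, Lp.enorm_toLp]

end LpLimits

/-! ### The weighted gradient in Fourier variables -/

section WeightedGradient

section Multiplier

variable {ι E F : Type*} [Fintype ι] [NormedAddCommGroup E] [InnerProductSpace ℝ E]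
  [FiniteDimensional ℝ E] [MeasurableSpace E] [BorelSpace E] [NormedAddCommGroup F]
  [InnerProductSpace ℝ F] {v : E → ℝ}

/-- The energy `∫ (∑ᵢ mᵢ(ξ)²) |v̂(ξ)|² dξ` of `v` for a family `m` of real Fourier multipliers. -/
def multiplierEnergy (m : ι → E → ℝ) (v : E → ℝ) : ENNReal :=
  ∫⁻ ξ, ENNReal.ofReal (∑ i, m i ξ ^ 2) * ‖fourierReal v ξ‖ₑ ^ 2

/-- The energy `∫ (2π|ξ|)^(2s) |v̂(ξ)|² dξ`. -/
def fourierEnergy (s : ℝ) (v : E → ℝ) : ENNReal :=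
  ∫⁻ ξ, ENNReal.ofReal ((2 * Real.pi * ‖ξ‖) ^ (2 * s)) * ‖fourierReal v ξ‖ₑ ^ 2

theorem memLp_of_inner_orthonormalBasis {α : Type*} [MeasurableSpace α] {μ : Measure α}
    {p : ENNReal} (b : OrthonormalBasis ι ℝ F) {G : α → F}
    (hG : ∀ i, MemLp (fun x => inner ℝ (G x) (b i)) p μ) : MemLp G p μ := by
  have hexpand : G = fun x => ∑ i, inner ℝ (G x) (b i) • b i := by
    funext x
    simp only [real_inner_comm _ (G x), b.sum_repr']
  rw [hexpand]
  exact memLp_finsetSum _ fun i _ =>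
    (ContinuousLinearMap.toSpanSingleton ℝ (b i)).comp_memLp' (hG i)

theorem lintegral_enorm_sq_of_inner_eq_diffOp (b : OrthonormalBasis ι ℝ F) {k : ι → E → ℝ}
    (hk : ∀ i, Integrable (k i)) (hodd : ∀ i h, k i (-h) = -k i h) (hm : Measurable v)
    (hv : Integrable v) (hv2 : MemLp v 2) {G : E → F}
    (hG : ∀ i x, inner ℝ (G x) (b i) = diffOp (k i) v x) :
    ∫⁻ x, ‖G x‖ₑ ^ 2 = multiplierEnergy (fun i => sineTransform (k i)) v := by
  have hfm : Measurable (fourierReal v) := (continuous_fourierReal hv).measurable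
  have hpythagoras : ∀ x, ‖G x‖ₑ ^ 2 = ∑ i, ‖diffOp (k i) v x‖ₑ ^ 2 := fun x => by
    rw [enorm_sq_eq_ofReal, ← b.sum_sq_inner_left,
      ENNReal.ofReal_sum_of_nonneg fun i _ => sq_nonneg _]
    simp only [enorm_sq_eq_ofReal, hG, Real.norm_eq_abs, sq_abs]
  simp only [hpythagoras, multiplierEnergy, ENNReal.ofReal_sum_of_nonneg fun _ _ => sq_nonneg _,
    Finset.sum_mul]
  rw [lintegral_finsetSum' _ fun i _ =>
      ((integrable_diffOp (hk i) hm hv).aestronglyMeasurable.enorm.pow_const 2),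
    lintegral_finsetSum _ fun i _ => ?_]
  · exact Finset.sum_congr rfl fun i _ => lintegral_diffOp_sq (hk i) (hodd i) hm hv hv2
  · have hsine := (continuous_sineTransform (hk i)).measurable
    fun_prop

theorem tendsto_multiplierEnergy {κ : Type*} {l : Filter κ} [l.IsCountablyGenerated] {s : ℝ}
    (hv : Integrable v) (hE : fourierEnergy s v < ⊤)
    {m : κ → ι → E → ℝ} {m₀ : ι → E → ℝ} {M : ℝ} (hmeas : ∀ᶠ j in l, ∀ i, Measurable (m j i))
    (hbound : ∀ j i ξ, |m j i ξ| ≤ M * (2 * Real.pi * ‖ξ‖) ^ s)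
    (hlim : ∀ i ξ, Tendsto (fun j => m j i ξ) l (𝓝 (m₀ i ξ))) :
    Tendsto (fun j => multiplierEnergy (m j) v) l (𝓝 (multiplierEnergy m₀ v)) := by
  have hfm : Measurable (fourierReal v) := (continuous_fourierReal hv).measurable
  have := Real.pi_pos
  refine tendsto_lintegral_filter_of_dominated_convergence
    (fun ξ => ENNReal.ofReal (Fintype.card ι * M ^ 2) *
      (ENNReal.ofReal ((2 * Real.pi * ‖ξ‖) ^ (2 * s)) * ‖fourierReal v ξ‖ₑ ^ 2))
    (hmeas.mono fun j hj => by fun_prop)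
    (Eventually.of_forall fun j => Eventually.of_forall fun ξ => ?_) ?_
    (Eventually.of_forall fun ξ => ?_)
  · rw [← mul_assoc, ← ENNReal.ofReal_mul (by positivity)]
    gcongr
    calc ∑ i, m j i ξ ^ 2 ≤ ∑ _i : ι, (M * (2 * Real.pi * ‖ξ‖) ^ s) ^ 2 :=
          Finset.sum_le_sum fun i _ => by
            rw [← sq_abs]; exact pow_le_pow_left₀ (abs_nonneg _) (hbound j i ξ) 2
      _ = Fintype.card ι * M ^ 2 * (2 * Real.pi * ‖ξ‖) ^ (2 * s) := by
          rw [Finset.sum_const, Finset.card_univ, nsmul_eq_mul, mul_pow,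
            ← Real.rpow_natCast ((2 * Real.pi * ‖ξ‖) ^ s) 2, ← Real.rpow_mul (by positivity)]
          push_cast; ring_nf
  · rw [lintegral_const_mul' _ _ ENNReal.ofReal_ne_top]
    exact (ENNReal.mul_lt_top ENNReal.ofReal_lt_top hE).ne
  · exact ENNReal.Tendsto.mul_const (ENNReal.tendsto_ofReal
      (tendsto_finsetSum _ fun i _ => (hlim i ξ).pow 2))
      (Or.inr (ENNReal.pow_ne_top enorm_ne_top))

end Multiplier

variable {n : ℕ} {s ε δ : ℝ} {v : Eucl n → ℝ}

theorem le_norm_sub_of_mem_compl_ball {x y : Eucl n} (hy : y ∈ (Metric.ball x ε)ᶜ) :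
    ε ≤ ‖x - y‖ := by
  rw [← dist_eq_norm, dist_comm]; simpa using hy

theorem integrableOn_rpow_compl_ball (hn : 1 ≤ n) (hs0 : 0 < s) (hs1 : s < 1) (hε : 0 < ε)
    (x : Eucl n) : IntegrableOn (fun y => ‖x - y‖ ^ (-((n : ℝ) + s))) (Metric.ball x ε)ᶜ := by
  refine ((integrable_min_mul_rpow_scaled hn hs0 hs1 (inv_pos.2 hε).le).comp_sub_left
    x).integrableOn.congr_fun (fun y hy => ?_) Metric.isOpen_ball.measurableSet.compl
  dsimp only
  rw [min_eq_left ((le_inv_mul_iff₀ hε).2 (by simpa using le_norm_sub_of_mem_compl_ball hy)),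
    one_mul]

theorem norm_direction_le (x y : Eucl n) : ‖direction x y‖ ≤ 1 := by
  rw [direction, norm_smul, norm_inv, norm_norm]
  exact inv_mul_le_one

theorem norm_truncGrad_integrand_le (hs0 : 0 < s) (hs1 : s < 1) (v : Eucl n → ℝ) (x y : Eucl n) :
    ‖(weight s x y * (v y - v x)) • direction x y‖ ≤
      weightConst n s * (‖x - y‖ ^ (-((n : ℝ) + s)) * |v y| +
        ‖x - y‖ ^ (-((n : ℝ) + s)) * |v x|) := by
  have hw := weightConst_pos n hs0 hs1
  calc ‖(weight s x y * (v y - v x)) • direction x y‖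
      ≤ ‖weight s x y * (v y - v x)‖ * 1 := by
        rw [norm_smul]; gcongr; exact norm_direction_le x y
    _ = weightConst n s * (‖x - y‖ ^ (-((n : ℝ) + s)) * |v y - v x|) := by
        rw [mul_one, norm_mul, weight, Real.norm_of_nonneg (by positivity), Real.norm_eq_abs]
        ring
    _ ≤ _ := by rw [← mul_add]; gcongr; exact abs_sub _ _

theorem integrableOn_truncGrad (hn : 1 ≤ n) (hs0 : 0 < s) (hs1 : s < 1) (hε : 0 < ε)
    (hm : Measurable v) (hv : Integrable v) (x : Eucl n) :
    IntegrableOn (fun y => (weight s x y * (v y - v x)) • direction x y) (Metric.ball x ε)ᶜ := by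
  have hw := weightConst_pos n hs0 hs1
  have hbound : IntegrableOn (fun y => weightConst n s * (ε ^ (-((n : ℝ) + s)) * |v y| +
      ‖x - y‖ ^ (-((n : ℝ) + s)) * |v x|)) (Metric.ball x ε)ᶜ :=
    ((hv.abs.integrableOn.const_mul _).add
      ((integrableOn_rpow_compl_ball hn hs0 hs1 hε x).mul_const _)).const_mul _
  have hmeas : Measurable fun y => (weight s x y * (v y - v x)) • direction x y := by
    unfold weight direction
    fun_prop
  refine Integrable.mono' hbound hmeas.aestronglyMeasurable ?_
  filter_upwards [ae_restrict_mem Metric.isOpen_ball.measurableSet.compl] with y hy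
  have hpow : ‖x - y‖ ^ (-((n : ℝ) + s)) ≤ ε ^ (-((n : ℝ) + s)) :=
    Real.rpow_le_rpow_of_nonpos hε (le_norm_sub_of_mem_compl_ball hy) (neg_nonpos.2 (by positivity))
  refine (norm_truncGrad_integrand_le hs0 hs1 v x y).trans ?_
  gcongr

theorem indicator_inner_truncGrad (s ε : ℝ) (v : Eucl n → ℝ) (e x h : Eucl n) :
    (Metric.ball x ε)ᶜ.indicator (fun y => innerSL ℝ e ((weight s x y * (v y - v x)) •
      direction x y)) (x + h) = truncKernel s ε e h * (v (x + h) - v x) := by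
  rw [truncKernel]
  by_cases hh : h ∈ (Metric.ball (0 : Eucl n) ε)ᶜ
  · have hxh : x + h ∈ (Metric.ball x ε)ᶜ := by simpa using hh
    rw [Set.indicator_of_mem hh, Set.indicator_of_mem hxh, innerSL_apply_apply, direction,
      add_sub_cancel_left, inner_smul_right, inner_smul_right, weight, fracKernel,
      sub_add_cancel_left, norm_neg, real_inner_comm]
    ring
  · have hxh : x + h ∉ (Metric.ball x ε)ᶜ := by simpa using hh
    rw [Set.indicator_of_notMem hh, Set.indicator_of_notMem hxh, zero_mul]

theorem integrable_truncKernel_mul (hn : 1 ≤ n) (hs0 : 0 < s) (hs1 : s < 1) (hε : 0 < ε)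
    (hm : Measurable v) (hv : Integrable v) (e x : Eucl n) :
    Integrable fun h => truncKernel s ε e h * (v (x + h) - v x) := by
  simp only [← indicator_inner_truncGrad]
  exact ((integrable_indicator_iff Metric.isOpen_ball.measurableSet.compl).2
    ((innerSL ℝ e).integrable_comp (integrableOn_truncGrad hn hs0 hs1 hε hm hv x))).comp_add_left x

theorem inner_truncGrad (hn : 1 ≤ n) (hs0 : 0 < s) (hs1 : s < 1) (hε : 0 < ε)
    (hm : Measurable v) (hv : Integrable v) (e x : Eucl n) :
    inner ℝ (truncGrad s ε v x) e = diffOp (truncKernel s ε e) v x := by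
  have hcomm := (innerSL ℝ e).integral_comp_comm (integrableOn_truncGrad hn hs0 hs1 hε hm hv x)
  rw [real_inner_comm, truncGrad]
  refine hcomm.symm.trans ?_
  rw [← integral_indicator Metric.isOpen_ball.measurableSet.compl, diffOp,
    ← integral_add_left_eq_self _ x]
  exact integral_congr_ae (Eventually.of_forall fun h => indicator_inner_truncGrad s ε v e x h)

theorem diffOp_truncKernel_sub (hn : 1 ≤ n) (hs0 : 0 < s) (hs1 : s < 1) (hε : 0 < ε)
    (hδ : 0 < δ) (hm : Measurable v) (hv : Integrable v) (e x : Eucl n) :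
    diffOp (truncKernel s ε e - truncKernel s δ e) v x =
      diffOp (truncKernel s ε e) v x - diffOp (truncKernel s δ e) v x := by
  simp only [diffOp, Pi.sub_apply, sub_mul]
  exact integral_sub (integrable_truncKernel_mul hn hs0 hs1 hε hm hv e x)
    (integrable_truncKernel_mul hn hs0 hs1 hδ hm hv e x)

theorem memLp_truncGrad (hn : 1 ≤ n) (hs0 : 0 < s) (hs1 : s < 1) (hε : 0 < ε)
    (hm : Measurable v) (hv : Integrable v) (hv2 : MemLp v 2) : MemLp (truncGrad s ε v) 2 := by
  refine memLp_of_inner_orthonormalBasis (EuclideanSpace.basisFun (Fin n) ℝ) fun i => ?_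
  simp only [inner_truncGrad hn hs0 hs1 hε hm hv]
  exact memLp_diffOp (integrable_truncKernel hn hs0 hs1 hε _) hm hv hv2

variable {ι : Type*} [Fintype ι]

theorem lintegral_truncGrad_sq (hn : 1 ≤ n) (hs0 : 0 < s) (hs1 : s < 1) (hε : 0 < ε)
    (b : OrthonormalBasis ι ℝ (Eucl n)) (hm : Measurable v) (hv : Integrable v)
    (hv2 : MemLp v 2) :
    ∫⁻ x, ‖truncGrad s ε v x‖ₑ ^ 2 =
      multiplierEnergy (fun i => sineTransform (truncKernel s ε (b i))) v :=
  lintegral_enorm_sq_of_inner_eq_diffOp b (fun i => integrable_truncKernel hn hs0 hs1 hε (b i))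
    (fun _ => truncKernel_neg s ε _) hm hv hv2
    (fun _ x => inner_truncGrad hn hs0 hs1 hε hm hv _ x)

theorem lintegral_truncGrad_sub_sq (hn : 1 ≤ n) (hs0 : 0 < s) (hs1 : s < 1) (hε : 0 < ε)
    (hδ : 0 < δ) (b : OrthonormalBasis ι ℝ (Eucl n)) (hm : Measurable v) (hv : Integrable v)
    (hv2 : MemLp v 2) :
    ∫⁻ x, ‖(truncGrad s ε v - truncGrad s δ v) x‖ₑ ^ 2 = multiplierEnergy (fun i ξ =>
      sineTransform (truncKernel s ε (b i)) ξ - sineTransform (truncKernel s δ (b i)) ξ) v := by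
  have hk := fun i => integrable_truncKernel hn hs0 hs1 hε (b i)
  have hk' := fun i => integrable_truncKernel hn hs0 hs1 hδ (b i)
  simp only [← sineTransform_sub (hk _) (hk' _)]
  refine lintegral_enorm_sq_of_inner_eq_diffOp b (fun i => (hk i).sub (hk' i)) (fun i h => ?_)
    hm hv hv2 fun i x => ?_
  · simp only [Pi.sub_apply, truncKernel_neg]; ring
  · rw [diffOp_truncKernel_sub hn hs0 hs1 hε hδ hm hv, Pi.sub_apply, inner_sub_left,
      inner_truncGrad hn hs0 hs1 hε hm hv, inner_truncGrad hn hs0 hs1 hδ hm hv]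

theorem multiplierEnergy_fracKernel (hn : 1 ≤ n) (hs0 : 0 < s) (hs1 : s < 1)
    (b : OrthonormalBasis ι ℝ (Eucl n)) (v : Eucl n → ℝ) :
    multiplierEnergy (fun i => sineTransform (fracKernel s (b i))) v = fourierEnergy s v := by
  refine lintegral_congr fun ξ => ?_
  congr 2
  simp only [sineTransform_fracKernel hn hs0 hs1]
  rcases eq_or_ne ξ 0 with rfl | hξ
  · simp [Real.zero_rpow (by positivity : 2 * s ≠ 0)]
  have hξ0 : 0 < 2 * Real.pi * ‖ξ‖ := mul_pos Real.two_pi_pos (norm_pos_iff.2 hξ)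
  simp only [mul_pow _ ((2 * Real.pi * ‖ξ‖) ^ (s - 1)), mul_pow (2 * Real.pi)]
  rw [← Finset.sum_mul, ← Finset.mul_sum, b.sum_sq_inner_left, ← mul_pow, ← mul_pow,
    ← Real.rpow_one_add' hξ0.le (by linarith), ← Real.rpow_natCast, ← Real.rpow_mul hξ0.le]
  congr 1; push_cast; ring

theorem exists_abs_sineTransform_truncKernel_le (hn : 1 ≤ n) (hs0 : 0 < s) (hs1 : s < 1)
    (b : OrthonormalBasis ι ℝ (Eucl n)) :
    ∃ M : ℝ, ∀ (ε : ℝ) (i : ι) (ξ : Eucl n),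
      |sineTransform (truncKernel s ε (b i)) ξ| ≤ M * (2 * Real.pi * ‖ξ‖) ^ s := by
  refine ⟨weightConst n s * ∫ h : Eucl n, min 1 ‖h‖ * ‖h‖ ^ (-((n : ℝ) + s)), fun ε i ξ => ?_⟩
  have hbound := abs_sineTransform_truncKernel_le hn hs0 hs1 ε (b i) ξ
  rwa [b.norm_eq_one, mul_one, ← mul_assoc] at hbound

theorem measurable_sineTransform_truncKernel (hn : 1 ≤ n) (hs0 : 0 < s) (hs1 : s < 1)
    (hε : 0 < ε) (e : Eucl n) : Measurable (sineTransform (truncKernel s ε e)) :=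
  (continuous_sineTransform (integrable_truncKernel hn hs0 hs1 hε e)).measurable

theorem tendsto_eLpNorm_truncGrad_sub (hn : 1 ≤ n) (hs0 : 0 < s) (hs1 : s < 1)
    (hm : Measurable v) (hv : Integrable v) (hv2 : MemLp v 2) (hE : fourierEnergy s v < ⊤) :
    Tendsto (fun q : ℝ × ℝ => eLpNorm (truncGrad s q.1 v - truncGrad s q.2 v) 2 volume)
      (𝓝[>] 0 ×ˢ 𝓝[>] 0) (𝓝 0) := by
  obtain ⟨b⟩ : Nonempty (OrthonormalBasis (Fin n) ℝ (Eucl n)) := ⟨EuclideanSpace.basisFun _ _⟩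
  obtain ⟨M, hM⟩ := exists_abs_sineTransform_truncKernel_le hn hs0 hs1 b
  have hpos : ∀ᶠ q in 𝓝[>] (0 : ℝ) ×ˢ 𝓝[>] (0 : ℝ), 0 < q.1 ∧ 0 < q.2 :=
    eventually_mem_nhdsWithin.prod_mk eventually_mem_nhdsWithin
  have hsymbol := fun i ξ => tendsto_sineTransform_truncKernel hn hs0 hs1 (b i) ξ
  have henergy := tendsto_multiplierEnergy (M := M + M) hv hE
    (m := fun q i ξ => sineTransform (truncKernel s q.1 (b i)) ξ -
      sineTransform (truncKernel s q.2 (b i)) ξ)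
    (hpos.mono fun q hq i => (measurable_sineTransform_truncKernel hn hs0 hs1 hq.1 (b i)).sub
      (measurable_sineTransform_truncKernel hn hs0 hs1 hq.2 (b i)))
    (fun q i ξ => by
      rw [add_mul]
      exact (abs_sub _ _).trans (add_le_add (hM q.1 i ξ) (hM q.2 i ξ)))
    (fun i ξ => ((hsymbol i ξ).comp tendsto_fst).sub ((hsymbol i ξ).comp tendsto_snd))
  have hzero : multiplierEnergy (fun i ξ => sineTransform (fracKernel s (b i)) ξ -
      sineTransform (fracKernel s (b i)) ξ) v = 0 := by simp [multiplierEnergy]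
  rw [hzero] at henergy
  have hsq : Tendsto (fun q : ℝ × ℝ =>
      eLpNorm (truncGrad s q.1 v - truncGrad s q.2 v) 2 volume ^ (2 : ℝ))
      (𝓝[>] 0 ×ˢ 𝓝[>] 0) (𝓝 0) := by
    refine henergy.congr' (hpos.mono fun q hq => ?_)
    dsimp only
    rw [ENNReal.rpow_two, ← lintegral_truncGrad_sub_sq hn hs0 hs1 hq.1 hq.2 b hm hv hv2,
      lintegral_enorm_sq_eq]
  have hroot := hsq.ennrpow_const 2⁻¹
  simp only [← ENNReal.rpow_mul] at hroot
  norm_num at hroot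
  exact hroot

theorem tendsto_eLpNorm_truncGrad (hn : 1 ≤ n) (hs0 : 0 < s) (hs1 : s < 1)
    (hm : Measurable v) (hv : Integrable v) (hv2 : MemLp v 2) (hE : fourierEnergy s v < ⊤) :
    Tendsto (fun ε => eLpNorm (truncGrad s ε v) 2 volume ^ 2) (𝓝[>] 0)
      (𝓝 (fourierEnergy s v)) := by
  obtain ⟨b⟩ : Nonempty (OrthonormalBasis (Fin n) ℝ (Eucl n)) := ⟨EuclideanSpace.basisFun _ _⟩
  obtain ⟨M, hM⟩ := exists_abs_sineTransform_truncKernel_le hn hs0 hs1 b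
  have hpos : ∀ᶠ ε in 𝓝[>] (0 : ℝ), 0 < ε := eventually_mem_nhdsWithin
  rw [← multiplierEnergy_fracKernel hn hs0 hs1 b]
  refine (tendsto_multiplierEnergy hv hE (hpos.mono fun ε hε i =>
    measurable_sineTransform_truncKernel hn hs0 hs1 hε (b i)) hM fun i =>
      tendsto_sineTransform_truncKernel hn hs0 hs1 (b i)).congr' (hpos.mono fun ε hε => ?_)
  rw [← lintegral_truncGrad_sq hn hs0 hs1 hε b hm hv hv2, lintegral_enorm_sq_eq]

theorem exists_hasWeightedGrad (hn : 1 ≤ n) (hs0 : 0 < s) (hs1 : s < 1) {u : L2 n}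
    (hu : Integrable u) (hE : fourierEnergy s u < ⊤) :
    ∃ g, HasWeightedGrad s u g ∧ ‖g‖ₑ ^ 2 = fourierEnergy s u := by
  have hm : Measurable u := (Lp.stronglyMeasurable u).measurable
  have hpos : ∀ᶠ ε in 𝓝[>] (0 : ℝ), 0 < ε := eventually_mem_nhdsWithin
  obtain ⟨g, hg, hnorm⟩ := exists_tendsto_eLpNorm_sub
    (hpos.mono fun ε hε => memLp_truncGrad hn hs0 hs1 hε hm hu (Lp.memLp u))
    (tendsto_eLpNorm_truncGrad_sub hn hs0 hs1 hm hu (Lp.memLp u) hE)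
  exact ⟨g, hg, tendsto_nhds_unique (((ENNReal.continuous_pow 2).tendsto _).comp hnorm)
    (tendsto_eLpNorm_truncGrad hn hs0 hs1 hm hu (Lp.memLp u) hE)⟩

theorem measurable_truncGrad (s ε : ℝ) (hm : Measurable v) : Measurable (truncGrad s ε v) := by
  have hintegrand : Measurable fun q : Eucl n × Eucl n =>
      (weight s q.1 q.2 * (v q.2 - v q.1)) • direction q.1 q.2 := by
    unfold weight direction
    fun_prop
  have hset : MeasurableSet {q : Eucl n × Eucl n | q.2 ∈ (Metric.ball q.1 ε)ᶜ} := by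
    simp only [Set.mem_compl_iff, Metric.mem_ball, not_lt]
    exact measurableSet_le measurable_const (by fun_prop)
  have hind := (hintegrand.indicator hset).stronglyMeasurable.integral_prod_right'
    (ν := (volume : Measure (Eucl n)))
  convert hind.measurable using 2 with x
  rw [truncGrad, ← integral_indicator Metric.isOpen_ball.measurableSet.compl]
  rfl

theorem HasWeightedGrad.unique {u : L2 n} {g g' : Lp (Eucl n) 2 (volume : Measure (Eucl n))}
    (hg : HasWeightedGrad s u g) (hg' : HasWeightedGrad s u g') : g = g' :=
  eq_of_tendsto_eLpNorm_sub (Eventually.of_forall fun ε =>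
    (measurable_truncGrad s ε (Lp.stronglyMeasurable u).measurable).aestronglyMeasurable) hg hg'

theorem hasWeightedGrad_weightedGrad {u : L2 n} (h : ∃ g, HasWeightedGrad s u g) :
    HasWeightedGrad s u (weightedGrad s u) := by
  rw [weightedGrad, dif_pos h]
  exact h.choose_spec

theorem truncGrad_congr (s ε : ℝ) {u v : Eucl n → ℝ} (h : u =ᵐ[volume] v) :
    truncGrad s ε u =ᵐ[volume] truncGrad s ε v := by
  filter_upwards [h] with x hx
  refine integral_congr_ae (ae_restrict_of_ae ?_)
  filter_upwards [h] with y hy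
  rw [hx, hy]

theorem truncGrad_add (hn : 1 ≤ n) (hs0 : 0 < s) (hs1 : s < 1) (hε : 0 < ε) {v v' : Eucl n → ℝ}
    (hm : Measurable v) (hv : Integrable v) (hm' : Measurable v') (hv' : Integrable v') :
    truncGrad s ε (v + v') = truncGrad s ε v + truncGrad s ε v' := by
  funext x
  rw [Pi.add_apply, truncGrad, truncGrad, truncGrad, ← integral_add
    (integrableOn_truncGrad hn hs0 hs1 hε hm hv x) (integrableOn_truncGrad hn hs0 hs1 hε hm' hv' x)]
  refine integral_congr_ae (Eventually.of_forall fun y => ?_)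
  simp only [Pi.add_apply]
  rw [← add_smul]
  congr 1; ring

theorem truncGrad_const_smul (s ε c : ℝ) (v : Eucl n → ℝ) :
    truncGrad s ε (c • v) = c • truncGrad s ε v := by
  funext x
  rw [Pi.smul_apply, truncGrad, truncGrad, ← integral_smul]
  refine integral_congr_ae (Eventually.of_forall fun y => ?_)
  simp only [Pi.smul_apply, smul_eq_mul]
  rw [smul_smul]
  congr 1; ring

theorem HasWeightedGrad.add (hn : 1 ≤ n) (hs0 : 0 < s) (hs1 : s < 1) {u u' : L2 n}
    (hu : Integrable u) (hu' : Integrable u') {g g' : Lp (Eucl n) 2 (volume : Measure (Eucl n))}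
    (hg : HasWeightedGrad s u g) (hg' : HasWeightedGrad s u' g') :
    HasWeightedGrad s (u + u') (g + g') := by
  have hm := (Lp.stronglyMeasurable u).measurable
  have hm' := (Lp.stronglyMeasurable u').measurable
  have hsum : Tendsto (fun ε => eLpNorm (fun x => truncGrad s ε u x - g x) 2 volume +
      eLpNorm (fun x => truncGrad s ε u' x - g' x) 2 volume) (𝓝[>] 0) (𝓝 0) := by
    simpa using Tendsto.add hg hg'
  refine tendsto_of_tendsto_of_tendsto_of_le_of_le' tendsto_const_nhds hsum
    (Eventually.of_forall fun ε => zero_le) ?_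
  filter_upwards [eventually_mem_nhdsWithin] with ε (hε : 0 < ε)
  refine le_trans (le_of_eq (eLpNorm_congr_ae ?_)) (eLpNorm_add_le
    ((measurable_truncGrad s ε hm).aestronglyMeasurable.sub (Lp.aestronglyMeasurable g))
    ((measurable_truncGrad s ε hm').aestronglyMeasurable.sub (Lp.aestronglyMeasurable g'))
    one_le_two)
  filter_upwards [Lp.coeFn_add g g', truncGrad_congr s ε (Lp.coeFn_add u u')] with x hx htrunc
  rw [hx, htrunc, truncGrad_add hn hs0 hs1 hε hm hu hm' hu']
  simp only [Pi.add_apply]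
  abel

theorem HasWeightedGrad.const_smul (c : ℝ) {u : L2 n}
    {g : Lp (Eucl n) 2 (volume : Measure (Eucl n))} (hg : HasWeightedGrad s u g) :
    HasWeightedGrad s (c • u) (c • g) := by
  have hmul := ENNReal.Tendsto.const_mul (a := ‖c‖ₑ) hg (Or.inr enorm_ne_top)
  rw [mul_zero] at hmul
  refine hmul.congr fun ε => ?_
  rw [← eLpNorm_const_smul]
  refine eLpNorm_congr_ae ?_
  filter_upwards [Lp.coeFn_smul c g, truncGrad_congr s ε (Lp.coeFn_smul c u)] with x hx htrunc
  rw [hx, htrunc, truncGrad_const_smul]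
  simp only [Pi.smul_apply, smul_sub]

end WeightedGradient

section SobolevSpace

variable {n : ℕ} {s : ℝ} {Ω : Set (Eucl n)}

theorem Hs.ae_eq_zero (v : Hs s Ω) : ∀ᵐ x, x ∉ Ω → Hs.toL2 v x = 0 := v.2.2

theorem Hs.indicator_toL2 {S : Set (Eucl n)} (hΩS : Ω ⊆ S) (v : Hs s Ω) :
    S.indicator (Hs.toL2 v) =ᵐ[volume] Hs.toL2 v := by
  filter_upwards [Hs.ae_eq_zero v] with x hx
  exact Set.indicator_apply_eq_self.2 fun hxS => hx fun hxΩ => hxS (hΩS hxΩ)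

theorem Hs.integrable_toL2 (hΩb : Bornology.IsBounded Ω) (v : Hs s Ω) :
    Integrable (Hs.toL2 v) := by
  obtain ⟨R, hΩR⟩ := hΩb.subset_ball 0
  have hball : IsFiniteMeasure ((volume : Measure (Eucl n)).restrict (Metric.ball 0 R)) :=
    isFiniteMeasure_restrict.2 measure_ball_lt_top.ne
  have hv : IntegrableOn (Hs.toL2 v) (Metric.ball 0 R) :=
    ((Lp.memLp (Hs.toL2 v)).restrict _).integrable one_le_two
  exact (hv.integrable_indicator measurableSet_ball).congr (Hs.indicator_toL2 hΩR v)

theorem Hs.norm_eq (v : Hs s Ω) : ‖v‖ = ‖Hs.quot v‖ := rfl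

theorem Hs.lintegral_diffQuot_sq (v : Hs s Ω) :
    ∫⁻ p, ‖diffQuot s (Hs.toL2 v) p‖ₑ ^ 2 ∂((volume : Measure (Eucl n)).prod volume) =
      ENNReal.ofReal (‖v‖ ^ 2) := by
  rw [lintegral_enorm_sq_eq, ← Lp.enorm_toLp (Hs.memLp_diffQuot v), enorm_sq_eq_ofReal]
  rfl

theorem Hs.fourierEnergy_toL2 (hn : 1 ≤ n) (hs0 : 0 < s) (hs1 : s < 1)
    (hΩb : Bornology.IsBounded Ω) (v : Hs s Ω) :
    fourierEnergy s (Hs.toL2 v) = ENNReal.ofReal (fracLapConst n s / 2 * ‖v‖ ^ 2) := by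
  have hC := fracLapConst_pos n hs0 hs1
  rw [ENNReal.ofReal_mul (by positivity), ← Hs.lintegral_diffQuot_sq,
    FracDiff.lintegral_diffQuot_sq hn hs0 hs1 (Lp.stronglyMeasurable _).measurable
      (Hs.integrable_toL2 hΩb v) (Lp.memLp _), ← mul_assoc, ← ENNReal.ofReal_mul (by positivity),
    div_mul_div_cancel₀ two_ne_zero, div_self hC.ne', ENNReal.ofReal_one, one_mul, fourierEnergy]

theorem Hs.exists_hasWeightedGrad (hn : 1 ≤ n) (hs0 : 0 < s) (hs1 : s < 1)
    (hΩb : Bornology.IsBounded Ω) (v : Hs s Ω) :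
    ∃ g, HasWeightedGrad s (Hs.toL2 v) g ∧ ‖g‖ ^ 2 = fracLapConst n s / 2 * ‖v‖ ^ 2 := by
  have hC := fracLapConst_pos n hs0 hs1
  have henergy := Hs.fourierEnergy_toL2 hn hs0 hs1 hΩb v
  obtain ⟨g, hg, hnorm⟩ := FracDiff.exists_hasWeightedGrad hn hs0 hs1 (Hs.integrable_toL2 hΩb v)
    (henergy ▸ ENNReal.ofReal_lt_top)
  rw [henergy, enorm_sq_eq_ofReal] at hnorm
  exact ⟨g, hg, (ENNReal.ofReal_eq_ofReal_iff (by positivity) (by positivity)).1 hnorm⟩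

theorem Hs.hasWeightedGrad_weightedGrad (hn : 1 ≤ n) (hs0 : 0 < s) (hs1 : s < 1)
    (hΩb : Bornology.IsBounded Ω) (v : Hs s Ω) :
    HasWeightedGrad s (Hs.toL2 v) (weightedGrad s (Hs.toL2 v)) :=
  FracDiff.hasWeightedGrad_weightedGrad
    ((Hs.exists_hasWeightedGrad hn hs0 hs1 hΩb v).imp fun _ hg => hg.1)

theorem Hs.norm_weightedGrad (hn : 1 ≤ n) (hs0 : 0 < s) (hs1 : s < 1)
    (hΩb : Bornology.IsBounded Ω) (v : Hs s Ω) :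
    ‖weightedGrad s (Hs.toL2 v)‖ = √(fracLapConst n s / 2) * ‖v‖ := by
  obtain ⟨g, hg, hnorm⟩ := Hs.exists_hasWeightedGrad hn hs0 hs1 hΩb v
  rw [(Hs.hasWeightedGrad_weightedGrad hn hs0 hs1 hΩb v).unique hg, ← Real.sqrt_sq (norm_nonneg g),
    hnorm, Real.sqrt_mul' _ (sq_nonneg _), Real.sqrt_sq (norm_nonneg v)]

/-- The weighted gradient `𝒢_ω` as a bounded linear map from `H^s_Ω` to `L²(ℝⁿ; ℝⁿ)`. -/
def Hs.grad (hn : 1 ≤ n) (hs0 : 0 < s) (hs1 : s < 1) (hΩb : Bornology.IsBounded Ω) :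
    Hs s Ω →L[ℝ] Lp (Eucl n) 2 (volume : Measure (Eucl n)) :=
  LinearMap.mkContinuous
    { toFun := fun v => weightedGrad s (Hs.toL2 v)
      map_add' := fun v w => (Hs.hasWeightedGrad_weightedGrad hn hs0 hs1 hΩb (v + w)).unique <| by
        rw [map_add]
        exact (Hs.hasWeightedGrad_weightedGrad hn hs0 hs1 hΩb v).add hn hs0 hs1
          (Hs.integrable_toL2 hΩb v) (Hs.integrable_toL2 hΩb w)
          (Hs.hasWeightedGrad_weightedGrad hn hs0 hs1 hΩb w)
      map_smul' := fun c v => (Hs.hasWeightedGrad_weightedGrad hn hs0 hs1 hΩb (c • v)).unique <| by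
        rw [map_smul]
        exact (Hs.hasWeightedGrad_weightedGrad hn hs0 hs1 hΩb v).const_smul c }
    (√(fracLapConst n s / 2)) fun v => (Hs.norm_weightedGrad hn hs0 hs1 hΩb v).le

theorem Hs.norm_grad_sq (hn : 1 ≤ n) (hs0 : 0 < s) (hs1 : s < 1) (hΩb : Bornology.IsBounded Ω)
    (v : Hs s Ω) : ‖Hs.grad hn hs0 hs1 hΩb v‖ ^ 2 = fracLapConst n s / 2 * ‖v‖ ^ 2 := by
  have hC := fracLapConst_pos n hs0 hs1
  rw [← Real.sq_sqrt (by positivity : 0 ≤ fracLapConst n s / 2), ← mul_pow]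
  exact congrArg (· ^ 2) (Hs.norm_weightedGrad hn hs0 hs1 hΩb v)

end SobolevSpace

/-! ### The anisotropic form -/

section AnisotropicForm

theorem norm_apply_le_of_inner_le {F : Type*} [NormedAddCommGroup F] [InnerProductSpace ℝ F]
    {L : F →ₗ[ℝ] F} (hL : L.IsSymmetric) (hpos : ∀ v, 0 ≤ inner ℝ v (L v)) {c : ℝ}
    (hc : ∀ v, inner ℝ v (L v) ≤ c * ‖v‖ ^ 2) (b : F) : ‖L b‖ ≤ c * ‖b‖ := by
  rcases (norm_nonneg b).eq_or_lt' with hb | hb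
  · simp [norm_eq_zero.1 hb]
  rcases (norm_nonneg (L b)).eq_or_lt' with hLb | hLb
  · rw [hLb]
    nlinarith [hpos b, hc b]
  have hcauchy : inner ℝ (L b) (L b) ^ 2 ≤ inner ℝ (L b) (L (L b)) * inner ℝ b (L b) :=
    LinearMap.BilinForm.apply_sq_le_of_symm ((innerₗ F).compl₂ L) hpos
      ⟨fun x y => by simp [hL x y |>.symm, real_inner_comm]⟩ (L b) b
  have hsq : (‖L b‖ ^ 2) ^ 2 ≤ (c * ‖L b‖ ^ 2) * (c * ‖b‖ ^ 2) := by
    rw [real_inner_self_eq_norm_sq] at hcauchy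
    exact hcauchy.trans (mul_le_mul (hc _) (hc b) (hpos b) ((hpos _).trans (hc _)))
  have hcb : 0 ≤ c * ‖b‖ := by nlinarith [hpos b, hc b]
  refine le_of_sq_le_sq ?_ hcb
  nlinarith [pow_pos hLb 2]

variable {n : ℕ} {A : Eucl n → Matrix (Fin n) (Fin n) ℝ} {lmin lmax : ℝ}

theorem IsEllipticTensor.isSymmetric (hA : IsEllipticTensor A lmin lmax) (x : Eucl n) :
    (Matrix.toEuclideanLin (A x)).IsSymmetric :=
  Matrix.isSymmetric_toEuclideanLin_iff.2
    ((Matrix.conjTranspose_eq_transpose_of_trivial _).trans (hA.symm x))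

theorem IsEllipticTensor.norm_le (hA : IsEllipticTensor A lmin lmax) (x v : Eucl n) :
    ‖Matrix.toEuclideanLin (A x) v‖ ≤ lmax * ‖v‖ :=
  norm_apply_le_of_inner_le (hA.isSymmetric x)
    (fun w => (mul_nonneg hA.pos.le (sq_nonneg _)).trans (hA.lower x w)) (hA.upper x) v

theorem IsEllipticTensor.memLp (hA : IsEllipticTensor A lmin lmax)
    (g : Lp (Eucl n) 2 (volume : Measure (Eucl n))) :
    MemLp (fun x => Matrix.toEuclideanLin (A x) (g x)) 2 := by
  refine (Lp.memLp g).of_le_mul (c := lmax) (Measurable.aestronglyMeasurable ?_)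
    (Eventually.of_forall fun x => hA.norm_le x (g x))
  have hg : Measurable g := (Lp.stronglyMeasurable g).measurable
  refine (WithLp.measurable_toLp 2 _).comp (measurable_pi_iff.2 fun i => ?_)
  change Measurable fun x => ∑ j, A x i j * g x j
  exact Finset.measurable_sum _ fun j _ => (hA.measurable i j).mul (by fun_prop)

/-- Multiplication by the tensor field `A` as a bounded linear map on `L²(ℝⁿ; ℝⁿ)`. -/
def IsEllipticTensor.mulLp (hA : IsEllipticTensor A lmin lmax) :
    Lp (Eucl n) 2 (volume : Measure (Eucl n)) →L[ℝ] Lp (Eucl n) 2 (volume : Measure (Eucl n)) :=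
  LinearMap.mkContinuous
    { toFun := fun g => (hA.memLp g).toLp
      map_add' := fun g g' => by
        rw [← MemLp.toLp_add, MemLp.toLp_eq_toLp_iff]
        filter_upwards [Lp.coeFn_add g g'] with x hx
        rw [hx, Pi.add_apply, Pi.add_apply, map_add]
      map_smul' := fun c g => by
        rw [RingHom.id_apply, ← MemLp.toLp_const_smul, MemLp.toLp_eq_toLp_iff]
        filter_upwards [Lp.coeFn_smul c g] with x hx
        rw [hx, Pi.smul_apply, Pi.smul_apply, map_smul] }
    lmax fun g => Lp.norm_le_mul_norm_of_ae_le_mul <| by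
      filter_upwards [(hA.memLp g).coeFn_toLp] with x hx
      exact hx ▸ hA.norm_le x (g x)

theorem IsEllipticTensor.coeFn_mulLp (hA : IsEllipticTensor A lmin lmax)
    (g : Lp (Eucl n) 2 (volume : Measure (Eucl n))) :
    hA.mulLp g =ᵐ[volume] fun x => Matrix.toEuclideanLin (A x) (g x) :=
  (hA.memLp g).coeFn_toLp

theorem IsEllipticTensor.inner_mulLp (hA : IsEllipticTensor A lmin lmax)
    (g g' : Lp (Eucl n) 2 (volume : Measure (Eucl n))) :
    inner ℝ g (hA.mulLp g') = ∫ x, inner ℝ (g x) (Matrix.toEuclideanLin (A x) (g' x)) := by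
  rw [L2.inner_def]
  refine integral_congr_ae ?_
  filter_upwards [hA.coeFn_mulLp g'] with x hx
  rw [hx]

theorem IsEllipticTensor.inner_mulLp_comm (hA : IsEllipticTensor A lmin lmax)
    (g g' : Lp (Eucl n) 2 (volume : Measure (Eucl n))) :
    inner ℝ g (hA.mulLp g') = inner ℝ g' (hA.mulLp g) := by
  rw [hA.inner_mulLp, hA.inner_mulLp]
  refine integral_congr_ae (Eventually.of_forall fun x => ?_)
  dsimp only
  rw [← hA.isSymmetric x, real_inner_comm]

theorem IsEllipticTensor.le_inner_mulLp (hA : IsEllipticTensor A lmin lmax)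
    (g : Lp (Eucl n) 2 (volume : Measure (Eucl n))) :
    lmin * ‖g‖ ^ 2 ≤ inner ℝ g (hA.mulLp g) := by
  rw [← real_inner_self_eq_norm_sq, L2.inner_def, L2.inner_def, ← integral_const_mul]
  refine integral_mono_ae ((L2.integrable_inner g g).const_mul lmin)
    (L2.integrable_inner g (hA.mulLp g)) ?_
  filter_upwards [hA.coeFn_mulLp g] with x hx
  rw [hx, real_inner_self_eq_norm_sq]
  exact hA.lower x (g x)

variable {s : ℝ} {Ω : Set (Eucl n)}

/-- The form `ℬ_{ω;A}` as a bounded bilinear form on `H^s_Ω`. -/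
def Hs.form (hn : 1 ≤ n) (hs0 : 0 < s) (hs1 : s < 1) (hΩb : Bornology.IsBounded Ω)
    (hA : IsEllipticTensor A lmin lmax) : Hs s Ω →L[ℝ] Hs s Ω →L[ℝ] ℝ :=
  (isBoundedBilinearMap_inner (𝕜 := ℝ)).toContinuousLinearMap.bilinearComp
    (Hs.grad hn hs0 hs1 hΩb) (hA.mulLp ∘L Hs.grad hn hs0 hs1 hΩb)

theorem Hs.form_apply (hn : 1 ≤ n) (hs0 : 0 < s) (hs1 : s < 1) (hΩb : Bornology.IsBounded Ω)
    (hA : IsEllipticTensor A lmin lmax) (u v : Hs s Ω) :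
    Hs.form hn hs0 hs1 hΩb hA u v = anisoForm s A (Hs.toL2 u) (Hs.toL2 v) :=
  hA.inner_mulLp _ _

theorem Hs.form_comm (hn : 1 ≤ n) (hs0 : 0 < s) (hs1 : s < 1) (hΩb : Bornology.IsBounded Ω)
    (hA : IsEllipticTensor A lmin lmax) (u v : Hs s Ω) :
    Hs.form hn hs0 hs1 hΩb hA u v = Hs.form hn hs0 hs1 hΩb hA v u :=
  hA.inner_mulLp_comm _ _

theorem Hs.le_form_self (hn : 1 ≤ n) (hs0 : 0 < s) (hs1 : s < 1) (hΩb : Bornology.IsBounded Ω)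
    (hA : IsEllipticTensor A lmin lmax) (u : Hs s Ω) :
    fracLapConst n s / 2 * lmin * ‖u‖ ^ 2 ≤ Hs.form hn hs0 hs1 hΩb hA u u := by
  rw [mul_right_comm, ← Hs.norm_grad_sq hn hs0 hs1 hΩb, mul_comm]
  exact hA.le_inner_mulLp (Hs.grad hn hs0 hs1 hΩb u)

end AnisotropicForm

/-! ### Completeness of `H^s_Ω` -/

section HilbertSpace

variable {n : ℕ} {s : ℝ} {Ω : Set (Eucl n)}

theorem le_enorm_diffQuot_sq (hs0 : 0 < s) {v : Eucl n → ℝ} {p : Eucl n × Eucl n} {d : ℝ}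
    (hv : v p.2 = 0) (hne : p.1 ≠ p.2) (hd : ‖p.1 - p.2‖ ≤ d) :
    ENNReal.ofReal ((d ^ ((n : ℝ) / 2 + s))⁻¹ ^ 2) * ‖v p.1‖ₑ ^ 2 ≤ ‖diffQuot s v p‖ₑ ^ 2 := by
  have hpos : 0 < ‖p.1 - p.2‖ := norm_pos_iff.2 (sub_ne_zero.2 hne)
  have hd0 : 0 < d := hpos.trans_le hd
  rw [enorm_sq_eq_ofReal, enorm_sq_eq_ofReal, ← ENNReal.ofReal_mul (by positivity), ← mul_pow,
    diffQuot, hv, sub_zero, norm_div, div_eq_inv_mul ‖v p.1‖,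
    Real.norm_of_nonneg (Real.rpow_nonneg hpos.le _)]
  gcongr

/-- The values of `v` on `Ω` are compared with its zero values on a set `B` away from `Ω`. -/
theorem Hs.measure_mul_enorm_sq_le (hs0 : 0 < s) {S B : Set (Eucl n)} (hS : MeasurableSet S)
    (hB : MeasurableSet B) (hΩS : Ω ⊆ S) (hSB : Disjoint S B) {d : ℝ}
    (hd : ∀ x ∈ S, ∀ y ∈ B, ‖x - y‖ ≤ d) (v : Hs s Ω) :
    ENNReal.ofReal ((d ^ ((n : ℝ) / 2 + s))⁻¹ ^ 2) * volume B * ‖Hs.toL2 v‖ₑ ^ 2 ≤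
      ENNReal.ofReal (‖v‖ ^ 2) := by
  set k := ENNReal.ofReal ((d ^ ((n : ℝ) / 2 + s))⁻¹ ^ 2)
  have : Measurable (Hs.toL2 v) := (Lp.stronglyMeasurable _).measurable
  have hzero := (Measure.quasiMeasurePreserving_snd
    (μ := (volume : Measure (Eucl n))) (ν := (volume : Measure (Eucl n)))).ae (Hs.ae_eq_zero v)
  have hnorm : ∫⁻ x in S, ‖Hs.toL2 v x‖ₑ ^ 2 = ‖Hs.toL2 v‖ₑ ^ 2 := by
    rw [Lp.enorm_def, ← lintegral_enorm_sq_eq, ← lintegral_indicator hS]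
    refine lintegral_congr_ae ?_
    filter_upwards [Hs.indicator_toL2 hΩS v] with x hx
    by_cases hxS : x ∈ S
    · rw [Set.indicator_of_mem hxS]
    · rw [Set.indicator_of_notMem hxS] at hx ⊢
      simp [← hx]
  calc k * volume B * ‖Hs.toL2 v‖ₑ ^ 2
      = ∫⁻ p in S ×ˢ B, k * ‖Hs.toL2 v p.1‖ₑ ^ 2 * 1
          ∂((volume : Measure (Eucl n)).prod volume) := by
        rw [← Measure.prod_restrict, lintegral_prod_mul (f := fun x => k * ‖Hs.toL2 v x‖ₑ ^ 2)
          (g := fun _ => 1) (by fun_prop) (by fun_prop), lintegral_const_mul _ (by fun_prop),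
          hnorm, lintegral_one, Measure.restrict_apply_univ, mul_right_comm]
    _ ≤ ∫⁻ p in S ×ˢ B, ‖diffQuot s (Hs.toL2 v) p‖ₑ ^ 2
          ∂((volume : Measure (Eucl n)).prod volume) := by
        refine lintegral_mono_ae ?_
        filter_upwards [ae_restrict_of_ae hzero, ae_restrict_mem (hS.prod hB)] with p hp hmem
        rw [mul_one]
        exact le_enorm_diffQuot_sq hs0
          (hp fun hΩ => hSB.notMem_of_mem_left (hΩS hΩ) hmem.2)
          (hSB.ne_of_mem hmem.1 hmem.2) (hd _ hmem.1 _ hmem.2)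
    _ ≤ ENNReal.ofReal (‖v‖ ^ 2) :=
        (setLIntegral_le_lintegral _ _).trans_eq (Hs.lintegral_diffQuot_sq v)

theorem poincareOn_of_ofReal_mul_le {m : ℝ} (hm : 0 < m)
    (h : ∀ v : Hs s Ω, ENNReal.ofReal m * ‖Hs.toL2 v‖ₑ ^ 2 ≤ ENNReal.ofReal (‖v‖ ^ 2)) :
    PoincareOn s Ω (√m)⁻¹ := by
  intro v
  have hv := h v
  rw [enorm_sq_eq_ofReal, ← ENNReal.ofReal_mul hm.le,
    ENNReal.ofReal_le_ofReal_iff (by positivity)] at hv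
  rw [← div_eq_inv_mul, le_div_iff₀ (by positivity), mul_comm]
  refine le_of_sq_le_sq ?_ (norm_nonneg v)
  rwa [mul_pow, Real.sq_sqrt hm.le]

theorem exists_poincareOn (hn : 1 ≤ n) (hs0 : 0 < s) (hΩb : Bornology.IsBounded Ω) :
    ∃ C : ℝ, PoincareOn s Ω C := by
  have : Nonempty (Fin n) := ⟨⟨0, hn⟩⟩
  obtain ⟨R, hR, hΩR⟩ := hΩb.subset_ball_lt 0 0
  obtain ⟨p, hp⟩ := exists_norm_eq (Eucl n) (by positivity : 0 ≤ 3 * R)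
  have hdisj : Disjoint (Metric.ball 0 R) (Metric.ball p R) :=
    Metric.ball_disjoint_ball (by rw [dist_zero_left, hp]; linarith)
  have hdist : ∀ x ∈ Metric.ball 0 R, ∀ y ∈ Metric.ball p R, ‖x - y‖ ≤ 5 * R := by
    intro x hx y hy
    rw [mem_ball_zero_iff] at hx
    rw [mem_ball_iff_norm'] at hy
    linarith [norm_sub_le_norm_sub_add_norm_sub x p y, norm_sub_le x p]
  have hvol : 0 < volume.real (Metric.ball p R) :=
    ENNReal.toReal_pos (Metric.measure_ball_pos _ _ hR).ne' measure_ball_lt_top.ne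
  refine ⟨_, poincareOn_of_ofReal_mul_le
    (m := ((5 * R) ^ ((n : ℝ) / 2 + s))⁻¹ ^ 2 * volume.real (Metric.ball p R))
    (by positivity) fun v => ?_⟩
  rw [ENNReal.ofReal_mul (by positivity), ofReal_measureReal measure_ball_lt_top.ne]
  exact Hs.measure_mul_enorm_sq_le hs0 measurableSet_ball measurableSet_ball hΩR hdisj hdist v

theorem Hs.toL2_injective : Function.Injective (Hs.toL2 : Hs s Ω →ₗ[ℝ] L2 n) :=
  Subtype.val_injective

/-- The norm of `H^s_Ω` is definite as soon as a Poincaré inequality holds. -/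
abbrev Hs.normedAddCommGroup {C : ℝ} (hC : PoincareOn s Ω C) : NormedAddCommGroup (Hs s Ω) :=
  NormedAddCommGroup.ofSeparation fun v hv => by
    refine Hs.toL2_injective ?_
    rw [map_zero, ← norm_le_zero_iff]
    simpa [hv] using hC v

/-- The inclusion of `H^s_Ω` in `L²(ℝⁿ)` as a bounded linear map. -/
def Hs.toL2CLM {C : ℝ} (hC : PoincareOn s Ω C) : Hs s Ω →L[ℝ] L2 n :=
  Hs.toL2.mkContinuous C hC

theorem ae_eq_zero_of_tendsto {u : ℕ → Hs s Ω} {v : L2 n}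
    (hv : ∀ᵐ x, Tendsto (fun k => Hs.toL2 (u k) x) atTop (𝓝 (v x))) :
    ∀ᵐ x, x ∉ Ω → v x = 0 := by
  filter_upwards [hv, ae_all_iff.2 fun k => Hs.ae_eq_zero (u k)] with x hx hzero hxΩ
  refine tendsto_nhds_unique hx ?_
  simp only [hzero _ hxΩ, tendsto_const_nhds]

theorem diffQuot_ae_eq_of_tendsto {u : ℕ → Hs s Ω} {v : L2 n}
    {q : Lp ℝ 2 ((volume : Measure (Eucl n)).prod (volume : Measure (Eucl n)))}
    (hv : ∀ᵐ x, Tendsto (fun k => Hs.toL2 (u k) x) atTop (𝓝 (v x)))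
    (hq : Tendsto (fun k => Hs.quot (u k)) atTop (𝓝 q)) :
    diffQuot s v =ᵐ[(volume : Measure (Eucl n)).prod volume] q := by
  obtain ⟨ns, hns, hqns⟩ := (tendstoInMeasure_of_tendsto_Lp hq).exists_seq_tendsto_ae
  have hquot : ∀ᵐ p ∂((volume : Measure (Eucl n)).prod volume), ∀ k,
      Hs.quot (u k) p = diffQuot s (Hs.toL2 (u k)) p :=
    ae_all_iff.2 fun k => (Hs.memLp_diffQuot (u k)).coeFn_toLp
  filter_upwards [(Measure.quasiMeasurePreserving_fst
      (μ := (volume : Measure (Eucl n))) (ν := (volume : Measure (Eucl n)))).ae hv,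
    (Measure.quasiMeasurePreserving_snd
      (μ := (volume : Measure (Eucl n))) (ν := (volume : Measure (Eucl n)))).ae hv,
    hquot, hqns] with p hfst hsnd hp hlim
  have hlim' : Tendsto (fun k => diffQuot s (Hs.toL2 (u k)) p) atTop (𝓝 (diffQuot s v p)) :=
    (hfst.sub hsnd).div_const _
  simp only [hp] at hlim
  exact tendsto_nhds_unique (hlim'.comp hns.tendsto_atTop) hlim

theorem Hs.exists_quot_eq_of_tendsto {u : ℕ → Hs s Ω} {v : L2 n}
    {q : Lp ℝ 2 ((volume : Measure (Eucl n)).prod (volume : Measure (Eucl n)))}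
    (hv : Tendsto (fun k => Hs.toL2 (u k)) atTop (𝓝 v))
    (hq : Tendsto (fun k => Hs.quot (u k)) atTop (𝓝 q)) : ∃ w : Hs s Ω, Hs.quot w = q := by
  obtain ⟨ns, hns, hvns⟩ := (tendstoInMeasure_of_tendsto_Lp hv).exists_seq_tendsto_ae
  have hdiff := diffQuot_ae_eq_of_tendsto hvns (hq.comp hns.tendsto_atTop)
  have hmem : MemLp (diffQuot s v) 2 ((volume : Measure (Eucl n)).prod volume) :=
    (memLp_congr_ae hdiff).2 (Lp.memLp q)
  exact ⟨⟨v, hmem, ae_eq_zero_of_tendsto hvns⟩, Lp.ext (hmem.coeFn_toLp.trans hdiff)⟩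

theorem Hs.completeSpace {C : ℝ} (hC : PoincareOn s Ω C) : CompleteSpace (Hs s Ω) := by
  refine Metric.complete_of_cauchySeq_tendsto fun u hu => ?_
  have hisom : Isometry (Hs.quot : Hs s Ω → _) :=
    AddMonoidHomClass.isometry_of_norm _ fun w => (Hs.norm_eq w).symm
  have hL2 : CauchySeq fun k => Hs.toL2 (u k) := hu.map (Hs.toL2CLM hC).uniformContinuous
  have hquot : CauchySeq fun k => Hs.quot (u k) := hu.map hisom.uniformContinuous
  obtain ⟨v, hv⟩ := cauchySeq_tendsto_of_complete hL2
  obtain ⟨q, hq⟩ := cauchySeq_tendsto_of_complete hquot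
  obtain ⟨w, rfl⟩ := Hs.exists_quot_eq_of_tendsto hv hq
  exact ⟨w, hisom.isUniformInducing.isInducing.tendsto_nhds_iff.2 hq⟩

end HilbertSpace

/-! ### Weak solutions -/

section WeakSolutions

variable {n : ℕ} {s T C : ℝ} {Ω : Set (Eucl n)} {A : Eucl n → Matrix (Fin n) (Fin n) ℝ}
  {a : Hs s Ω →L[ℝ] Hs s Ω →L[ℝ] ℝ} {f w : ℝ → StrongDual ℝ (Hs s Ω)} {u₀ : Hs s Ω}
  {u : ℝ → Hs s Ω} {U U' : ℝ → L2 n}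

theorem Hs.integrable_dual_apply_const (hC : PoincareOn s Ω C) (hw : MemLp w 2 (timeMeasure T))
    (v : Hs s Ω) : Integrable (fun t => w t v) (timeMeasure T) :=
  let _ := Hs.normedAddCommGroup hC
  integrable_dual_apply hw (memLp_const v)

theorem IsContRep.eqOn (hT : 0 < T) (hU : IsContRep T u U) (hU' : IsContRep T u U') :
    Set.EqOn U U' (Set.Icc 0 T) :=
  eqOn_of_ae_timeMeasure hT hU.1 hU'.1 (EventuallyEq.trans hU.2 (EventuallyEq.symm hU'.2))

theorem isTimeDeriv_of_inner_eq (hC : PoincareOn s Ω C) (hT : 0 ≤ T)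
    (hw : MemLp w 2 (timeMeasure T)) (hU : IsContRep T u U) {g : L2 n}
    (h : ∀ t ∈ Set.Icc 0 T, ∀ v : Hs s Ω,
      inner ℝ (U t) (Hs.toL2 v) = inner ℝ g (Hs.toL2 v) + ∫ r in (0 : ℝ)..t, w r v) :
    IsTimeDeriv T u w := by
  intro φ hφ _ hφs v
  rw [← integral_deriv_mul_add_primitive hT (inner ℝ g (Hs.toL2 v))
    (Hs.integrable_dual_apply_const hC hw v) hφ hφs]
  refine integral_congr_ae ?_
  filter_upwards [hU.2, ae_timeMeasure_mem T] with t hUt ht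
  rw [← hUt, h t ht v]

theorem IsTimeDeriv.inner_eq (hC : PoincareOn s Ω C) (hT : 0 < T) (huw : IsTimeDeriv T u w)
    (hw : MemLp w 2 (timeMeasure T)) (hU : IsContRep T u U) {t : ℝ} (ht : t ∈ Set.Icc 0 T)
    (v : Hs s Ω) :
    inner ℝ (U t) (Hs.toL2 v) = inner ℝ (U 0) (Hs.toL2 v) + ∫ r in (0 : ℝ)..t, w r v := by
  refine eq_add_primitive_of_integral_deriv_mul hT (c := fun t => inner ℝ (U t) (Hs.toL2 v))
    (hU.1.inner continuousOn_const) (Hs.integrable_dual_apply_const hC hw v)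
    (fun φ hφ hφc hφs => ?_) ht
  rw [← huw φ hφ hφc hφs v]
  refine integral_congr_ae ?_
  filter_upwards [hU.2] with r hr
  rw [hr]

theorem IsMildSolution.isWeakSolution (hC : PoincareOn s Ω C) (hT : 0 ≤ T)
    (ha : ∀ u v, a u v = anisoForm s A (Hs.toL2 u) (Hs.toL2 v))
    (hf : MemLp f 2 (timeMeasure T)) (hu : IsMildSolution Hs.toL2 a T f u₀ u U) :
    IsWeakSolution A T f u₀ u := by
  have hw : MemLp (fun t => f t - a (u t)) 2 (timeMeasure T) :=
    let _ := Hs.normedAddCommGroup hC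
    memLp_dual_sub a hf hu.memLp
  have hU : IsContRep T u U := ⟨hu.continuousOn, hu.ae_eq⟩
  refine ⟨hu.memLp, ⟨_, hw, isTimeDeriv_of_inner_eq hC hT hw hU hu.inner_eq, ?_⟩, U, hU, hu.zero⟩
  exact Eventually.of_forall fun t v => by rw [← ha, sub_apply, sub_add_cancel]

theorem IsWeakSolution.exists_isMildSolution (hC : PoincareOn s Ω C) (hT : 0 < T)
    (ha : ∀ u v, a u v = anisoForm s A (Hs.toL2 u) (Hs.toL2 v))
    (hu : IsWeakSolution A T f u₀ u) : ∃ U : ℝ → L2 n, IsMildSolution Hs.toL2 a T f u₀ u U := by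
  obtain ⟨w, hw, huw, heq⟩ := hu.equation
  obtain ⟨U, hU, hU0⟩ := hu.initial
  refine ⟨U, hu.memLp, hU.1, hU.2, hU0, fun t ht v => ?_⟩
  have hint : ∫ r in (0 : ℝ)..t, w r v = ∫ r in (0 : ℝ)..t, (f r v - a (u r) v) := by
    refine intervalIntegral_congr_timeMeasure ht ?_
    filter_upwards [heq] with r hr
    rw [← hr v, ha, add_sub_cancel_right]
  rw [huw.inner_eq hC hT hw hU ht v, hU0, hint]

theorem IsWeakSolution.unique (hC : PoincareOn s Ω C) (hT : 0 < T)
    (ha : ∀ u v, a u v = anisoForm s A (Hs.toL2 u) (Hs.toL2 v))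
    (hcomm : ∀ u v, a u v = a v u) (hpos : ∀ u, 0 ≤ a u u) (hf : MemLp f 2 (timeMeasure T))
    {u' : ℝ → Hs s Ω} (hu : IsWeakSolution A T f u₀ u) (hu' : IsWeakSolution A T f u₀ u') :
    u =ᵐ[timeMeasure T] u' := by
  let _ := Hs.normedAddCommGroup hC
  have _ := Hs.completeSpace hC
  obtain ⟨U, hU⟩ := hu.exists_isMildSolution hC hT ha
  obtain ⟨U', hU'⟩ := hu'.exists_isMildSolution hC hT ha
  exact IsMildSolution.unique hT.le (ι := Hs.toL2CLM hC) Hs.toL2_injective hcomm hpos hf hU hU'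

theorem Hs.exists_isMildSolution {c : ℝ} (hC : PoincareOn s Ω C) (hT : 0 ≤ T)
    (hcomm : ∀ u v, a u v = a v u) (hc : 0 < c) (hcoer : ∀ u, c * ‖u‖ ^ 2 ≤ a u u)
    (hf : MemLp f 2 (timeMeasure T)) (u₀ : Hs s Ω) :
    ∃ (u : ℝ → Hs s Ω) (U : ℝ → L2 n), IsMildSolution Hs.toL2 a T f u₀ u U ∧
      ∀ t ∈ Set.Icc 0 T, ‖U t‖ ^ 2 + c * ∫ r in (0 : ℝ)..t, ‖u r‖ ^ 2 ≤
        ‖Hs.toL2 u₀‖ ^ 2 + c⁻¹ * ∫ r in (0 : ℝ)..t, ‖f r‖ ^ 2 :=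
  let _ := Hs.normedAddCommGroup hC
  have _ := Hs.completeSpace hC
  FracDiff.exists_isMildSolution (ι := Hs.toL2CLM hC) hT Hs.toL2_injective hcomm hc hcoer hf u₀

end WeakSolutions

theorem inv_le_sq_div_two_mul {c C : ℝ} (hc : 0 < c) (hC : √2 ≤ C) : c⁻¹ ≤ C ^ 2 / (2 * c) := by
  rw [← div_div, inv_eq_one_div]
  have : 2 ≤ C ^ 2 := (Real.sqrt_le_left (by linarith [Real.sqrt_nonneg 2])).1 hC
  gcongr
  linarith

theorem fracLapConst_div_two_mul_pos (n : ℕ) {s : ℝ} (hs0 : 0 < s) (hs1 : s < 1)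
    {A : Eucl n → Matrix (Fin n) (Fin n) ℝ} {lmin lmax : ℝ} (hA : IsEllipticTensor A lmin lmax) :
    0 < fracLapConst n s / 2 * lmin :=
  mul_pos (half_pos (fracLapConst_pos n hs0 hs1)) hA.pos

end FracDiff

end

theorem corollary4p2_general (n : ℕ) (hn : 1 ≤ n) (s : ℝ) (hs0 : 0 < s) (hs1 : s < 1)
    (Ω : Set (FracDiff.Eucl n)) (hΩb : Bornology.IsBounded Ω)
    (A : FracDiff.Eucl n → Matrix (Fin n) (Fin n) ℝ) (lmin lmax : ℝ)
    (hA : FracDiff.IsEllipticTensor A lmin lmax) (T : ℝ) (hT : 0 < T)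
    (f : ℝ → StrongDual ℝ (FracDiff.Hs s Ω)) (hf : MemLp f 2 (FracDiff.timeMeasure T))
    (u₀ : FracDiff.Hs s Ω) :
    (∀ v : FracDiff.Hs s Ω, ∃ g, FracDiff.HasWeightedGrad s (FracDiff.Hs.toL2 v) g) ∧
    (∃ Cp : ℝ, FracDiff.PoincareOn s Ω Cp) ∧
    ∃ u : ℝ → FracDiff.Hs s Ω,
      FracDiff.IsWeakSolution A T f u₀ u ∧
      (∀ u' : ℝ → FracDiff.Hs s Ω, FracDiff.IsWeakSolution A T f u₀ u' →
        u' =ᵐ[FracDiff.timeMeasure T] u) ∧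
      ∀ U : ℝ → FracDiff.L2 n, FracDiff.IsContRep T u U →
        ∀ Ccoer : ℝ, Ccoer = FracDiff.fracLapConst n s / 2 * lmin →
        ∀ t ∈ Set.Icc 0 T,
          ‖U t‖ ^ 2 + Ccoer * ∫ r in (0 : ℝ)..t, ‖u r‖ ^ 2 ≤
            ‖FracDiff.Hs.toL2 u₀‖ ^ 2 + Ccoer⁻¹ * ∫ r in (0 : ℝ)..t, ‖f r‖ ^ 2 := by
  obtain ⟨C, hC⟩ := FracDiff.exists_poincareOn hn hs0 hΩb
  have hc := FracDiff.fracLapConst_div_two_mul_pos n hs0 hs1 hA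
  have hcoer := FracDiff.Hs.le_form_self hn hs0 hs1 hΩb hA
  have hcomm := FracDiff.Hs.form_comm hn hs0 hs1 hΩb hA
  have hform := FracDiff.Hs.form_apply hn hs0 hs1 hΩb hA
  obtain ⟨u, V, hu, henergy⟩ := FracDiff.Hs.exists_isMildSolution hC hT.le hcomm hc hcoer hf u₀
  have hsol : FracDiff.IsWeakSolution A T f u₀ u := hu.isWeakSolution hC hT.le hform hf
  refine ⟨fun v => ⟨_, FracDiff.Hs.hasWeightedGrad_weightedGrad hn hs0 hs1 hΩb v⟩, ⟨C, hC⟩, u,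
    hsol, fun u' hu' => hu'.unique hC hT hform hcomm
      (fun v => (mul_nonneg hc.le (sq_nonneg _)).trans (hcoer v)) hf hsol, ?_⟩
  rintro U hU _ rfl t ht
  have hUV : U t = V t := hU.eqOn hT ⟨hu.continuousOn, hu.ae_eq⟩ ht
  rw [hUV]
  exact henergy t ht

theorem corollary4p2 (n : ℕ) (hn : 1 ≤ n) (s : ℝ) (hs0 : 0 < s) (hs1 : s < 1)
    (Ω : Set (FracDiff.Eucl n)) (hΩo : IsOpen Ω) (hΩb : Bornology.IsBounded Ω)
    (A : FracDiff.Eucl n → Matrix (Fin n) (Fin n) ℝ) (lmin lmax : ℝ)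
    (hA : FracDiff.IsEllipticTensor A lmin lmax) (T : ℝ) (hT : 0 < T)
    (f : ℝ → StrongDual ℝ (FracDiff.Hs s Ω)) (hf : MemLp f 2 (FracDiff.timeMeasure T))
    (u₀ : FracDiff.Hs s Ω) :
    (∀ v : FracDiff.Hs s Ω, ∃ g, FracDiff.HasWeightedGrad s (FracDiff.Hs.toL2 v) g) ∧
    (∃ Cp : ℝ, FracDiff.PoincareOn s Ω Cp) ∧
    ∃ u : ℝ → FracDiff.Hs s Ω,
      FracDiff.IsWeakSolution A T f u₀ u ∧
      (∀ u' : ℝ → FracDiff.Hs s Ω, FracDiff.IsWeakSolution A T f u₀ u' →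
        u' =ᵐ[FracDiff.timeMeasure T] u) ∧
      ∀ U : ℝ → FracDiff.L2 n, FracDiff.IsContRep T u U →
        ∀ Ccoer : ℝ, Ccoer = FracDiff.fracLapConst n s / 2 * lmin →
        ∀ Cp : ℝ, √2 ≤ Cp → FracDiff.PoincareOn s Ω Cp →
        ∀ t ∈ Set.Icc 0 T,
          ‖U t‖ ^ 2 + Ccoer * ∫ r in (0 : ℝ)..t, ‖u r‖ ^ 2 ≤
            ‖FracDiff.Hs.toL2 u₀‖ ^ 2 + Cp ^ 2 / (2 * Ccoer) * ∫ r in (0 : ℝ)..t, ‖f r‖ ^ 2 := by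
  obtain ⟨hgrad, hpoincare, u, hsol, hunique, henergy⟩ :=
    corollary4p2_general n hn s hs0 hs1 Ω hΩb A lmin lmax hA T hT f hf u₀
  refine ⟨hgrad, hpoincare, u, hsol, hunique, ?_⟩
  rintro U hU Ccoer rfl Cp hCp - t ht
  have hc := FracDiff.fracLapConst_div_two_mul_pos n hs0 hs1 hA
  have hf_nonneg : 0 ≤ ∫ r in (0 : ℝ)..t, ‖f r‖ ^ 2 :=
    intervalIntegral.integral_nonneg ht.1 fun _ _ => sq_nonneg _
  grw [henergy U hU _ rfl t ht, FracDiff.inv_le_sq_div_two_mul hc hCp]
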